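/- Fix a DLE-language $\mathcal{L}=\mathcal{L}(\mathcal{F},\mathcal{G})$: disjoint sets $\mathcal{F},\mathcal{G}$ of connectives, each connective $h$ with a finite arity $n_h$ and an order type $\varepsilon_h\in\{1,\partial\}^{n_h}$. Formulas are built from countably many letters with $\top,\bot,\wedge,\vee$ and these connectives. The expanded language $\mathcal{L}^*=\mathcal{L}(\mathcal{F}^*,\mathcal{G}^*)$ adds the residuals $\rightarrow,\leftarrow$ of $\wedge$ (in $\mathcal{G}^*$), the residuals $>\!\!-,\,-\!\!<$ of $\vee$ (in $\mathcal{F}^*$), and for each $f\in\mathcal{F}$ (resp. $g\in\mathcal{G}$) and each coordinate $i$ the residual or Galois-adjoint $f^\sharp_i$ (in $\mathcal{G}^*$ if $\varepsilon_f(i)=1$, else in $\mathcal{F}^*$) (resp. $g^\flat_i$, in $\mathcal{F}^*$ if $\varepsilon_g(i)=1$, else in $\mathcal{G}^*$). A DLE-logic is an axiomatic extension (a set of sequents $\varphi\vdash\psi$) of the basic logic $\mathbf{L}_{\mathrm{DLE}}$ of normal distributive lattice expansions; a tense DLE-logic, or DLE$^*$-logic, is an axiomatic extension, in the language $\mathcal{L}^*$,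 of the basic bi-intuitionistic tense logic $\mathbf{L}^*_{\mathrm{DLE}}$ (the basic logic of $\mathcal{L}^*$ closed under all residuation rules). Let $\mathbf{DL}$ (resp. $\mathbf{DL}^*$) be the display calculus for $\mathbf{L}_{\mathrm{DLE}}$ (resp. $\mathbf{L}^*_{\mathrm{DLE}}$). Both use the same structural connectives: $\mathrm{I}$, $;$, $>$, $<$, $H$ for $f\in\mathcal{F}$, $K$ for $g\in\mathcal{G}$, and $H_i$, $K_h$ for the residuals. Sequents $S\vdash T$ are such that each structural connective of $S$ (resp. $T$) has a logical counterpart in $\mathcal{L}^*$ for the precedent/succedent position in which it occurs. A structural rule has finitely many premises and a conclusion that are sequents of structural terms over structure variables, and its instances are its substitution instances. It is interpretable if its premises and its conclusion satisfy the same condition. It is analytic if it satisfies C$_1$–C$_7$, i.e.: every variable of a premise occurs in the conclusion (C$_1$); every variable occurs at most once in the conclusion (C$_3$); no variable occurs in a premise in precedent (resp. succedent) position and in the conclusion in succedent (resp. precedent) position (C$_4$). It is special if it is analytic and of the form $(X\vdash T_i)_{i\le n}/X\vdash T$ with $X$ a variable not occurring in $T,T_1,\dots,T_n$, or $(S_i\vdash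 Y)_{i\le n}/S\vdash Y$ with $Y$ a variable not occurring in $S,S_1,\dots,S_n$. Two interpretable rules are equivalent if they are valid on the same perfect $\mathcal{L}$-algebras (perfect distributive lattices in which each $f$ (resp. $g$) is, in each coordinate, completely join- (resp. meet-) preserving or completely meet- (resp. join-) reversing), where structural connectives are interpreted according to position as the corresponding connectives of $\mathcal{L}^*$. A DLE-logic is properly (resp. specially) displayable if the formula-sequents in it are exactly those derivable in $\mathbf{DL}$ extended with some set of analytic (resp. special) rules; a tense DLE-logic is properly displayable if its sequents are exactly the formula-sequents derivable in $\mathbf{DL}^*$ extended with some set of analytic rules. Left-primitive formulas $\psi$ and right-primitive formulas $\phi$ are given by $\psi::=p\mid\top\mid\psi\vee\psi\mid\psi\wedge\psi\mid f(\vec\psi,\vec\phi)$ and $\phi::=p\mid\bot\mid\phi\wedge\phi\mid\phi\vee\phi\mid g(\vec\phi,\vec\psi)$, where the first array fills the coordinates of order type $1$ and the second those of order type $\partial$. An inequality $s_1\le s_2$ is left-primitive (resp. right-primitive) if both sides are left-primitive (resp. right-primitive), every letter occurs at most once in the head $s_1$ (resp. $s_2$), all occurrences of each letter in the other side have the same sign,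 and the common letters occur with the same sign in both sides; it is primitive if it is left- or right-primitive. Then: 1. Every interpretable analytic structural rule in the language of $\mathbf{DL}$, each of whose premises contains at least one structure variable, is equivalent to some interpretable special structural rule in the same language. 2. Every properly displayable DLE-logic in the language $\mathcal{L}$ is specially displayable. 3. Every properly displayable tense DLE-logic is the extension of $\mathbf{L}^*_{\mathrm{DLE}}$ by some set of primitive $\mathcal{L}^*$-inequalities. -/

import Mathlib

universe u v w

/-! ### Signs, languages and formulas -/

/-- Signs. They serve both as entries of order types (`pos` is `1`, `neg` is `∂`) and as positions in
sequents or signs in generation trees (`pos` is precedent, i.e. `+`; `neg` is succedent, i.e. `-`). -/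
inductive Sgn : Type
  | pos
  | neg
  deriving DecidableEq

namespace Sgn

/-- The opposite sign. -/
def opp : Sgn → Sgn
  | pos => neg
  | neg => pos

/-- `s.act e` is the sign of a coordinate of order type `e` of a node of sign `s`. -/
def act : Sgn → Sgn → Sgn
  | s, pos => s
  | s, neg => s.opp

end Sgn

/-- A DLE-language `L(F, G)`: two (disjoint) sets of connectives with arities and order types. -/
structure DLELang : Type (u + 1) where
  F : Type u
  G : Type u
  arF : F → ℕ
  arG : G → ℕ
  epsF : (f : F) → Fin (arF f) → Sgn
  epsG : (g : G) → Fin (arG g) → Sgn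

/-- Formulas of a DLE-language over the denumerable set `ℕ` of proposition letters. -/
inductive Form (L : DLELang.{u}) : Type u
  | var (p : ℕ) : Form L
  | top : Form L
  | bot : Form L
  | and (φ ψ : Form L) : Form L
  | or (φ ψ : Form L) : Form L
  | opF (f : L.F) (a : Fin (L.arF f) → Form L) : Form L
  | opG (g : L.G) (a : Fin (L.arG g) → Form L) : Form L

namespace Form

variable {L : DLELang.{u}}

/-- Uniform substitution. -/
def subst (σ : ℕ → Form L) : Form L → Form L
  | var p => σ p
  | top => top
  | bot => bot
  | and φ ψ => and (subst σ φ) (subst σ ψ)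
  | or φ ψ => or (subst σ φ) (subst σ ψ)
  | opF f a => opF f fun i => subst σ (a i)
  | opG g a => opG g fun i => subst σ (a i)

/-- `φ.occ t p` is the number of occurrences of the letter `p` that carry the sign `t` in the
positive generation tree of `φ`. -/
def occ : Form L → Sgn → ℕ → ℕ
  | var q, t, p => if q = p ∧ t = Sgn.pos then 1 else 0
  | top, _, _ => 0
  | bot, _, _ => 0
  | and φ ψ, t, p => occ φ t p + occ ψ t p
  | or φ ψ, t, p => occ φ t p + occ ψ t p
  | opF f a, t, p => ∑ i, occ (a i) (t.act (L.epsF f i)) p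
  | opG g a, t, p => ∑ i, occ (a i) (t.act (L.epsG g i)) p

/-- `Prim pos φ`: the formula `φ` is left-primitive; `Prim neg φ`: it is right-primitive.
`ψ ::= p | ⊤ | ψ ∨ ψ | ψ ∧ ψ | f(ψ, φ)` and `φ ::= p | ⊥ | φ ∧ φ | φ ∨ φ | g(φ, ψ)`. -/
def Prim : Sgn → Form L → Prop
  | _, var _ => True
  | s, top => s = Sgn.pos
  | s, bot => s = Sgn.neg
  | s, and φ ψ => Prim s φ ∧ Prim s ψ
  | s, or φ ψ => Prim s φ ∧ Prim s ψ
  | s, opF f a => s = Sgn.pos ∧ ∀ i, Prim (s.act (L.epsF f i)) (a i)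
  | s, opG g a => s = Sgn.neg ∧ ∀ i, Prim (s.act (L.epsG g i)) (a i)

/-- Each proposition letter occurs at most once. -/
def Scattered (φ : Form L) : Prop :=
  ∀ p, φ.occ Sgn.pos p + φ.occ Sgn.neg p ≤ 1

/-- All the occurrences of any given letter have the same sign. -/
def Uniform (φ : Form L) : Prop :=
  ∀ p, φ.occ Sgn.pos p = 0 ∨ φ.occ Sgn.neg p = 0

/-- No letter occurs with some sign in `φ` and with the opposite sign in `ψ`. -/
def SameOrderType (φ ψ : Form L) : Prop :=
  ∀ p t, φ.occ t p = 0 ∨ ψ.occ t.opp p = 0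

/-- The inequality `φ ≤ ψ` is left-primitive: the head `φ` is scattered, the tail `ψ` uniform. -/
def LeftPrimitiveIneq (φ ψ : Form L) : Prop :=
  Prim Sgn.pos φ ∧ Prim Sgn.pos ψ ∧ Scattered φ ∧ SameOrderType φ ψ ∧ Uniform ψ

/-- The inequality `φ ≤ ψ` is right-primitive: the head `ψ` is scattered, the tail `φ` uniform. -/
def RightPrimitiveIneq (φ ψ : Form L) : Prop :=
  Prim Sgn.neg φ ∧ Prim Sgn.neg ψ ∧ Scattered ψ ∧ SameOrderType φ ψ ∧ Uniform φ

/-- The inequality `φ ≤ ψ` is primitive. -/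
def PrimitiveIneq (φ ψ : Form L) : Prop :=
  LeftPrimitiveIneq φ ψ ∨ RightPrimitiveIneq φ ψ

end Form

/-! ### The expanded language -/

/-- The connectives in `F*`: those of `F`, the two left residuals of `∨`, the Galois-adjoints
`f♯ᵢ` with `ε_f(i) = ∂` and the left residuals `g♭ᵢ` with `ε_g(i) = 1`. -/
inductive StarF (L : DLELang.{u}) : Type u
  | base (f : L.F) : StarF L
  | coimp : StarF L
  | coimp' : StarF L
  | adjF (f : L.F) (i : Fin (L.arF f)) (h : L.epsF f i = Sgn.neg) : StarF L
  | adjG (g : L.G) (i : Fin (L.arG g)) (h : L.epsG g i = Sgn.pos) : StarF L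

/-- The connectives in `G*`: those of `G`, the two right residuals of `∧`, the right residuals
`f♯ᵢ` with `ε_f(i) = 1` and the Galois-adjoints `g♭ᵢ` with `ε_g(i) = ∂`. -/
inductive StarG (L : DLELang.{u}) : Type u
  | base (g : L.G) : StarG L
  | imp : StarG L
  | imp' : StarG L
  | adjF (f : L.F) (i : Fin (L.arF f)) (h : L.epsF f i = Sgn.pos) : StarG L
  | adjG (g : L.G) (i : Fin (L.arG g)) (h : L.epsG g i = Sgn.neg) : StarG L

/-- The order type of the residual in the `i`-th coordinate of a connective of order type `e`. -/
def adjEps {n : ℕ} (e : Fin n → Sgn) (i j : Fin n) : Sgn :=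
  if j = i then e i
  else match e i with
    | Sgn.pos => (e j).opp
    | Sgn.neg => e j

abbrev starArF (L : DLELang.{u}) : StarF L → ℕ
  | .base f => L.arF f
  | .coimp => 2
  | .coimp' => 2
  | .adjF f _ _ => L.arF f
  | .adjG g _ _ => L.arG g

abbrev starArG (L : DLELang.{u}) : StarG L → ℕ
  | .base g => L.arG g
  | .imp => 2
  | .imp' => 2
  | .adjF f _ _ => L.arF f
  | .adjG g _ _ => L.arG g

abbrev starEpsF (L : DLELang.{u}) : (c : StarF L) → Fin (starArF L c) → Sgn
  | .base f => L.epsF f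
  | .coimp => ![Sgn.neg, Sgn.pos]
  | .coimp' => ![Sgn.pos, Sgn.neg]
  | .adjF f i _ => adjEps (L.epsF f) i
  | .adjG g i _ => adjEps (L.epsG g) i

abbrev starEpsG (L : DLELang.{u}) : (c : StarG L) → Fin (starArG L c) → Sgn
  | .base g => L.epsG g
  | .imp => ![Sgn.neg, Sgn.pos]
  | .imp' => ![Sgn.pos, Sgn.neg]
  | .adjF f i _ => adjEps (L.epsF f) i
  | .adjG g i _ => adjEps (L.epsG g) i

/-- The expanded language `L* = L(F*, G*)`. -/
abbrev DLELang.star (L : DLELang.{u}) : DLELang.{u} where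
  F := StarF L
  G := StarG L
  arF := starArF L
  arG := starArG L
  epsF := starEpsF L
  epsG := starEpsG L

/-! ### Logics -/

/-- The least set closed under the given finitary rules (premises, conclusion). -/
inductive Gen {α : Type u} (rules : List α → α → Prop) : α → Prop
  | step (ps : List α) (c : α) (hr : rules ps c) (hp : ∀ p ∈ ps, Gen rules p) : Gen rules c

/-- Formula-sequents `φ ⊢ ψ` (also read as inequalities `φ ≤ ψ`), written as pairs. -/
abbrev FSeq (L : DLELang.{u}) : Type u := Form L × Form L

open Form Function in
/-- Axioms and rules of the basic DLE-logic of the language `L`. -/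
inductive LogicRule (L : DLELang.{u}) : List (FSeq L) → FSeq L → Prop
  | refl (φ) : LogicRule L [] (φ, φ)
  | bot_le (φ) : LogicRule L [] (bot, φ)
  | le_top (φ) : LogicRule L [] (φ, top)
  | distrib (φ ψ χ) : LogicRule L [] (and φ (or ψ χ), or (and φ ψ) (and φ χ))
  | le_or_left (φ ψ) : LogicRule L [] (φ, or φ ψ)
  | le_or_right (φ ψ) : LogicRule L [] (ψ, or φ ψ)
  | and_le_left (φ ψ) : LogicRule L [] (and φ ψ, φ)
  | and_le_right (φ ψ) : LogicRule L [] (and φ ψ, ψ)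
  | f_bot (f i a) (h : L.epsF f i = Sgn.pos) : LogicRule L [] (opF f (update a i bot), bot)
  | f_top (f i a) (h : L.epsF f i = Sgn.neg) : LogicRule L [] (opF f (update a i top), bot)
  | g_top (g i a) (h : L.epsG g i = Sgn.pos) : LogicRule L [] (top, opG g (update a i top))
  | g_bot (g i a) (h : L.epsG g i = Sgn.neg) : LogicRule L [] (top, opG g (update a i bot))
  | f_or (f i a φ ψ) (h : L.epsF f i = Sgn.pos) : LogicRule L []
      (opF f (update a i (or φ ψ)), or (opF f (update a i φ)) (opF f (update a i ψ)))
  | f_and (f i a φ ψ) (h : L.epsF f i = Sgn.neg) : LogicRule L []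
      (opF f (update a i (and φ ψ)), or (opF f (update a i φ)) (opF f (update a i ψ)))
  | g_and (g i a φ ψ) (h : L.epsG g i = Sgn.pos) : LogicRule L []
      (and (opG g (update a i φ)) (opG g (update a i ψ)), opG g (update a i (and φ ψ)))
  | g_or (g i a φ ψ) (h : L.epsG g i = Sgn.neg) : LogicRule L []
      (and (opG g (update a i φ)) (opG g (update a i ψ)), opG g (update a i (or φ ψ)))
  | cut (φ χ ψ) : LogicRule L [(φ, χ), (χ, ψ)] (φ, ψ)
  | subst (σ : ℕ → Form L) (φ ψ) : LogicRule L [(φ, ψ)] (φ.subst σ, ψ.subst σ)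
  | and_intro (χ φ ψ) : LogicRule L [(χ, φ), (χ, ψ)] (χ, and φ ψ)
  | or_elim (φ ψ χ) : LogicRule L [(φ, χ), (ψ, χ)] (or φ ψ, χ)
  | f_mono (f i a φ ψ) (h : L.epsF f i = Sgn.pos) :
      LogicRule L [(φ, ψ)] (opF f (update a i φ), opF f (update a i ψ))
  | f_anti (f i a φ ψ) (h : L.epsF f i = Sgn.neg) :
      LogicRule L [(φ, ψ)] (opF f (update a i ψ), opF f (update a i φ))
  | g_mono (g i a φ ψ) (h : L.epsG g i = Sgn.pos) :
      LogicRule L [(φ, ψ)] (opG g (update a i φ), opG g (update a i ψ))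
  | g_anti (g i a φ ψ) (h : L.epsG g i = Sgn.neg) :
      LogicRule L [(φ, ψ)] (opG g (update a i ψ), opG g (update a i φ))

/-- The axiomatic extension of the basic `L`-logic by the set `Ax` of sequents. -/
def dleLogic (L : DLELang.{u}) (Ax : Set (FSeq L)) : Set (FSeq L) :=
  {s | Gen (fun ps c => LogicRule L ps c ∨ (ps = [] ∧ c ∈ Ax)) s}

open Form Function in
/-- The pairs of sequents related by the (invertible) residuation rules of the basic
bi-intuitionistic tense logic. -/
inductive Residuation (L : DLELang.{u}) : FSeq L.star → FSeq L.star → Prop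
  | imp (φ ψ χ) : Residuation L (and φ ψ, χ) (ψ, opG (L := L.star) StarG.imp ![φ, χ])
  | imp' (φ ψ χ) : Residuation L (and φ ψ, χ) (φ, opG (L := L.star) StarG.imp' ![χ, ψ])
  | coimp (φ ψ χ) : Residuation L (φ, or ψ χ) (opF (L := L.star) StarF.coimp ![ψ, φ], χ)
  | coimp' (φ ψ χ) : Residuation L (φ, or ψ χ) (opF (L := L.star) StarF.coimp' ![φ, χ], ψ)
  | f_pos (f : L.F) (i : Fin (L.arF f)) (a : Fin (L.arF f) → Form L.star) (ψ)
      (h : L.epsF f i = Sgn.pos) :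
      Residuation L (opF (L := L.star) (StarF.base f) a, ψ)
        (a i, opG (L := L.star) (StarG.adjF f i h) (update a i ψ))
  | f_neg (f : L.F) (i : Fin (L.arF f)) (a : Fin (L.arF f) → Form L.star) (ψ)
      (h : L.epsF f i = Sgn.neg) :
      Residuation L (opF (L := L.star) (StarF.base f) a, ψ)
        (opF (L := L.star) (StarF.adjF f i h) (update a i ψ), a i)
  | g_pos (g : L.G) (i : Fin (L.arG g)) (a : Fin (L.arG g) → Form L.star) (φ)
      (h : L.epsG g i = Sgn.pos) :
      Residuation L (φ, opG (L := L.star) (StarG.base g) a)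
        (opF (L := L.star) (StarF.adjG g i h) (update a i φ), a i)
  | g_neg (g : L.G) (i : Fin (L.arG g)) (a : Fin (L.arG g) → Form L.star) (φ)
      (h : L.epsG g i = Sgn.neg) :
      Residuation L (φ, opG (L := L.star) (StarG.base g) a)
        (a i, opG (L := L.star) (StarG.adjG g i h) (update a i φ))

/-- The axiomatic extension, by the set `Ax` of `L*`-sequents, of the basic bi-intuitionistic tense
`L`-logic, i.e. of the basic logic of `L*` closed under residuation. -/
def tenseLogic (L : DLELang.{u}) (Ax : Set (FSeq L.star)) : Set (FSeq L.star) :=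
  {s | Gen (fun ps c => LogicRule L.star ps c ∨
      (∃ d, ps = [d] ∧ (Residuation L d c ∨ Residuation L c d)) ∨ (ps = [] ∧ c ∈ Ax)) s}

/-! ### Structures, sequents and structural rules -/

/-- Structures over the language `L`, with leaves in `α`. For `α = ℕ` these are structural terms
over structure variables; for `α` a set of formulas, they are the structures of the calculi. -/
inductive Str (L : DLELang.{u}) (α : Type v) : Type (max u v)
  | leaf (a : α) : Str L α
  | I : Str L α
  | comma (S T : Str L α) : Str L α
  | gt (S T : Str L α) : Str L α
  | lt (S T : Str L α) : Str L α
  | H (f : L.F) (X : Fin (L.arF f) → Str L α) : Str L α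
  | K (g : L.G) (X : Fin (L.arG g) → Str L α) : Str L α
  | Hres (f : L.F) (i : Fin (L.arF f)) (X : Fin (L.arF f) → Str L α) : Str L α
  | Kres (g : L.G) (i : Fin (L.arG g)) (X : Fin (L.arG g) → Str L α) : Str L α

namespace Str

variable {L : DLELang.{u}} {α : Type v} {β : Type w}

/-- `Sided pos S`: `S` is left-sided; `Sided neg S`: `S` is right-sided. That is, each structural
connective in `S` has a logical counterpart in `L*` for the position in which it occurs when `S` is
placed in precedent (resp. succedent) position. -/
def Sided : Sgn → Str L α → Prop
  | _, leaf _ => True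
  | _, I => True
  | s, comma S T => Sided s S ∧ Sided s T
  | s, gt S T => Sided s.opp S ∧ Sided s T
  | s, lt S T => Sided s S ∧ Sided s.opp T
  | s, H f X => s = Sgn.pos ∧ ∀ j, Sided (s.act (L.epsF f j)) (X j)
  | s, K g X => s = Sgn.neg ∧ ∀ j, Sided (s.act (L.epsG g j)) (X j)
  | s, Hres f i X => s = (L.epsF f i).opp ∧ ∀ j, Sided (s.act (adjEps (L.epsF f) i j)) (X j)
  | s, Kres g i X => s = L.epsG g i ∧ ∀ j, Sided (s.act (adjEps (L.epsG g) i j)) (X j)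

/-- Substitution of structures for the leaves. -/
def subst (σ : α → Str L β) : Str L α → Str L β
  | leaf a => σ a
  | I => I
  | comma S T => comma (subst σ S) (subst σ T)
  | gt S T => gt (subst σ S) (subst σ T)
  | lt S T => lt (subst σ S) (subst σ T)
  | H f X => H f fun j => subst σ (X j)
  | K g X => K g fun j => subst σ (X j)
  | Hres f i X => Hres f i fun j => subst σ (X j)
  | Kres g i X => Kres g i fun j => subst σ (X j)

/-- `S.occ t x`: the number of occurrences of the structure variable `x` in position `t` when `S`
itself is in precedent position. -/
def occ : Str L ℕ → Sgn → ℕ → ℕ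
  | leaf y, t, x => if y = x ∧ t = Sgn.pos then 1 else 0
  | I, _, _ => 0
  | comma S T, t, x => occ S t x + occ T t x
  | gt S T, t, x => occ S t.opp x + occ T t x
  | lt S T, t, x => occ S t x + occ T t.opp x
  | H f X, t, x => ∑ j, occ (X j) (t.act (L.epsF f j)) x
  | K g X, t, x => ∑ j, occ (X j) (t.act (L.epsG g j)) x
  | Hres f i X, t, x => ∑ j, occ (X j) (t.act (adjEps (L.epsF f) i j)) x
  | Kres g i X, t, x => ∑ j, occ (X j) (t.act (adjEps (L.epsG g) i j)) x

/-- The structure variable `x` occurs in `S`. -/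
def Mem (x : ℕ) (S : Str L ℕ) : Prop := ∃ t, 0 < S.occ t x

end Str

/-- Sequents `S ⊢ T` of structures. -/
structure StrSeq (L : DLELang.{u}) (α : Type v) : Type (max u v) where
  ant : Str L α
  suc : Str L α

infix:50 " ⊩ " => StrSeq.mk

namespace StrSeq

variable {L : DLELang.{u}} {α : Type v} {β : Type w}

/-- The antecedent is left-sided and the succedent is right-sided. -/
def Sided (c : StrSeq L α) : Prop := c.ant.Sided Sgn.pos ∧ c.suc.Sided Sgn.neg

def subst (σ : α → Str L β) (c : StrSeq L α) : StrSeq L β := c.ant.subst σ ⊩ c.suc.subst σ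

/-- The number of occurrences of the variable `x` in position `t` in the sequent. -/
def occ (c : StrSeq L ℕ) (t : Sgn) (x : ℕ) : ℕ := c.ant.occ t x + c.suc.occ t.opp x

/-- The structure variable `x` occurs in the sequent. -/
def Mem (x : ℕ) (c : StrSeq L ℕ) : Prop := ∃ t, 0 < c.occ t x

end StrSeq

/-- Structural rules in the language of the display calculus for `L`: finitely many premises and a
conclusion, all of them sequents of structural terms over structure variables. -/
structure SRule (L : DLELang.{u}) : Type u where
  prems : List (StrSeq L ℕ)
  concl : StrSeq L ℕ

namespace SRule

variable {L : DLELang.{u}}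

/-- All the sequents in the rule can be translated into formula-sequents. -/
def Sided (ρ : SRule L) : Prop := ρ.concl.Sided ∧ ∀ c ∈ ρ.prems, c.Sided

/-- Analytic structural rules, i.e. those satisfying C1-C7, where two occurrences of parameters are
congruent exactly when they are occurrences of the same structure variable. Since a structural rule
consists of structure variables only, and its instances are all the substitution instances, C2, C5,
C6 and C7 hold automatically. -/
structure IsAnalytic (ρ : SRule L) : Prop where
  /-- C1: no structure variable of a premise disappears in the conclusion. -/
  c1 : ∀ c ∈ ρ.prems, ∀ x, c.Mem x → ρ.concl.Mem x
  /-- C3: no structure variable proliferates in the conclusion. -/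
  c3 : ∀ x, ρ.concl.occ Sgn.pos x + ρ.concl.occ Sgn.neg x ≤ 1
  /-- C4: congruent occurrences in a premise and in the conclusion have the same position. -/
  c4 : ∀ c ∈ ρ.prems, ∀ x t, 0 < c.occ t x → ρ.concl.occ t.opp x = 0

/-- Special structural rules: analytic rules of the form `(X ⊢ Tᵢ)ᵢ / X ⊢ T` or
`(Sᵢ ⊢ Y)ᵢ / S ⊢ Y`, the displayed variable occurring nowhere else. -/
def IsSpecial (ρ : SRule L) : Prop :=
  ρ.IsAnalytic ∧ ∃ x : ℕ,
    (∀ c ∈ ρ.concl :: ρ.prems, c.ant = Str.leaf x ∧ ¬ c.suc.Mem x) ∨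
    (∀ c ∈ ρ.concl :: ρ.prems, c.suc = Str.leaf x ∧ ¬ c.ant.Mem x)

end SRule

/-! ### Perfect algebras and validity of structural rules -/

/-- Operations on `A` interpreting the connectives of `L`. -/
structure DLEOps (L : DLELang.{u}) (A : Type v) : Type (max u v) where
  opF : (f : L.F) → (Fin (L.arF f) → A) → A
  opG : (g : L.G) → (Fin (L.arG g) → A) → A

/-- Completely join-prime elements. -/
def ComplJoinPrime {A : Type v} [CompleteLattice A] (j : A) : Prop :=
  ∀ S : Set A, j ≤ sSup S → ∃ x ∈ S, j ≤ x

namespace DLEOps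

variable {L : DLELang.{u}} {A : Type v}

/-- Perfect `L`-algebras: the complete and completely distributive lattice `A` is join-generated by
its completely join-prime elements, and in each coordinate the `f`-operations (resp.
`g`-operations) completely preserve joins (resp. meets) or reverse meets (resp. joins). -/
structure IsPerfect [CompletelyDistribLattice A] (𝔸 : DLEOps L A) : Prop where
  join_gen : ∀ a : A, sSup {j | ComplJoinPrime j ∧ j ≤ a} = a
  f_pos : ∀ f i, L.epsF f i = Sgn.pos → ∀ (a : Fin (L.arF f) → A) (S : Set A),
    𝔸.opF f (Function.update a i (sSup S)) = sSup ((fun x => 𝔸.opF f (Function.update a i x)) '' S)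
  f_neg : ∀ f i, L.epsF f i = Sgn.neg → ∀ (a : Fin (L.arF f) → A) (S : Set A),
    𝔸.opF f (Function.update a i (sInf S)) = sSup ((fun x => 𝔸.opF f (Function.update a i x)) '' S)
  g_pos : ∀ g i, L.epsG g i = Sgn.pos → ∀ (a : Fin (L.arG g) → A) (S : Set A),
    𝔸.opG g (Function.update a i (sInf S)) = sInf ((fun x => 𝔸.opG g (Function.update a i x)) '' S)
  g_neg : ∀ g i, L.epsG g i = Sgn.neg → ∀ (a : Fin (L.arG g) → A) (S : Set A),
    𝔸.opG g (Function.update a i (sSup S)) = sInf ((fun x => 𝔸.opG g (Function.update a i x)) '' S)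

/-- The operation `f♯ᵢ`; here `a i` is the argument in the `i`-th coordinate. -/
def resF [CompleteLattice A] (𝔸 : DLEOps L A) (f : L.F) (i : Fin (L.arF f))
    (a : Fin (L.arF f) → A) : A :=
  match L.epsF f i with
  | Sgn.pos => sSup {x | 𝔸.opF f (Function.update a i x) ≤ a i}
  | Sgn.neg => sInf {x | 𝔸.opF f (Function.update a i x) ≤ a i}

/-- The operation `g♭ᵢ`; here `a i` is the argument in the `i`-th coordinate. -/
def resG [CompleteLattice A] (𝔸 : DLEOps L A) (g : L.G) (i : Fin (L.arG g))
    (a : Fin (L.arG g) → A) : A :=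
  match L.epsG g i with
  | Sgn.pos => sInf {x | a i ≤ 𝔸.opG g (Function.update a i x)}
  | Sgn.neg => sSup {x | a i ≤ 𝔸.opG g (Function.update a i x)}

end DLEOps

section Semantics

variable {L : DLELang.{u}} {A : Type v} [CompletelyDistribLattice A]

/-- The value in `A` of the structural term `S` placed in position `s`, i.e. of the `L*`-formula
`l(S)` for `s = pos` and `r(S)` for `s = neg`. (Meaningful if `S` is sided accordingly.) -/
def Str.eval (𝔸 : DLEOps L A) (v : ℕ → A) : Sgn → Str L ℕ → A
  | _, leaf x => v x
  | .pos, I => ⊤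
  | .neg, I => ⊥
  | .pos, comma S T => Str.eval 𝔸 v .pos S ⊓ Str.eval 𝔸 v .pos T
  | .neg, comma S T => Str.eval 𝔸 v .neg S ⊔ Str.eval 𝔸 v .neg T
  | .pos, gt S T => Str.eval 𝔸 v .pos T \ Str.eval 𝔸 v .neg S
  | .neg, gt S T => Str.eval 𝔸 v .pos S ⇨ Str.eval 𝔸 v .neg T
  | .pos, lt S T => Str.eval 𝔸 v .pos S \ Str.eval 𝔸 v .neg T
  | .neg, lt S T => Str.eval 𝔸 v .pos T ⇨ Str.eval 𝔸 v .neg S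
  | s, H f X => 𝔸.opF f fun j => Str.eval 𝔸 v (s.act (L.epsF f j)) (X j)
  | s, K g X => 𝔸.opG g fun j => Str.eval 𝔸 v (s.act (L.epsG g j)) (X j)
  | s, Hres f i X => 𝔸.resF f i fun j => Str.eval 𝔸 v (s.act (adjEps (L.epsF f) i j)) (X j)
  | s, Kres g i X => 𝔸.resG g i fun j => Str.eval 𝔸 v (s.act (adjEps (L.epsG g) i j)) (X j)

/-- Satisfaction of a sequent under an assignment. -/
def StrSeq.Sat (𝔸 : DLEOps L A) (v : ℕ → A) (c : StrSeq L ℕ) : Prop :=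
  c.ant.eval 𝔸 v Sgn.pos ≤ c.suc.eval 𝔸 v Sgn.neg

/-- Validity of a structural rule. -/
def SRule.Valid (𝔸 : DLEOps L A) (ρ : SRule L) : Prop :=
  ∀ v : ℕ → A, (∀ c ∈ ρ.prems, c.Sat 𝔸 v) → ρ.concl.Sat 𝔸 v

end Semantics

/-! ### The display calculi -/

open Str Function in
/-- The pairs of sequents related by the (invertible) display postulates. -/
inductive Display (L : DLELang.{u}) (α : Type v) : StrSeq L α → StrSeq L α → Prop
  | gt_left (X Y Z) : Display L α (comma X Y ⊩ Z) (Y ⊩ gt X Z)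
  | gt_right (X Y Z) : Display L α (Z ⊩ comma X Y) (gt X Z ⊩ Y)
  | lt_left (X Y Z) : Display L α (comma X Y ⊩ Z) (X ⊩ lt Z Y)
  | lt_right (X Y Z) : Display L α (Z ⊩ comma X Y) (lt Z Y ⊩ X)
  | f_pos (f i X Y) (h : L.epsF f i = Sgn.pos) :
      Display L α (H f X ⊩ Y) (X i ⊩ Hres f i (update X i Y))
  | f_neg (f i X Y) (h : L.epsF f i = Sgn.neg) :
      Display L α (H f X ⊩ Y) (Hres f i (update X i Y) ⊩ X i)
  | g_pos (g i X Y) (h : L.epsG g i = Sgn.pos) :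
      Display L α (Y ⊩ K g X) (Kres g i (update X i Y) ⊩ X i)
  | g_neg (g i X Y) (h : L.epsG g i = Sgn.neg) :
      Display L α (Y ⊩ K g X) (X i ⊩ Kres g i (update X i Y))

open Str Function in
/-- The structural rules common to the calculi, apart from identity, cut and display postulates. -/
inductive StructRule (L : DLELang.{u}) (α : Type v) : List (StrSeq L α) → StrSeq L α → Prop
  | nec_f_pos (f k X) (h : L.epsF f k = Sgn.pos) :
      StructRule L α [X k ⊩ I] (X k ⊩ Hres f k (update X k I))
  | nec_f_neg (f k X) (h : L.epsF f k = Sgn.neg) :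
      StructRule L α [I ⊩ X k] (Hres f k (update X k I) ⊩ X k)
  | nec_g_pos (g k X) (h : L.epsG g k = Sgn.pos) :
      StructRule L α [I ⊩ X k] (Kres g k (update X k I) ⊩ X k)
  | nec_g_neg (g k X) (h : L.epsG g k = Sgn.neg) :
      StructRule L α [X k ⊩ I] (X k ⊩ Kres g k (update X k I))
  | I_left (X Y) : StructRule L α [X ⊩ Y] (comma I X ⊩ Y)
  | I_left_inv (X Y) : StructRule L α [comma I X ⊩ Y] (X ⊩ Y)
  | I_right (X Y) : StructRule L α [Y ⊩ X] (Y ⊩ comma X I)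
  | I_right_inv (X Y) : StructRule L α [Y ⊩ comma X I] (Y ⊩ X)
  | exch_left (X Y Z) : StructRule L α [comma Y X ⊩ Z] (comma X Y ⊩ Z)
  | exch_right (X Y Z) : StructRule L α [Z ⊩ comma X Y] (Z ⊩ comma Y X)
  | weak_left (X Y Z) : StructRule L α [Y ⊩ Z] (comma X Y ⊩ Z)
  | weak_right (X Y Z) : StructRule L α [Z ⊩ Y] (Z ⊩ comma Y X)
  | contr_left (X Y) : StructRule L α [comma X X ⊩ Y] (X ⊩ Y)
  | contr_right (X Y) : StructRule L α [Y ⊩ comma X X] (Y ⊩ X)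
  | assoc_left (X Y Z W) :
      StructRule L α [comma X (comma Y Z) ⊩ W] (comma (comma X Y) Z ⊩ W)
  | assoc_left_inv (X Y Z W) :
      StructRule L α [comma (comma X Y) Z ⊩ W] (comma X (comma Y Z) ⊩ W)
  | assoc_right (X Y Z W) :
      StructRule L α [W ⊩ comma (comma Z Y) X] (W ⊩ comma Z (comma Y X))
  | assoc_right_inv (X Y Z W) :
      StructRule L α [W ⊩ comma Z (comma Y X)] (W ⊩ comma (comma Z Y) X)

open Str in
/-- The rules of the display calculus with the structural language of `L` and the formulas of the
language `M`, where `sF`, `sG` assign to each connective of `M` its structural counterpart. -/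
inductive CalcRule (L M : DLELang.{u})
    (sF : (f : M.F) → (Fin (M.arF f) → Str L (Form M)) → Str L (Form M))
    (sG : (g : M.G) → (Fin (M.arG g) → Str L (Form M)) → Str L (Form M)) :
    List (StrSeq L (Form M)) → StrSeq L (Form M) → Prop
  | id (p : ℕ) : CalcRule L M sF sG [] (leaf (Form.var p) ⊩ leaf (Form.var p))
  | cut (X A Y) : CalcRule L M sF sG [X ⊩ leaf A, leaf A ⊩ Y] (X ⊩ Y)
  | disp (c d) (h : Display L (Form M) c d) : CalcRule L M sF sG [c] d
  | disp_inv (c d) (h : Display L (Form M) c d) : CalcRule L M sF sG [d] c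
  | struct (ps c) (h : StructRule L (Form M) ps c) : CalcRule L M sF sG ps c
  | bot_left : CalcRule L M sF sG [] (leaf Form.bot ⊩ I)
  | bot_right (X) : CalcRule L M sF sG [X ⊩ I] (X ⊩ leaf Form.bot)
  | top_left (X) : CalcRule L M sF sG [I ⊩ X] (leaf Form.top ⊩ X)
  | top_right : CalcRule L M sF sG [] (I ⊩ leaf Form.top)
  | and_left (A B X) :
      CalcRule L M sF sG [comma (leaf A) (leaf B) ⊩ X] (leaf (Form.and A B) ⊩ X)
  | and_right (A B X Y) :
      CalcRule L M sF sG [X ⊩ leaf A, Y ⊩ leaf B] (comma X Y ⊩ leaf (Form.and A B))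
  | or_left (A B X Y) :
      CalcRule L M sF sG [leaf A ⊩ X, leaf B ⊩ Y] (leaf (Form.or A B) ⊩ comma X Y)
  | or_right (A B X) :
      CalcRule L M sF sG [X ⊩ comma (leaf A) (leaf B)] (X ⊩ leaf (Form.or A B))
  | f_left (f A X) :
      CalcRule L M sF sG [sF f (fun i => leaf (A i)) ⊩ X] (leaf (Form.opF f A) ⊩ X)
  | f_right (f A X) :
      CalcRule L M sF sG
        (List.ofFn fun i => match M.epsF f i with
          | Sgn.pos => X i ⊩ leaf (A i)
          | Sgn.neg => leaf (A i) ⊩ X i)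
        (sF f X ⊩ leaf (Form.opF f A))
  | g_right (g A X) :
      CalcRule L M sF sG [X ⊩ sG g (fun i => leaf (A i))] (X ⊩ leaf (Form.opG g A))
  | g_left (g A X) :
      CalcRule L M sF sG
        (List.ofFn fun i => match M.epsG g i with
          | Sgn.pos => leaf (A i) ⊩ X i
          | Sgn.neg => X i ⊩ leaf (A i))
        (leaf (Form.opG g A) ⊩ sG g X)

/-- The rules of the calculus `DL` for the language `L`. -/
def dlRule (L : DLELang.{u}) : List (StrSeq L (Form L)) → StrSeq L (Form L) → Prop :=
  CalcRule L L Str.H Str.K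

/-- The structural counterparts of the connectives in `F*`. -/
def strF (L : DLELang.{u}) {α : Type v} : (c : StarF L) → (Fin (starArF L c) → Str L α) → Str L α
  | .base f, X => Str.H f X
  | .coimp, X => Str.gt (X (0 : Fin 2)) (X (1 : Fin 2))
  | .coimp', X => Str.lt (X (0 : Fin 2)) (X (1 : Fin 2))
  | .adjF f i _, X => Str.Hres f i X
  | .adjG g i _, X => Str.Kres g i X

/-- The structural counterparts of the connectives in `G*`. -/
def strG (L : DLELang.{u}) {α : Type v} : (c : StarG L) → (Fin (starArG L c) → Str L α) → Str L α
  | .base g, X => Str.K g X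
  | .imp, X => Str.gt (X (0 : Fin 2)) (X (1 : Fin 2))
  | .imp', X => Str.lt (X (0 : Fin 2)) (X (1 : Fin 2))
  | .adjF f i _, X => Str.Hres f i X
  | .adjG g i _, X => Str.Kres g i X

/-- The rules of the calculus `DL*` for the language `L`: same structures, formulas of `L*`. -/
def dlStarRule (L : DLELang.{u}) :
    List (StrSeq L (Form L.star)) → StrSeq L (Form L.star) → Prop :=
  CalcRule L L.star (strF L) (strG L)

/-- Derivability in the calculus given by `base` extended with the structural rules in `R`. The
calculus manipulates sequents with left-sided antecedent and right-sided succedent. -/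
def Derivable {L : DLELang.{u}} {α : Type u} (base : List (StrSeq L α) → StrSeq L α → Prop)
    (R : Set (SRule L)) (c : StrSeq L α) : Prop :=
  Gen (fun ps c => c.Sided ∧ (base ps c ∨ ∃ ρ ∈ R, ∃ σ : ℕ → Str L α,
    ps = ρ.prems.map (StrSeq.subst σ) ∧ c = ρ.concl.subst σ)) c

/-! ### Displayable logics -/

/-- `Λ` is a DLE-logic in the language `L` that is captured by `DL` extended with a set of
structural rules, each of which has the property `P`. -/
def DisplayableBy (L : DLELang.{u}) (P : SRule L → Prop) (Λ : Set (FSeq L)) : Prop :=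
  (∃ Ax, Λ = dleLogic L Ax) ∧ ∃ R : Set (SRule L), (∀ ρ ∈ R, P ρ) ∧
    ∀ A B, (A, B) ∈ Λ ↔ Derivable (dlRule L) R (Str.leaf A ⊩ Str.leaf B)

/-- Properly displayable DLE-logics. -/
def ProperlyDisplayable (L : DLELang.{u}) (Λ : Set (FSeq L)) : Prop :=
  DisplayableBy L SRule.IsAnalytic Λ

/-- Specially displayable DLE-logics. -/
def SpeciallyDisplayable (L : DLELang.{u}) (Λ : Set (FSeq L)) : Prop :=
  DisplayableBy L SRule.IsSpecial Λ

/-- Properly displayable `L*`-logics: tense DLE-logics captured by `DL*` extended with analytic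
structural rules. -/
def ProperlyDisplayableStar (L : DLELang.{u}) (Λ : Set (FSeq L.star)) : Prop :=
  (∃ Ax, Λ = tenseLogic L Ax) ∧ ∃ R : Set (SRule L), (∀ ρ ∈ R, ρ.IsAnalytic) ∧
    ∀ A B, (A, B) ∈ Λ ↔ Derivable (dlStarRule L) R (Str.leaf A ⊩ Str.leaf B)

/-! ### Signs and signed orders -/

namespace Sgn

/-! The heart is a localization of premises. Given an analytic rule with conclusion `S ⊢ T`, take a
fresh variable `z` and the new conclusion `z ⊢ S > T`, that is, `z ∧ S ≤ T`; putting `z = ⊤` shows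
that nothing is lost. A premise that contains a variable `x` can be displayed as `x ⊢ U`, or dually
as `U ⊢ x`. By C3 the conclusion, with all other values fixed, says `x ≤ V` for some `V` independent
of `x`. Replace the premise by `z ⊢ (S > T)[x := U > x]`: the conclusion, asserted only for the part
of `x` outside `U`, hence `x ≤ U ∨ V` (`LocalizedPrem`).

If the old premise holds, so does the new one, since `x ≤ U`. Conversely, assume the new premise and
lower `x` to `x ∧ U`. By C1 and C4 every variable has in the premises the position that it has in
the conclusion. So the other premises survive, and `U`, if it contains `x` at all, can only grow;
the displayed premise therefore holds at `x ∧ U`. The old rule gives `x ∧ U ≤ V`, and distributivity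
turns this and `x ≤ U ∨ V` into `x ≤ V` (`TenseAlg.sle_of_meet_sle`). Treating the premises one by
one gives a special rule (`SRule.Localizes.validIn_iff`).

The argument needs only residuation in a preordered algebra (`TenseAlg`), so it applies to three
kinds of algebras. Perfect algebras give the first claim.

For the second claim, the Galois-closed sets of structures with respect to derivability form a tense
algebra (`IsDisplayFrame.closedAlg`). It validates the sided analytic rules of the calculus: by C3
each variable of the conclusion can be tested on principal closed sets, where the rule becomes one
of its instances (`IsDisplayFrame.validIn_closedAlg`). With soundness (`Derivable.satIn`) and
completeness (`derivable_of_ev_le`), derivations are transferred between the analytic calculus and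
the special one.

A premise without variables cannot be localized. It is a constant statement, true or false in the
algebra `𝔹` of the given calculus: true ones are dropped, and a rule with a false one is discarded
(`SRule.specialRules`). A rule discarded this way stays harmless, because every constant statement
true in the new calculus is true in `𝔹` (`SRule.validIn_of_specialRules`).

For the third claim, a special rule `(z ⊢ Tᵢ)ᵢ / z ⊢ T` amounts to the right-primitive inequality `z
∧ ⋀ Tᵢ ≤ T` (`SRule.validIn_iff_tail_le`). The same transfer, with the algebra of formulas `lindAlg`
of the logic axiomatized by these inequalities, shows that they axiomatize the given logic. -/

@[simp] theorem opp_pos : pos.opp = neg := rfl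
@[simp] theorem opp_neg : neg.opp = pos := rfl
@[simp] theorem opp_opp (s : Sgn) : s.opp.opp = s := by cases s <;> rfl
@[simp] theorem act_pos (s : Sgn) : s.act pos = s := rfl
@[simp] theorem act_neg (s : Sgn) : s.act neg = s.opp := rfl
@[simp] theorem pos_act (s : Sgn) : pos.act s = s := by cases s <;> rfl
@[simp] theorem neg_act (s : Sgn) : neg.act s = s.opp := by cases s <;> rfl
@[simp] theorem opp_act (s t : Sgn) : s.opp.act t = (s.act t).opp := by cases s <;> cases t <;> rfl
@[simp] theorem act_opp (s t : Sgn) : s.act t.opp = (s.act t).opp := by cases s <;> cases t <;> rfl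
@[simp] theorem act_self (s : Sgn) : s.act s = pos := by cases s <;> rfl
@[simp] theorem opp_ne (s : Sgn) : s.opp ≠ s := by cases s <;> simp
theorem act_comm (s t : Sgn) : s.act t = t.act s := by cases s <;> cases t <;> rfl
theorem act_assoc (s t r : Sgn) : (s.act t).act r = s.act (t.act r) := by
  cases s <;> cases t <;> cases r <;> rfl
@[simp] theorem act_act_self (s t : Sgn) : (s.act t).act t = s := by cases s <;> cases t <;> rfl
@[simp] theorem act_self_act (s t : Sgn) : s.act (s.act t) = t := by cases s <;> cases t <;> rfl
theorem eq_or_eq_opp (s t : Sgn) : s = t ∨ s = t.opp := by cases s <;> cases t <;> simp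

end Sgn

@[simp] theorem adjEps_self {n : ℕ} (e : Fin n → Sgn) (i : Fin n) : adjEps e i i = e i := by
  simp [adjEps]

/-- One formula in signs replaces the case distinction on `e i`, so that residuals and
Galois-adjoints can be treated together. -/
theorem adjEps_of_ne {n : ℕ} (e : Fin n → Sgn) {i j : Fin n} (h : j ≠ i) :
    adjEps e i j = ((e i).act (e j)).opp := by
  unfold adjEps
  rw [if_neg h]
  cases e i <;> simp

/-- The order for the sign `pos`, the opposite order for the sign `neg`. -/
def sle {B : Type w} [Preorder B] : Sgn → B → B → Prop
  | .pos, a, b => a ≤ b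
  | .neg, a, b => b ≤ a

section sle

variable {B : Type w} [Preorder B] {s : Sgn} {a b c : B}

@[simp] theorem sle_pos : sle .pos a b ↔ a ≤ b := Iff.rfl
@[simp] theorem sle_neg : sle .neg a b ↔ b ≤ a := Iff.rfl
@[simp] theorem sle_opp : sle s.opp a b ↔ sle s b a := by cases s <;> rfl
@[refl] theorem sle_refl (s : Sgn) (a : B) : sle s a a := by cases s <;> exact le_rfl
theorem sle.trans (h : sle s a b) (h' : sle s b c) : sle s a c := by
  cases s
  · exact le_trans (α := B) h h'
  · exact le_trans (α := B) h' h

end sle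

/-- A map that is monotone in each coordinate, up to signs, is monotone. -/
theorem mono_of_coord {B : Type w} [Preorder B] {n : ℕ} (F : (Fin n → B) → B) (ε : Fin n → Sgn)
    (h : ∀ i a x y, sle (ε i) x y → F (Function.update a i x) ≤ F (Function.update a i y))
    {a b : Fin n → B} (hab : ∀ j, sle (ε j) (a j) (b j)) : F a ≤ F b := by
  -- The coordinates in `J` have already been moved from `a` to `b`; one more is moved at each step.
  have key : ∀ J : Finset (Fin n), F a ≤ F fun j => if j ∈ J then b j else a j := by
    intro J
    induction J using Finset.induction_on with
    | empty => simp
    | insert i J hi ih =>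
      refine ih.trans ?_
      have h1 : (fun j => if j ∈ J then b j else a j) =
          Function.update (fun j => if j ∈ J then b j else a j) i (a i) := by
        funext j
        by_cases hj : j = i
        · subst hj; simp [hi]
        · simp [hj]
      have h2 : (fun j => if j ∈ insert i J then b j else a j) =
          Function.update (fun j => if j ∈ J then b j else a j) i (b i) := by
        funext j
        by_cases hj : j = i
        · subst hj; simp
        · simp [hj]
      rw [h1, h2]
      exact h _ _ _ _ (hab i)
  simpa using key Finset.univ

/-! ### Tense algebras -/

/-- Preordered algebras of the expanded language. The operations `unit`, `meet`, `gt`, `lt` with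
sign `s` interpret the structural connectives `I`, `;`, `>`, `<` in position `s`. -/
structure TenseAlg (L : DLELang.{u}) (B : Type w) [Preorder B] where
  unit : Sgn → B
  meet : Sgn → B → B → B
  gt : Sgn → B → B → B
  lt : Sgn → B → B → B
  opF : (f : L.F) → (Fin (L.arF f) → B) → B
  opG : (g : L.G) → (Fin (L.arG g) → B) → B
  resF : (f : L.F) → Fin (L.arF f) → (Fin (L.arF f) → B) → B
  resG : (g : L.G) → Fin (L.arG g) → (Fin (L.arG g) → B) → B
  sle_unit : ∀ s a, sle s a (unit s)
  sle_meet : ∀ s a b c, sle s c (meet s a b) ↔ sle s c a ∧ sle s c b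
  gt_res : ∀ s a b c, sle s (gt s a b) c ↔ sle s b (meet s.opp a c)
  lt_res : ∀ s a b c, sle s (lt s a b) c ↔ sle s a (meet s.opp c b)
  f_res : ∀ f i a b, opF f a ≤ b ↔ sle (L.epsF f i) (a i) (resF f i (Function.update a i b))
  g_res : ∀ g i a b, b ≤ opG g a ↔ sle (L.epsG g i) (resG g i (Function.update a i b)) (a i)

namespace TenseAlg

variable {L : DLELang.{u}} {B : Type w} [Preorder B] (𝔹 : TenseAlg L B)

theorem unit_sle (s : Sgn) (a : B) : sle s (𝔹.unit s.opp) a := by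
  simpa using 𝔹.sle_unit s.opp a

theorem meet_left (s : Sgn) (a b : B) : sle s (𝔹.meet s a b) a :=
  ((𝔹.sle_meet s a b _).1 (sle_refl s _)).1

theorem meet_right (s : Sgn) (a b : B) : sle s (𝔹.meet s a b) b :=
  ((𝔹.sle_meet s a b _).1 (sle_refl s _)).2

theorem meet_opp_sle (s : Sgn) (a b c : B) :
    sle s (𝔹.meet s.opp a b) c ↔ sle s a c ∧ sle s b c := by
  simpa using 𝔹.sle_meet s.opp a b c

theorem left_sle (s : Sgn) (a b : B) : sle s a (𝔹.meet s.opp a b) := by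
  simpa using 𝔹.meet_left s.opp a b

theorem meet_mono {s : Sgn} {a b a' b' : B} (h : sle s a a') (h' : sle s b b') :
    sle s (𝔹.meet s a b) (𝔹.meet s a' b') :=
  (𝔹.sle_meet _ _ _ _).2 ⟨(𝔹.meet_left s a b).trans h, (𝔹.meet_right s a b).trans h'⟩

theorem meet_comm (s : Sgn) (a b : B) : sle s (𝔹.meet s a b) (𝔹.meet s b a) :=
  (𝔹.sle_meet _ _ _ _).2 ⟨𝔹.meet_right s a b, 𝔹.meet_left s a b⟩

theorem meet_assoc (s : Sgn) (a b c : B) :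
    sle s (𝔹.meet s (𝔹.meet s a b) c) (𝔹.meet s a (𝔹.meet s b c)) :=
  (𝔹.sle_meet _ _ _ _).2 ⟨(𝔹.meet_left s _ c).trans (𝔹.meet_left s a b),
    𝔹.meet_mono (𝔹.meet_right s a b) (sle_refl s c)⟩

theorem meet_assoc_symm (s : Sgn) (a b c : B) :
    sle s (𝔹.meet s a (𝔹.meet s b c)) (𝔹.meet s (𝔹.meet s a b) c) :=
  (𝔹.sle_meet _ _ _ _).2 ⟨𝔹.meet_mono (sle_refl s a) (𝔹.meet_left s b c),
    (𝔹.meet_right s a _).trans (𝔹.meet_right s b c)⟩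

theorem meet_sle_iff_gt (s : Sgn) (a b c : B) :
    sle s (𝔹.meet s a b) c ↔ sle s b (𝔹.gt s.opp a c) := by
  have h := 𝔹.gt_res s.opp a c b
  simp only [sle_opp, Sgn.opp_opp] at h
  exact h.symm

theorem meet_sle_iff_lt (s : Sgn) (a b c : B) :
    sle s (𝔹.meet s a b) c ↔ sle s a (𝔹.lt s.opp c b) := by
  have h := 𝔹.lt_res s.opp c b a
  simp only [sle_opp, Sgn.opp_opp] at h
  exact h.symm

/-- Cut, from distributivity. -/
theorem sle_of_meet_sle {s : Sgn} {x t v : B} (h : sle s x (𝔹.meet s.opp t v))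
    (h' : sle s (𝔹.meet s x t) v) : sle s x v := by
  -- For `s = pos`: both `t` and `v` lie below `x → v`, hence so does `x ≤ t ∨ v`; then `x ∧ x ≤ v`.
  have h1 : sle s (𝔹.meet s.opp t v) (𝔹.gt s.opp x v) :=
    (𝔹.meet_opp_sle _ _ _ _).2 ⟨(𝔹.meet_sle_iff_gt _ _ _ _).1 h',
      (𝔹.meet_sle_iff_gt _ _ _ _).1 (𝔹.meet_right s x v)⟩
  have h2 := (𝔹.meet_sle_iff_gt _ _ _ _).2 (h.trans h1)
  exact ((𝔹.sle_meet _ _ _ _).2 ⟨sle_refl s x, sle_refl s x⟩).trans h2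

theorem gt_mono {s : Sgn} {a b a' b' : B} (h : sle s.opp a a') (h' : sle s b b') :
    sle s (𝔹.gt s a b) (𝔹.gt s a' b') := by
  rw [𝔹.gt_res]
  have h1 := (𝔹.gt_res s a' b' _).1 (sle_refl s _)
  refine h'.trans (h1.trans ?_)
  have := 𝔹.meet_mono h (sle_refl s.opp (𝔹.gt s a' b'))
  simpa using this

theorem lt_mono {s : Sgn} {a b a' b' : B} (h : sle s a a') (h' : sle s.opp b b') :
    sle s (𝔹.lt s a b) (𝔹.lt s a' b') := by
  rw [𝔹.lt_res]
  have h1 := (𝔹.lt_res s a' b' _).1 (sle_refl s _)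
  refine h.trans (h1.trans ?_)
  have := 𝔹.meet_mono (sle_refl s.opp (𝔹.lt s a' b')) h'
  simpa using this

/-- Residuation read from the side of the residual: here the entry `a i` is the bound and `c` is the
genuine `i`-th argument. -/
theorem sle_resF (f : L.F) (i : Fin (L.arF f)) (a : Fin (L.arF f) → B) (c : B) :
    sle (L.epsF f i) c (𝔹.resF f i a) ↔ 𝔹.opF f (Function.update a i c) ≤ a i := by
  rw [𝔹.f_res f i]
  simp

theorem resG_sle (g : L.G) (i : Fin (L.arG g)) (a : Fin (L.arG g) → B) (c : B) :
    sle (L.epsG g i) (𝔹.resG g i a) c ↔ a i ≤ 𝔹.opG g (Function.update a i c) := by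
  rw [𝔹.g_res g i]
  simp

/-- An operation with a residual in a coordinate is monotone there up to sign, by comparing with the
unit of the adjunction. -/
theorem opF_mono (f : L.F) {a b : Fin (L.arF f) → B} (h : ∀ j, sle (L.epsF f j) (a j) (b j)) :
    𝔹.opF f a ≤ 𝔹.opF f b := by
  refine mono_of_coord _ (L.epsF f) (fun i a x y hxy => ?_) h
  rw [𝔹.f_res f i]
  have := (𝔹.f_res f i (Function.update a i y) _).1 le_rfl
  simp only [Function.update_self, Function.update_idem] at this ⊢
  exact hxy.trans this

theorem opG_mono (g : L.G) {a b : Fin (L.arG g) → B} (h : ∀ j, sle (L.epsG g j) (a j) (b j)) :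
    𝔹.opG g a ≤ 𝔹.opG g b := by
  refine mono_of_coord _ (L.epsG g) (fun i a x y hxy => ?_) h
  rw [𝔹.g_res g i]
  have := (𝔹.g_res g i (Function.update a i x) _).1 le_rfl
  simp only [Function.update_self, Function.update_idem] at this ⊢
  exact this.trans hxy

/-- Checked through the adjunction: off `i`, the signs of `adjEps` are exactly those that the
monotonicity of `opF` requires. For order type `∂` the residual is a least solution instead of a
greatest one, so `a` and `b` exchange roles. -/
theorem resF_mono (f : L.F) (i : Fin (L.arF f)) {a b : Fin (L.arF f) → B}
    (h : ∀ j, sle (adjEps (L.epsF f) i j) (a j) (b j)) : 𝔹.resF f i a ≤ 𝔹.resF f i b := by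
  have hi := h i
  rw [adjEps_self] at hi
  have hj : ∀ j, j ≠ i → sle ((L.epsF f i).act (L.epsF f j)).opp (a j) (b j) := fun j hj => by
    rw [← adjEps_of_ne _ hj]; exact h j
  cases e : L.epsF f i with
  | pos =>
    rw [e] at hi
    have h1 := (𝔹.sle_resF f i b (𝔹.resF f i a)).2
    rw [e] at h1
    refine h1 (le_trans ?_ (le_trans ((𝔹.sle_resF f i a _).1 (sle_refl _ _)) hi))
    refine 𝔹.opF_mono f fun j => ?_
    by_cases hji : j = i
    · subst hji; simpa using sle_refl _ _
    · have := hj j hji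
      simpa [hji, e] using this
  | neg =>
    rw [e] at hi
    have h1 := (𝔹.sle_resF f i a (𝔹.resF f i b)).2
    rw [e] at h1
    refine h1 (le_trans ?_ (le_trans ((𝔹.sle_resF f i b _).1 (sle_refl _ _)) hi))
    refine 𝔹.opF_mono f fun j => ?_
    by_cases hji : j = i
    · subst hji; simpa using sle_refl _ _
    · have := hj j hji
      simpa [hji, e] using this

theorem resG_mono (g : L.G) (i : Fin (L.arG g)) {a b : Fin (L.arG g) → B}
    (h : ∀ j, sle (adjEps (L.epsG g) i j) (a j) (b j)) : 𝔹.resG g i a ≤ 𝔹.resG g i b := by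
  have hi := h i
  rw [adjEps_self] at hi
  have hj : ∀ j, j ≠ i → sle ((L.epsG g i).act (L.epsG g j)).opp (a j) (b j) := fun j hj => by
    rw [← adjEps_of_ne _ hj]; exact h j
  cases e : L.epsG g i with
  | pos =>
    rw [e] at hi
    have h1 := (𝔹.resG_sle g i a (𝔹.resG g i b)).2
    rw [e] at h1
    refine h1 (le_trans (le_trans hi ((𝔹.resG_sle g i b _).1 (sle_refl _ _))) ?_)
    refine 𝔹.opG_mono g fun j => ?_
    by_cases hji : j = i
    · subst hji; simpa using sle_refl _ _
    · have := hj j hji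
      simpa [hji, e] using this
  | neg =>
    rw [e] at hi
    have h1 := (𝔹.resG_sle g i b (𝔹.resG g i a)).2
    rw [e] at h1
    refine h1 (le_trans (le_trans hi ((𝔹.resG_sle g i a _).1 (sle_refl _ _))) ?_)
    refine 𝔹.opG_mono g fun j => ?_
    by_cases hji : j = i
    · subst hji; simpa using sle_refl _ _
    · have := hj j hji
      simpa [hji, e] using this

end TenseAlg

/-- Signed version of the monotonicity of an operation with order type `ε`. -/
theorem sle_of_mono {B : Type w} [Preorder B] {n : ℕ} {F : (Fin n → B) → B} {ε : Fin n → Sgn}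
    (hF : ∀ {a b : Fin n → B}, (∀ j, sle (ε j) (a j) (b j)) → F a ≤ F b) (s : Sgn)
    {a b : Fin n → B} (h : ∀ j, sle (s.act (ε j)) (a j) (b j)) : sle s (F a) (F b) := by
  cases s with
  | pos => exact hF fun j => by simpa using h j
  | neg => exact hF fun j => by simpa using h j

/-! ### Structures: leaves, values, display -/

namespace Str

variable {L : DLELang.{u}} {α : Type v}

/-- All the leaves of `S` satisfy `P`, when `S` is in position `s`. -/
def All (P : Sgn → α → Prop) : Sgn → Str L α → Prop
  | s, leaf a => P s a
  | _, I => True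
  | s, comma S T => All P s S ∧ All P s T
  | s, gt S T => All P s.opp S ∧ All P s T
  | s, lt S T => All P s S ∧ All P s.opp T
  | s, H f X => ∀ j, All P (s.act (L.epsF f j)) (X j)
  | s, K g X => ∀ j, All P (s.act (L.epsG g j)) (X j)
  | s, Hres f i X => ∀ j, All P (s.act (adjEps (L.epsF f) i j)) (X j)
  | s, Kres g i X => ∀ j, All P (s.act (adjEps (L.epsG g) i j)) (X j)

theorem All.imp {P Q : Sgn → α → Prop} (h : ∀ t a, P t a → Q t a) {s : Sgn} {S : Str L α}
    (hS : S.All P s) : S.All Q s := by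
  induction S generalizing s with
  | leaf a => exact h _ _ hS
  | I => trivial
  | comma S T ihS ihT => exact ⟨ihS hS.1, ihT hS.2⟩
  | gt S T ihS ihT => exact ⟨ihS hS.1, ihT hS.2⟩
  | lt S T ihS ihT => exact ⟨ihS hS.1, ihT hS.2⟩
  | H f X ih => exact fun j => ih j (hS j)
  | K g X ih => exact fun j => ih j (hS j)
  | Hres f i X ih => exact fun j => ih j (hS j)
  | Kres g i X ih => exact fun j => ih j (hS j)

theorem All.of_forall {P : Sgn → α → Prop} (h : ∀ t a, P t a) (s : Sgn) (S : Str L α) :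
    S.All P s := by
  induction S generalizing s with
  | leaf a => exact h _ _
  | I => trivial
  | comma S T ihS ihT => exact ⟨ihS _, ihT _⟩
  | gt S T ihS ihT => exact ⟨ihS _, ihT _⟩
  | lt S T ihS ihT => exact ⟨ihS _, ihT _⟩
  | H f X ih => exact fun j => ih j _
  | K g X ih => exact fun j => ih j _
  | Hres f i X ih => exact fun j => ih j _
  | Kres g i X ih => exact fun j => ih j _

theorem all_subst {β : Type w} {P : Sgn → β → Prop} (σ : α → Str L β) (s : Sgn) (S : Str L α) :
    (S.subst σ).All P s ↔ S.All (fun t a => (σ a).All P t) s := by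
  induction S generalizing s with
  | leaf a => exact Iff.rfl
  | I => exact Iff.rfl
  | comma S T ihS ihT => exact and_congr (ihS _) (ihT _)
  | gt S T ihS ihT => exact and_congr (ihS _) (ihT _)
  | lt S T ihS ihT => exact and_congr (ihS _) (ihT _)
  | H f X ih => exact forall_congr' fun j => ih j _
  | K g X ih => exact forall_congr' fun j => ih j _
  | Hres f i X ih => exact forall_congr' fun j => ih j _
  | Kres g i X ih => exact forall_congr' fun j => ih j _

theorem sided_subst {β : Type w} (σ : α → Str L β) (s : Sgn) (S : Str L α) :
    (S.subst σ).Sided s ↔ S.Sided s ∧ S.All (fun t a => (σ a).Sided t) s := by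
  induction S generalizing s with
  | leaf a => simp [subst, Sided, All]
  | I => simp [subst, Sided, All]
  | comma S T ihS ihT => simp only [subst, Sided, All, ihS, ihT]; tauto
  | gt S T ihS ihT => simp only [subst, Sided, All, ihS, ihT]; tauto
  | lt S T ihS ihT => simp only [subst, Sided, All, ihS, ihT]; tauto
  | H f X ih => simp only [subst, Sided, All, ih, forall_and]; tauto
  | K g X ih => simp only [subst, Sided, All, ih, forall_and]; tauto
  | Hres f i X ih => simp only [subst, Sided, All, ih, forall_and]; tauto
  | Kres g i X ih => simp only [subst, Sided, All, ih, forall_and]; tauto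

theorem all_coords_iff {n : ℕ} {X : Fin n → Str L ℕ} {ε : Fin n → Sgn} {P : Sgn → ℕ → Prop}
    (s : Sgn) (ih : ∀ j s, (X j).All P s ↔ ∀ t x, 0 < (X j).occ t x → P (s.act t) x) :
    (∀ j, (X j).All P (s.act (ε j))) ↔
      ∀ t x, 0 < ∑ j, (X j).occ (t.act (ε j)) x → P (s.act t) x := by
  simp only [ih, Finset.sum_pos_iff, Finset.mem_univ, true_and, forall_exists_index]
  constructor
  · intro h t x j hj
    have := h j _ x hj
    rwa [Sgn.act_assoc, Sgn.act_comm t, Sgn.act_self_act] at this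
  · intro h j t x hj
    have := h (t.act (ε j)) x j (by simpa using hj)
    rwa [Sgn.act_comm t, ← Sgn.act_assoc] at this

/-- `occ` counts relative to `S` standing in precedent position; placing `S` in position `s`
multiplies each recorded sign by `s`. -/
theorem all_iff_occ {P : Sgn → ℕ → Prop} (s : Sgn) (S : Str L ℕ) :
    S.All P s ↔ ∀ t x, 0 < S.occ t x → P (s.act t) x := by
  induction S generalizing s with
  | leaf a =>
    constructor
    · intro h t x hx
      simp only [occ] at hx
      split_ifs at hx with h'
      · rw [h'.2, ← h'.1]; exact h
      · simp at hx
    · intro h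
      exact h .pos a (by simp [occ])
  | I => simp [All, occ]
  | comma S T ihS ihT =>
    simp only [All, occ, ihS, ihT, add_pos_iff, or_imp, forall_and]
  | gt S T ihS ihT =>
    simp only [All, occ, ihS, ihT, add_pos_iff, or_imp, forall_and]
    refine and_congr ⟨fun h t x hx => ?_, fun h t x hx => ?_⟩ Iff.rfl
    · simpa using h _ _ hx
    · simpa using h t.opp x (by simpa using hx)
  | lt S T ihS ihT =>
    simp only [All, occ, ihS, ihT, add_pos_iff, or_imp, forall_and]
    refine and_congr Iff.rfl ⟨fun h t x hx => ?_, fun h t x hx => ?_⟩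
    · simpa using h _ _ hx
    · simpa using h t.opp x (by simpa using hx)
  | H f X ih => exact all_coords_iff s ih
  | K g X ih => exact all_coords_iff s ih
  | Hres f i X ih => exact all_coords_iff s ih
  | Kres g i X ih => exact all_coords_iff s ih

/-- The value of a structure in position `s`. -/
def ev {B : Type w} [Preorder B] (𝔹 : TenseAlg L B) (v : α → B) : Sgn → Str L α → B
  | _, leaf x => v x
  | s, I => 𝔹.unit s
  | s, comma S T => 𝔹.meet s (ev 𝔹 v s S) (ev 𝔹 v s T)
  | s, gt S T => 𝔹.gt s (ev 𝔹 v s.opp S) (ev 𝔹 v s T)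
  | s, lt S T => 𝔹.lt s (ev 𝔹 v s S) (ev 𝔹 v s.opp T)
  | s, H f X => 𝔹.opF f fun j => ev 𝔹 v (s.act (L.epsF f j)) (X j)
  | s, K g X => 𝔹.opG g fun j => ev 𝔹 v (s.act (L.epsG g j)) (X j)
  | s, Hres f i X => 𝔹.resF f i fun j => ev 𝔹 v (s.act (adjEps (L.epsF f) i j)) (X j)
  | s, Kres g i X => 𝔹.resG g i fun j => ev 𝔹 v (s.act (adjEps (L.epsG g) i j)) (X j)

section ev

variable {B : Type w} [Preorder B] (𝔹 : TenseAlg L B)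

theorem ev_mono {v w : α → B} {s : Sgn} {S : Str L α}
    (h : S.All (fun t a => sle t (v a) (w a)) s) : sle s (S.ev 𝔹 v s) (S.ev 𝔹 w s) := by
  induction S generalizing s with
  | leaf a => exact h
  | I => exact sle_refl _ _
  | comma S T ihS ihT => exact 𝔹.meet_mono (ihS h.1) (ihT h.2)
  | gt S T ihS ihT => exact 𝔹.gt_mono (ihS h.1) (ihT h.2)
  | lt S T ihS ihT => exact 𝔹.lt_mono (ihS h.1) (ihT h.2)
  | H f X ih => exact sle_of_mono (𝔹.opF_mono f) s fun j => ih j (h j)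
  | K g X ih => exact sle_of_mono (𝔹.opG_mono g) s fun j => ih j (h j)
  | Hres f i X ih => exact sle_of_mono (𝔹.resF_mono f i) s fun j => ih j (h j)
  | Kres g i X ih => exact sle_of_mono (𝔹.resG_mono g i) s fun j => ih j (h j)

theorem ev_congr {v w : α → B} {s : Sgn} {S : Str L α}
    (h : S.All (fun _ a => v a = w a) s) : S.ev 𝔹 v s = S.ev 𝔹 w s := by
  induction S generalizing s with
  | leaf a => exact h
  | I => rfl
  | comma S T ihS ihT => exact congrArg₂ _ (ihS h.1) (ihT h.2)
  | gt S T ihS ihT => exact congrArg₂ _ (ihS h.1) (ihT h.2)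
  | lt S T ihS ihT => exact congrArg₂ _ (ihS h.1) (ihT h.2)
  | H f X ih => exact congrArg _ (funext fun j => ih j (h j))
  | K g X ih => exact congrArg _ (funext fun j => ih j (h j))
  | Hres f i X ih => exact congrArg _ (funext fun j => ih j (h j))
  | Kres g i X ih => exact congrArg _ (funext fun j => ih j (h j))

/-- A structure may have different values in the two positions, so a single value for `σ a` is
demanded only at the positions in which the leaf `a` occurs. -/
theorem ev_subst {β : Type*} {v : β → B} {w : α → B} {σ : α → Str L β} {s : Sgn} {S : Str L α}
    (h : S.All (fun t a => (σ a).ev 𝔹 v t = w a) s) : (S.subst σ).ev 𝔹 v s = S.ev 𝔹 w s := by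
  induction S generalizing s with
  | leaf a => exact h
  | I => rfl
  | comma S T ihS ihT => exact congrArg₂ _ (ihS h.1) (ihT h.2)
  | gt S T ihS ihT => exact congrArg₂ _ (ihS h.1) (ihT h.2)
  | lt S T ihS ihT => exact congrArg₂ _ (ihS h.1) (ihT h.2)
  | H f X ih => exact congrArg _ (funext fun j => ih j (h j))
  | K g X ih => exact congrArg _ (funext fun j => ih j (h j))
  | Hres f i X ih => exact congrArg _ (funext fun j => ih j (h j))
  | Kres g i X ih => exact congrArg _ (funext fun j => ih j (h j))

end ev

theorem subst_leaf (S : Str L α) : S.subst leaf = S := by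
  induction S with
  | leaf a => rfl
  | I => rfl
  | comma S T ihS ihT => simp only [subst, ihS, ihT]
  | gt S T ihS ihT => simp only [subst, ihS, ihT]
  | lt S T ihS ihT => simp only [subst, ihS, ihT]
  | H f X ih => simp only [subst, ih]
  | K g X ih => simp only [subst, ih]
  | Hres f i X ih => simp only [subst, ih]
  | Kres g i X ih => simp only [subst, ih]

/-- The structure variables occurring in a structural term are bounded. -/
theorem exists_bound (S : Str L ℕ) : ∃ n, ∀ s, S.All (fun _ x => x < n) s := by
  have key : ∀ {k : ℕ} (X : Fin k → Str L ℕ),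
      (∀ j, ∃ n, ∀ s, (X j).All (fun _ x => x < n) s) →
      ∃ n, ∀ j s, (X j).All (fun _ x => x < n) s := by
    intro k X h
    choose n hn using h
    exact ⟨∑ j, n j, fun j s => (hn j s).imp fun _ x hx =>
      hx.trans_le (Finset.single_le_sum (f := n) (fun _ _ => Nat.zero_le _) (Finset.mem_univ j))⟩
  have key2 : ∀ {S T : Str L ℕ}, (∃ n, ∀ s, S.All (fun _ x => x < n) s) →
      (∃ n, ∀ s, T.All (fun _ x => x < n) s) →
      ∃ n, ∀ s, S.All (fun _ x => x < n) s ∧ ∀ s, T.All (fun _ x => x < n) s := by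
    rintro S T ⟨m, hm⟩ ⟨n, hn⟩
    exact ⟨m + n, fun s => ⟨(hm s).imp fun _ x hx => by omega,
      fun s => (hn s).imp fun _ x hx => by omega⟩⟩
  induction S with
  | leaf a => exact ⟨a + 1, fun s => Nat.lt_succ_self a⟩
  | I => exact ⟨0, fun s => trivial⟩
  | comma S T ihS ihT =>
    obtain ⟨n, hn⟩ := key2 ihS ihT
    exact ⟨n, fun s => ⟨(hn s).1, (hn s).2 _⟩⟩
  | gt S T ihS ihT =>
    obtain ⟨n, hn⟩ := key2 ihS ihT
    exact ⟨n, fun s => ⟨(hn _).1, (hn s).2 _⟩⟩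
  | lt S T ihS ihT =>
    obtain ⟨n, hn⟩ := key2 ihS ihT
    exact ⟨n, fun s => ⟨(hn s).1, (hn s).2 _⟩⟩
  | H f X ih => exact (key X ih).imp fun n hn s j => hn j _
  | K g X ih => exact (key X ih).imp fun n hn s j => hn j _
  | Hres f i X ih => exact (key X ih).imp fun n hn s j => hn j _
  | Kres g i X ih => exact (key X ih).imp fun n hn s j => hn j _

end Str

/-- This balances the occurrences when a residuation postulate exchanges the `i`-th argument with
the other side of the sequent; `forall_and_swap` does the same for sidedness. -/
theorem sum_add_eq_add_sum {n : ℕ} (i : Fin n) {F G : Fin n → ℕ} (h : ∀ j, j ≠ i → F j = G j) :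
    ∑ j, F j + G i = F i + ∑ j, G j := by
  have : ∑ j ∈ Finset.univ.erase i, F j = ∑ j ∈ Finset.univ.erase i, G j :=
    Finset.sum_congr rfl fun j hj => h j (Finset.ne_of_mem_erase hj)
  have h1 := Finset.add_sum_erase Finset.univ F (Finset.mem_univ i)
  have h2 := Finset.add_sum_erase Finset.univ G (Finset.mem_univ i)
  omega

theorem forall_and_swap {n : ℕ} (i : Fin n) {P Q : Fin n → Prop}
    (h : ∀ j, j ≠ i → (P j ↔ Q j)) : ((∀ j, P j) ∧ Q i) ↔ (P i ∧ ∀ j, Q j) := by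
  constructor
  · rintro ⟨hP, hQ⟩
    refine ⟨hP i, fun j => ?_⟩
    by_cases hj : j = i
    · subst hj; exact hQ
    · exact (h j hj).1 (hP j)
  · rintro ⟨hP, hQ⟩
    refine ⟨fun j => ?_, hQ i⟩
    by_cases hj : j = i
    · subst hj; exact hP
    · exact (h j hj).2 (hQ j)

namespace StrSeq

variable {L : DLELang.{u}} {α : Type v}

/-- All the leaves of the sequent satisfy `P`. -/
def All (P : Sgn → α → Prop) (c : StrSeq L α) : Prop := c.ant.All P .pos ∧ c.suc.All P .neg

/-- The sequent holds in a tense algebra. -/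
def SatIn {B : Type w} [Preorder B] (𝔹 : TenseAlg L B) (v : α → B) (c : StrSeq L α) : Prop :=
  c.ant.ev 𝔹 v .pos ≤ c.suc.ev 𝔹 v .neg

theorem All.imp {P Q : Sgn → α → Prop} {c : StrSeq L α} (hc : c.All P)
    (h : ∀ t a, P t a → Q t a) : c.All Q := ⟨hc.1.imp h, hc.2.imp h⟩

theorem all_iff_occ {P : Sgn → ℕ → Prop} {c : StrSeq L ℕ} :
    c.All P ↔ ∀ t x, 0 < c.occ t x → P t x := by
  simp only [All, Str.all_iff_occ, occ, Sgn.pos_act, Sgn.neg_act, add_pos_iff, or_imp, forall_and]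
  refine and_congr Iff.rfl ⟨fun h t x hx => ?_, fun h t x hx => ?_⟩
  · simpa using h _ _ hx
  · exact h t.opp x (by simpa using hx)

theorem sided_subst {β : Type w} (σ : α → Str L β) (c : StrSeq L α) :
    (c.subst σ).Sided ↔ c.Sided ∧ c.All (fun t a => (σ a).Sided t) := by
  simp only [Sided, subst, All, Str.sided_subst]
  tauto

section SatIn

variable {B : Type w} [Preorder B] (𝔹 : TenseAlg L B)

theorem SatIn.mono {v w : α → B} {c : StrSeq L α} (hc : c.SatIn 𝔹 v)
    (h : c.All fun t a => sle t (w a) (v a)) : c.SatIn 𝔹 w :=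
  le_trans (Str.ev_mono 𝔹 h.1) (le_trans hc (Str.ev_mono 𝔹 h.2))

theorem satIn_congr {v w : α → B} {c : StrSeq L α} (h : c.All fun _ a => v a = w a) :
    c.SatIn 𝔹 v ↔ c.SatIn 𝔹 w := by
  unfold SatIn
  rw [Str.ev_congr 𝔹 h.1, Str.ev_congr 𝔹 h.2]

theorem satIn_subst {β : Type*} {v : β → B} {w : α → B} {σ : α → Str L β} {c : StrSeq L α}
    (h : c.All (fun t a => (σ a).ev 𝔹 v t = w a)) : (c.subst σ).SatIn 𝔹 v ↔ c.SatIn 𝔹 w := by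
  unfold SatIn subst
  rw [Str.ev_subst 𝔹 h.1, Str.ev_subst 𝔹 h.2]

end SatIn

end StrSeq

/-- The sequent with `S` in position `s` and `T` in the opposite position. -/
def sseq {L : DLELang.{u}} {α : Type v} : Sgn → Str L α → Str L α → StrSeq L α
  | .pos, S, T => S ⊩ T
  | .neg, S, T => T ⊩ S

section sseq

variable {L : DLELang.{u}} {α : Type v}

theorem sseq_opp (s : Sgn) (S T : Str L α) : sseq s.opp S T = sseq s T S := by cases s <;> rfl

theorem sided_sseq {s : Sgn} {S T : Str L α} : (sseq s S T).Sided ↔ S.Sided s ∧ T.Sided s.opp := by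
  cases s
  · exact Iff.rfl
  · exact and_comm

theorem all_sseq {P : Sgn → α → Prop} {s : Sgn} {S T : Str L α} :
    (sseq s S T).All P ↔ S.All P s ∧ T.All P s.opp := by
  cases s
  · exact Iff.rfl
  · exact and_comm

theorem occ_sseq (s : Sgn) (S T : Str L ℕ) (t : Sgn) (x : ℕ) :
    (sseq s S T).occ t x = S.occ (s.act t) x + T.occ (s.opp.act t) x := by
  cases s
  · simp [sseq, StrSeq.occ]
  · simp [sseq, StrSeq.occ, add_comm]

theorem satIn_sseq {B : Type w} [Preorder B] {𝔹 : TenseAlg L B} {v : α → B} {s : Sgn}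
    {S T : Str L α} : (sseq s S T).SatIn 𝔹 v ↔ sle s (S.ev 𝔹 v s) (T.ev 𝔹 v s.opp) := by
  cases s <;> rfl

end sseq

/-- Passing from the arguments of an operation to those of its residual. -/
theorem update_adjEps {L : DLELang.{u}} {α : Type v} {γ : Type w} {n : ℕ} (ε : Fin n → Sgn)
    (i : Fin n) (t : Sgn) (E : Sgn → Str L α → γ) (X : Fin n → Str L α) (Y : Str L α) :
    (fun j => E ((t.act (ε i)).act (adjEps ε i j)) (Function.update X i Y j)) =
      Function.update (fun j => E (t.opp.act (ε j)) (X j)) i (E t Y) := by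
  funext j
  by_cases hj : j = i
  · subst hj; simp
  · have : (t.act (ε i)).act (adjEps ε i j) = t.opp.act (ε j) := by
      rw [adjEps_of_ne _ hj, Sgn.act_opp, ← Sgn.act_assoc]; simp
    simp only [Function.update_of_ne hj, this]

/-! ### Display postulates in signed form and their invariants -/

namespace Display

variable {L : DLELang.{u}} {α : Type v}

/-- The eight postulates are four up to the choice of signs, so each invariant is checked four times
instead of eight. -/
theorem signed_cases {R : StrSeq L α → StrSeq L α → Prop}
    (hgt : ∀ s X Y Z, R (sseq s (Str.comma X Y) Z) (sseq s Y (Str.gt X Z)))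
    (hlt : ∀ s X Y Z, R (sseq s (Str.comma X Y) Z) (sseq s X (Str.lt Z Y)))
    (hF : ∀ f i X Y, R (sseq .pos (Str.H f X) Y)
      (sseq (L.epsF f i) (X i) (Str.Hres f i (Function.update X i Y))))
    (hG : ∀ g i X Y, R (sseq .neg (Str.K g X) Y)
      (sseq (L.epsG g i).opp (X i) (Str.Kres g i (Function.update X i Y))))
    {c d : StrSeq L α} (h : Display L α c d) : R c d := by
  cases h with
  | gt_left X Y Z => exact hgt .pos X Y Z
  | gt_right X Y Z => exact hgt .neg X Y Z
  | lt_left X Y Z => exact hlt .pos X Y Z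
  | lt_right X Y Z => exact hlt .neg X Y Z
  | f_pos f i X Y h => have := hF f i X Y; rw [h] at this; exact this
  | f_neg f i X Y h => have := hF f i X Y; rw [h] at this; exact this
  | g_pos g i X Y h => have := hG g i X Y; rw [h] at this; exact this
  | g_neg g i X Y h => have := hG g i X Y; rw [h] at this; exact this

theorem gt_sseq (s : Sgn) (X Y Z : Str L α) :
    Display L α (sseq s (Str.comma X Y) Z) (sseq s Y (Str.gt X Z)) := by
  cases s
  · exact gt_left _ _ _
  · exact gt_right _ _ _

theorem lt_sseq (s : Sgn) (X Y Z : Str L α) :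
    Display L α (sseq s (Str.comma X Y) Z) (sseq s X (Str.lt Z Y)) := by
  cases s
  · exact lt_left _ _ _
  · exact lt_right _ _ _

theorem f_sseq (f : L.F) (i : Fin (L.arF f)) (X : Fin (L.arF f) → Str L α) (Y : Str L α) :
    Display L α (sseq .pos (Str.H f X) Y)
      (sseq (L.epsF f i) (X i) (Str.Hres f i (Function.update X i Y))) := by
  cases h : L.epsF f i
  · exact f_pos f i X Y h
  · exact f_neg f i X Y h

theorem g_sseq (g : L.G) (i : Fin (L.arG g)) (X : Fin (L.arG g) → Str L α) (Y : Str L α) :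
    Display L α (sseq .neg (Str.K g X) Y)
      (sseq (L.epsG g i).opp (X i) (Str.Kres g i (Function.update X i Y))) := by
  cases h : L.epsG g i
  · exact g_pos g i X Y h
  · exact g_neg g i X Y h

theorem satIn_iff {B : Type w} [Preorder B] (𝔹 : TenseAlg L B) (v : α → B) {c d : StrSeq L α}
    (h : Display L α c d) : c.SatIn 𝔹 v ↔ d.SatIn 𝔹 v := by
  refine signed_cases (R := fun c d => c.SatIn 𝔹 v ↔ d.SatIn 𝔹 v) ?hgt ?hlt ?hF ?hG h
  case hgt =>
    intro s X Y Z
    simpa only [satIn_sseq, Str.ev, Sgn.opp_opp] using 𝔹.meet_sle_iff_gt s _ _ _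
  case hlt =>
    intro s X Y Z
    simpa only [satIn_sseq, Str.ev, Sgn.opp_opp] using 𝔹.meet_sle_iff_lt s _ _ _
  case hF =>
    intro f i X Y
    have h1 := 𝔹.f_res f i (fun j => (X j).ev 𝔹 v (L.epsF f j)) (Y.ev 𝔹 v .neg)
    have h2 := update_adjEps (L.epsF f) i .neg (fun s S => S.ev 𝔹 v s) X Y
    simp only [satIn_sseq, Str.ev, Sgn.neg_act, Sgn.pos_act, Sgn.opp_neg, Sgn.opp_pos] at h2 ⊢
    rw [h2]
    exact h1
  case hG =>
    intro g i X Y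
    have h1 := 𝔹.g_res g i (fun j => (X j).ev 𝔹 v (L.epsG g j).opp) (Y.ev 𝔹 v .pos)
    have h2 := update_adjEps (L.epsG g) i .pos (fun s S => S.ev 𝔹 v s) X Y
    simp only [satIn_sseq, Str.ev, Sgn.neg_act, Sgn.pos_act, Sgn.opp_neg, Sgn.opp_pos, Sgn.opp_opp,
      sle_opp] at h2 ⊢
    rw [h2]
    exact h1

theorem sided_iff {c d : StrSeq L α} (h : Display L α c d) : c.Sided ↔ d.Sided := by
  refine signed_cases (R := fun c d => c.Sided ↔ d.Sided) ?hgt ?hlt ?hF ?hG h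
  case hgt => intro s X Y Z; simp only [sided_sseq, Str.Sided, Sgn.opp_opp]; tauto
  case hlt => intro s X Y Z; simp only [sided_sseq, Str.Sided, Sgn.opp_opp]; tauto
  case hF =>
    intro f i X Y
    have h2 := congrFun (update_adjEps (L.epsF f) i .neg (fun s S => S.Sided s) X Y)
    simp only [sided_sseq, Str.Sided, Sgn.neg_act, Sgn.pos_act, Sgn.opp_neg, Sgn.opp_pos,
      true_and] at h2 ⊢
    simp only [h2]
    have := forall_and_swap i (P := fun j => (X j).Sided (L.epsF f j)) (Q := Function.update
      (fun j => (X j).Sided (L.epsF f j)) i (Y.Sided .neg)) (fun j hj => by simp [hj])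
    simpa only [Function.update_self] using this
  case hG =>
    intro g i X Y
    have h2 := congrFun (update_adjEps (L.epsG g) i .pos (fun s S => S.Sided s) X Y)
    simp only [sided_sseq, Str.Sided, Sgn.neg_act, Sgn.pos_act, Sgn.opp_neg, Sgn.opp_pos,
      true_and, Sgn.opp_opp] at h2 ⊢
    simp only [h2]
    have := forall_and_swap i (P := fun j => (X j).Sided (L.epsG g j).opp) (Q := Function.update
      (fun j => (X j).Sided (L.epsG g j).opp) i (Y.Sided .pos)) (fun j hj => by simp [hj])
    simpa only [Function.update_self] using this

/-- Subterms cross the turnstile but keep their positions. Hence occurrence conditions such as C3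
and C4 may be checked on any displayed form. -/
theorem occ_eq {c d : StrSeq L ℕ} (h : Display L ℕ c d) (t : Sgn) (x : ℕ) :
    c.occ t x = d.occ t x := by
  refine signed_cases (R := fun c d => c.occ t x = d.occ t x) ?hgt ?hlt ?hF ?hG h
  case hgt => intro s X Y Z; simp only [occ_sseq, Str.occ, Sgn.opp_opp, Sgn.opp_act]; omega
  case hlt => intro s X Y Z; simp only [occ_sseq, Str.occ, Sgn.opp_opp, Sgn.opp_act]; omega
  case hF =>
    intro f i X Y
    have h2 := congrFun (update_adjEps (L.epsF f) i .neg (fun s S => S.occ (s.act t) x) X Y)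
    have h3 : ∀ j, ((L.epsF f i).opp.act t).act (adjEps (L.epsF f) i j) =
        ((Sgn.neg.act (L.epsF f i)).act (adjEps (L.epsF f) i j)).act t := fun j => by
      rw [Sgn.act_assoc, Sgn.act_comm t, ← Sgn.act_assoc, Sgn.neg_act]
    simp only [occ_sseq, Str.occ, h3, h2]
    have := sum_add_eq_add_sum i (F := fun j => (X j).occ (t.act (L.epsF f j)) x) (G :=
      Function.update (fun j => (X j).occ (t.act (L.epsF f j)) x) i (Y.occ t.opp x))
      (fun j hj => by simp [hj])
    simpa [Sgn.act_comm t] using this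
  case hG =>
    intro g i X Y
    have h2 := congrFun (update_adjEps (L.epsG g) i .pos (fun s S => S.occ (s.act t) x) X Y)
    have h3 : ∀ j, ((L.epsG g i).act t).act (adjEps (L.epsG g) i j) =
        ((Sgn.pos.act (L.epsG g i)).act (adjEps (L.epsG g) i j)).act t := fun j => by
      rw [Sgn.act_assoc, Sgn.act_comm t, ← Sgn.act_assoc, Sgn.pos_act]
    simp only [occ_sseq, Str.occ, Sgn.opp_opp, h3, h2]
    have := sum_add_eq_add_sum i (F := fun j => (X j).occ (t.opp.act (L.epsG g j)) x) (G :=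
      Function.update (fun j => (X j).occ (t.opp.act (L.epsG g j)) x) i (Y.occ t x))
      (fun j hj => by simp [hj])
    simpa [Sgn.act_comm t] using this

end Display

/-- Display equivalence of sequents. -/
def DispEquiv (L : DLELang.{u}) (α : Type v) : StrSeq L α → StrSeq L α → Prop :=
  Relation.EqvGen (Display L α)

namespace DispEquiv

variable {L : DLELang.{u}} {α : Type v} {c d e : StrSeq L α}

theorem of (h : Display L α c d) : DispEquiv L α c d := Relation.EqvGen.rel _ _ h
theorem refl (c : StrSeq L α) : DispEquiv L α c c := Relation.EqvGen.refl _
theorem symm (h : DispEquiv L α c d) : DispEquiv L α d c := Relation.EqvGen.symm _ _ h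
theorem trans (h : DispEquiv L α c d) (h' : DispEquiv L α d e) : DispEquiv L α c e :=
  Relation.EqvGen.trans _ _ _ h h'

theorem induct {P : StrSeq L α → StrSeq L α → Prop} (hP : Equivalence P)
    (h : ∀ c d, Display L α c d → P c d) (hcd : DispEquiv L α c d) : P c d := by
  induction hcd with
  | rel _ _ h' => exact h _ _ h'
  | refl => exact hP.refl _
  | symm _ _ _ ih => exact hP.symm ih
  | trans _ _ _ _ _ ih ih' => exact hP.trans ih ih'

theorem satIn_iff {B : Type w} [Preorder B] (𝔹 : TenseAlg L B) (v : α → B)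
    (h : DispEquiv L α c d) : c.SatIn 𝔹 v ↔ d.SatIn 𝔹 v :=
  h.induct (P := fun c d => c.SatIn 𝔹 v ↔ d.SatIn 𝔹 v)
    ⟨fun _ => Iff.rfl, Iff.symm, Iff.trans⟩ fun _ _ => Display.satIn_iff 𝔹 v

theorem sided_iff (h : DispEquiv L α c d) : c.Sided ↔ d.Sided :=
  h.induct (P := fun c d => c.Sided ↔ d.Sided)
    ⟨fun _ => Iff.rfl, Iff.symm, Iff.trans⟩ fun _ _ => Display.sided_iff

theorem occ_eq {c d : StrSeq L ℕ} (h : DispEquiv L ℕ c d) (t : Sgn) (x : ℕ) :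
    c.occ t x = d.occ t x :=
  h.induct (P := fun c d => c.occ t x = d.occ t x)
    ⟨fun _ => rfl, Eq.symm, Eq.trans⟩ fun _ _ h => h.occ_eq t x

theorem gt_left (s : Sgn) (A B T : Str L α) :
    DispEquiv L α (sseq s (Str.gt A B) T) (sseq s B (Str.comma A T)) := by
  have h := (of (Display.gt_sseq s.opp A T B)).symm
  rwa [sseq_opp, sseq_opp] at h

theorem lt_left (s : Sgn) (A B T : Str L α) :
    DispEquiv L α (sseq s (Str.lt A B) T) (sseq s A (Str.comma T B)) := by
  have h := (of (Display.lt_sseq s.opp T B A)).symm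
  rwa [sseq_opp, sseq_opp] at h

theorem gt_right (s : Sgn) (A B T : Str L α) :
    DispEquiv L α (sseq s (Str.gt A B) T) (sseq s.opp A (Str.lt B T)) := by
  have h := of (Display.lt_sseq s.opp A T B)
  have h' := gt_left s A B T
  rw [sseq_opp] at h
  exact h'.trans h

theorem lt_right (s : Sgn) (A B T : Str L α) :
    DispEquiv L α (sseq s (Str.lt A B) T) (sseq s.opp B (Str.gt T A)) := by
  have h := of (Display.gt_sseq s.opp T B A)
  have h' := lt_left s A B T
  rw [sseq_opp] at h
  exact h'.trans h

/-- The residual is turned back into `H`: `T` takes the coordinate `i`, and the old entry there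
becomes the bound. Display inside a residual goes through this form. -/
theorem hres_self (f : L.F) (i : Fin (L.arF f)) (X : Fin (L.arF f) → Str L α) (T : Str L α) :
    DispEquiv L α (sseq (L.epsF f i).opp (Str.Hres f i X) T)
      (sseq .pos (Str.H f (Function.update X i T)) (X i)) := by
  have h := (of (Display.f_sseq f i (Function.update X i T) (X i))).symm
  simp only [Function.update_self, Function.update_idem, Function.update_eq_self] at h
  rwa [sseq_opp]

theorem kres_self (g : L.G) (i : Fin (L.arG g)) (X : Fin (L.arG g) → Str L α) (T : Str L α) :
    DispEquiv L α (sseq (L.epsG g i) (Str.Kres g i X) T)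
      (sseq .neg (Str.K g (Function.update X i T)) (X i)) := by
  have h := (of (Display.g_sseq g i (Function.update X i T) (X i))).symm
  simp only [Function.update_self, Function.update_idem, Function.update_eq_self] at h
  rwa [← sseq_opp]

end DispEquiv

/-- A variable occurring in a sided sequent can be displayed. -/
theorem Str.exists_display {L : DLELang.{u}} {x : ℕ} {S : Str L ℕ} (hx : S.Mem x) {s : Sgn}
    (hS : S.Sided s) (T : Str L ℕ) :
    ∃ t T', DispEquiv L ℕ (sseq s S T) (sseq t (leaf x) T') := by
  have mem_sum : ∀ {n : ℕ} {X : Fin n → Str L ℕ} {ε : Fin n → Sgn} {t : Sgn},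
      0 < ∑ j, (X j).occ (t.act (ε j)) x → ∃ j, (X j).Mem x := by
    intro n X ε t h
    obtain ⟨j, -, hj⟩ := Finset.sum_pos_iff.1 h
    exact ⟨j, _, hj⟩
  induction S generalizing s T with
  | leaf a =>
    obtain ⟨t, ht⟩ := hx
    simp only [occ] at ht
    split_ifs at ht with h
    · rw [h.1]; exact ⟨s, T, DispEquiv.refl _⟩
    · simp at ht
  | I => obtain ⟨t, ht⟩ := hx; simp [occ] at ht
  | comma A B ihA ihB =>
    obtain ⟨t, ht⟩ := hx
    simp only [occ, add_pos_iff] at ht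
    rcases ht with ht | ht
    · obtain ⟨t', T', h⟩ := ihA ⟨_, ht⟩ hS.1 (lt T B)
      exact ⟨t', T', (DispEquiv.of (Display.lt_sseq _ _ _ _)).trans h⟩
    · obtain ⟨t', T', h⟩ := ihB ⟨_, ht⟩ hS.2 (gt A T)
      exact ⟨t', T', (DispEquiv.of (Display.gt_sseq _ _ _ _)).trans h⟩
  | gt A B ihA ihB =>
    obtain ⟨t, ht⟩ := hx
    simp only [occ, add_pos_iff] at ht
    rcases ht with ht | ht
    · obtain ⟨t', T', h⟩ := ihA ⟨_, ht⟩ hS.1 (lt B T)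
      exact ⟨t', T', (DispEquiv.gt_right _ _ _ _).trans h⟩
    · obtain ⟨t', T', h⟩ := ihB ⟨_, ht⟩ hS.2 (comma A T)
      exact ⟨t', T', (DispEquiv.gt_left _ _ _ _).trans h⟩
  | lt A B ihA ihB =>
    obtain ⟨t, ht⟩ := hx
    simp only [occ, add_pos_iff] at ht
    rcases ht with ht | ht
    · obtain ⟨t', T', h⟩ := ihA ⟨_, ht⟩ hS.1 (comma T B)
      exact ⟨t', T', (DispEquiv.lt_left _ _ _ _).trans h⟩
    · obtain ⟨t', T', h⟩ := ihB ⟨_, ht⟩ hS.2 (gt T A)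
      exact ⟨t', T', (DispEquiv.lt_right _ _ _ _).trans h⟩
  | H f X ih =>
    obtain ⟨t, ht⟩ := hx
    obtain ⟨j, hj⟩ := mem_sum ht
    obtain ⟨rfl, hS⟩ := hS
    have hS := hS j
    rw [Sgn.pos_act] at hS
    obtain ⟨t', T', h⟩ := ih j hj hS (Hres f j (Function.update X j T))
    exact ⟨t', T', (DispEquiv.of (Display.f_sseq _ _ _ _)).trans h⟩
  | K g X ih =>
    obtain ⟨t, ht⟩ := hx
    obtain ⟨j, hj⟩ := mem_sum ht
    obtain ⟨rfl, hS⟩ := hS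
    have hS := hS j
    rw [Sgn.neg_act] at hS
    obtain ⟨t', T', h⟩ := ih j hj hS (Kres g j (Function.update X j T))
    exact ⟨t', T', (DispEquiv.of (Display.g_sseq _ _ _ _)).trans h⟩
  | Hres f i X ih =>
    obtain ⟨t, ht⟩ := hx
    obtain ⟨j, hj⟩ := mem_sum ht
    obtain ⟨rfl, hS⟩ := hS
    have hS := hS j
    have h1 := DispEquiv.hres_self f i X T
    by_cases hji : j = i
    · subst hji
      rw [adjEps_self, Sgn.opp_act, Sgn.act_self] at hS
      obtain ⟨t', T', h⟩ := ih j hj hS (H f (Function.update X j T))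
      exact ⟨t', T', h1.trans h⟩
    · rw [adjEps_of_ne _ hji, Sgn.act_opp, Sgn.opp_act, Sgn.opp_opp, Sgn.act_self_act] at hS
      obtain ⟨t', T', h⟩ := ih j hj hS _
      -- Off the coordinate `i` the route is indirect: the residual has become `H` with bound `X i`,
      -- and now the coordinate `j` of this `H` is displayed.
      have h2 := DispEquiv.of (Display.f_sseq f j (Function.update X i T) (X i))
      rw [Function.update_of_ne hji] at h2
      exact ⟨t', T', (h1.trans h2).trans h⟩
  | Kres g i X ih =>
    obtain ⟨t, ht⟩ := hx
    obtain ⟨j, hj⟩ := mem_sum ht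
    obtain ⟨rfl, hS⟩ := hS
    have hS := hS j
    have h1 := DispEquiv.kres_self g i X T
    by_cases hji : j = i
    · subst hji
      rw [adjEps_self, Sgn.act_self] at hS
      obtain ⟨t', T', h⟩ := ih j hj hS (K g (Function.update X j T))
      exact ⟨t', T', h1.trans h⟩
    · rw [adjEps_of_ne _ hji, Sgn.act_opp, Sgn.act_self_act] at hS
      obtain ⟨t', T', h⟩ := ih j hj hS _
      have h2 := DispEquiv.of (Display.g_sseq g j (Function.update X i T) (X i))
      rw [Function.update_of_ne hji] at h2
      exact ⟨t', T', (h1.trans h2).trans h⟩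

/-- A variable occurring in a sided sequent can be displayed. -/
theorem StrSeq.exists_display {L : DLELang.{u}} {x : ℕ} {c : StrSeq L ℕ} (hx : c.Mem x)
    (hc : c.Sided) : ∃ t T, DispEquiv L ℕ c (sseq t (Str.leaf x) T) := by
  obtain ⟨t, ht⟩ := hx
  rcases add_pos_iff.1 ht with ht | ht
  · exact Str.exists_display ⟨_, ht⟩ hc.1 c.suc
  · exact Str.exists_display (s := .neg) ⟨_, ht⟩ hc.2 c.ant

/-! ### From analytic rules to special rules -/

namespace SRule

variable {L : DLELang.{u}}

/-- Given C3, a variable has at most one sign in the conclusion, so C1 and C4 merge: each occurrence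
in a premise has the position of the occurrence in the conclusion. -/
theorem isAnalytic_iff {ρ : SRule L} : ρ.IsAnalytic ↔
    (∀ x, ρ.concl.occ .pos x + ρ.concl.occ .neg x ≤ 1) ∧
      ∀ c ∈ ρ.prems, c.All fun t x => 0 < ρ.concl.occ t x := by
  simp only [StrSeq.all_iff_occ]
  constructor
  · rintro ⟨c1, c3, c4⟩
    refine ⟨c3, fun c hc t x hx => ?_⟩
    obtain ⟨t', ht'⟩ := c1 c hc x ⟨t, hx⟩
    rcases Sgn.eq_or_eq_opp t' t with rfl | rfl
    · exact ht'
    · exact absurd (c4 c hc x t hx) ht'.ne'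
  · rintro ⟨c3, h⟩
    refine ⟨fun c hc x ⟨t, ht⟩ => ⟨t, h c hc t x ht⟩, c3, fun c hc x t ht => ?_⟩
    have h1 := h c hc t x ht
    have h2 := c3 x
    cases t <;> simp only [Sgn.opp_pos, Sgn.opp_neg] <;> omega

/-- Validity of a rule in a tense algebra. -/
def ValidIn {B : Type w} [Preorder B] (𝔹 : TenseAlg L B) (ρ : SRule L) : Prop :=
  ∀ v : ℕ → B, (∀ c ∈ ρ.prems, c.SatIn 𝔹 v) → ρ.concl.SatIn 𝔹 v

end SRule

theorem Sgn.eq_of_occ {L : DLELang.{u}} {d : StrSeq L ℕ} {x : ℕ}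
    (hd : d.occ .pos x + d.occ .neg x ≤ 1) {r t : Sgn} (hr : 0 < d.occ r x)
    (ht : 0 < d.occ t x) : r = t := by
  cases r <;> cases t <;> first | rfl | omega

/-- A sided sequent in which a variable occurs exactly once bounds that variable. -/
theorem StrSeq.exists_bound_value {L : DLELang.{u}} {B : Type w} [Preorder B] (𝔹 : TenseAlg L B)
    {d : StrSeq L ℕ} (hs : d.Sided) {x : ℕ} (hd : d.occ .pos x + d.occ .neg x ≤ 1) {t : Sgn}
    (ht : 0 < d.occ t x) (v : ℕ → B) :
    ∃ V, ∀ a, d.SatIn 𝔹 (Function.update v x a) ↔ sle t a V := by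
  obtain ⟨t', T, h⟩ := d.exists_display ⟨t, ht⟩ hs
  have h1 : d.occ t' x = 1 + T.occ .neg x := by
    rw [h.occ_eq, occ_sseq]; simp [Str.occ]
  have h2 : d.occ t'.opp x = T.occ .pos x := by
    rw [h.occ_eq, occ_sseq]; simp [Str.occ]
  obtain rfl : t' = t := Sgn.eq_of_occ hd (by omega) ht
  -- An occurrence of `x` in `T` would be a second occurrence in `d`; hence the bound given by `T`
  -- does not depend on the value of `x`.
  have h3 : ∀ s, T.All (fun _ y => y ≠ x) s := fun s => by
    rw [Str.all_iff_occ]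
    rintro r y hy rfl
    cases t' <;> cases r <;> simp only [Sgn.opp_pos, Sgn.opp_neg] at h1 h2 <;> omega
  refine ⟨T.ev 𝔹 v t'.opp, fun a => ?_⟩
  rw [h.satIn_iff, satIn_sseq, Str.ev_congr 𝔹 (w := v) ((h3 _).imp fun _ y hy => by simp [hy])]
  simp [Str.ev]

/-- The premise `c'` says that the conclusion `z ⊩ U` holds where the premise `c` fails. -/
def LocalizedPrem {L : DLELang.{u}} (z : ℕ) (U : Str L ℕ) (c c' : StrSeq L ℕ) : Prop :=
  ∃ x t T, DispEquiv L ℕ c (sseq t (Str.leaf x) T) ∧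
    c' = (Str.leaf z ⊩ U.subst (Function.update Str.leaf x (Str.gt T (Str.leaf x))))

/-! ### Localizing the premises: positions, sidedness, validity -/

namespace LocalizedPrem

variable {L : DLELang.{u}} {z : ℕ} {U : Str L ℕ} {c c' : StrSeq L ℕ}

/-- Display does not change positions, so `T` stands in `c` opposite to `x`. In `T > x`, put in the
place of `x`, both `T` and `x` keep the positions that they had in `c`. -/
theorem all_occ (h : LocalizedPrem z U c c')
    (hd : ∀ x, (Str.leaf z ⊩ U).occ .pos x + (Str.leaf z ⊩ U).occ .neg x ≤ 1)
    (hc : c.All fun t x => 0 < (Str.leaf z ⊩ U).occ t x) :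
    c'.All fun t x => 0 < (Str.leaf z ⊩ U).occ t x := by
  obtain ⟨x, t, T, h, rfl⟩ := h
  have hT : (sseq t (Str.leaf x) T).All fun t x => 0 < (Str.leaf z ⊩ U).occ t x := by
    rw [StrSeq.all_iff_occ] at hc ⊢
    intro r y hy
    exact hc r y (by rwa [h.occ_eq])
  rw [all_sseq] at hT
  have hself : (Str.leaf z ⊩ U).All fun t x => 0 < (Str.leaf z ⊩ U).occ t x := by
    rw [StrSeq.all_iff_occ]; exact fun _ _ h => h
  refine ⟨hself.1, ?_⟩
  rw [Str.all_subst]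
  refine hself.2.imp fun r y hy => ?_
  by_cases hyx : y = x
  · subst hyx
    obtain rfl := Sgn.eq_of_occ (hd y) hy hT.1
    rw [Function.update_self]
    exact ⟨hT.2, hT.1⟩
  · rw [Function.update_of_ne hyx]
    exact hy

theorem sided (h : LocalizedPrem z U c c') (hcs : c.Sided) (hU : U.Sided .neg)
    (hd : ∀ x, (Str.leaf z ⊩ U).occ .pos x + (Str.leaf z ⊩ U).occ .neg x ≤ 1)
    (hc : c.All fun t x => 0 < (Str.leaf z ⊩ U).occ t x) : c'.Sided := by
  obtain ⟨x, t, T, h, rfl⟩ := h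
  have ht : 0 < (Str.leaf z ⊩ U).occ t x := by
    rw [StrSeq.all_iff_occ] at hc
    refine hc t x ?_
    rw [h.occ_eq, occ_sseq]
    simp [Str.occ]
  have hT := sided_sseq.1 (h.sided_iff.1 hcs)
  refine ⟨trivial, ?_⟩
  rw [Str.sided_subst]
  refine ⟨hU, ?_⟩
  have hself : (Str.leaf z ⊩ U).All fun t x => 0 < (Str.leaf z ⊩ U).occ t x := by
    rw [StrSeq.all_iff_occ]; exact fun _ _ h => h
  refine hself.2.imp fun r y hy => ?_
  by_cases hyx : y = x
  · subst hyx
    obtain rfl := Sgn.eq_of_occ (hd y) hy ht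
    rw [Function.update_self]
    exact ⟨hT.2, trivial⟩
  · rw [Function.update_of_ne hyx]
    trivial

theorem suc_all_ne (h : LocalizedPrem z U c c') (hU : ∀ s, U.All (fun _ y => y ≠ z) s)
    (hc : c.All fun _ y => y ≠ z) : c'.ant = Str.leaf z ∧ c'.suc.All (fun _ y => y ≠ z) .neg := by
  obtain ⟨x, t, T, h, rfl⟩ := h
  refine ⟨rfl, ?_⟩
  have hT : (sseq t (Str.leaf x) T).All fun _ y => y ≠ z := by
    rw [StrSeq.all_iff_occ] at hc ⊢
    intro r y hy
    exact hc r y (by rwa [h.occ_eq])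
  rw [all_sseq] at hT
  rw [Str.all_subst]
  refine (hU _).imp fun r y hy => ?_
  by_cases hyx : y = x
  · subst hyx
    rw [Function.update_self]
    refine ⟨?_, hy⟩
    have := hT.2
    rw [Str.all_iff_occ] at this ⊢
    exact fun t' y' => this t' y'
  · rw [Function.update_of_ne hyx]
    exact hy

/-- A property of assignments that is preserved when the values of the variables of `d` decrease
in the sense of their positions. -/
def DownClosed {B : Type w} [Preorder B] (d : StrSeq L ℕ) (Γ : (ℕ → B) → Prop) : Prop :=
  ∀ v x t a, 0 < d.occ t x → sle t a (v x) → Γ v → Γ (Function.update v x a)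

/-- The positions in `c` are those in `d`, so decreasing values in the order of their positions
lowers the antecedent of `c` and raises its succedent. -/
theorem downClosed_satIn {B : Type w} [Preorder B] (𝔹 : TenseAlg L B) {d c : StrSeq L ℕ}
    (hd : ∀ x, d.occ .pos x + d.occ .neg x ≤ 1)
    (hc : c.All fun t x => 0 < d.occ t x) : DownClosed d (fun v => c.SatIn 𝔹 v) := by
  intro v x t a ht ha hv
  refine hv.mono 𝔹 (hc.imp fun r y hy => ?_)
  by_cases hyx : y = x
  · subst hyx
    obtain rfl := Sgn.eq_of_occ (hd y) hy ht
    simpa using ha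
  · simp only [Function.update_of_ne hyx]
    exact sle_refl _ _

/-- If the conclusion bounds `x` by `V`, then `c'` says `x ≤ T ∨ V` (for `t = pos`). This follows
from `c`, which says `x ≤ T`; conversely it can be cut against `x ∧ T ≤ V`, which the old rule
yields at the smaller value `x ∧ T`. The context `Γ` stands for the other premises and has to
survive that decrease. -/
theorem valid_iff {B : Type w} [Preorder B] (𝔹 : TenseAlg L B) (h : LocalizedPrem z U c c')
    (hU : U.Sided .neg) (hcz : c.All fun _ y => y ≠ z)
    (hd : ∀ x, (Str.leaf z ⊩ U).occ .pos x + (Str.leaf z ⊩ U).occ .neg x ≤ 1)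
    (hc : c.All fun t x => 0 < (Str.leaf z ⊩ U).occ t x)
    {Γ : (ℕ → B) → Prop} (hΓ : DownClosed (Str.leaf z ⊩ U) Γ) :
    (∀ v, Γ v → c.SatIn 𝔹 v → (Str.leaf z ⊩ U).SatIn 𝔹 v) ↔
      ∀ v, Γ v → c'.SatIn 𝔹 v → (Str.leaf z ⊩ U).SatIn 𝔹 v := by
  obtain ⟨x, t, T, h, rfl⟩ := h
  have hocc : 0 < c.occ t x := by
    rw [h.occ_eq, occ_sseq]
    simp [Str.occ]
  have ht : 0 < (Str.leaf z ⊩ U).occ t x := StrSeq.all_iff_occ.1 hc t x hocc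
  have hxz : x ≠ z := StrSeq.all_iff_occ.1 hcz t x hocc
  have hself : (Str.leaf z ⊩ U).All fun t x => 0 < (Str.leaf z ⊩ U).occ t x := by
    rw [StrSeq.all_iff_occ]; exact fun _ _ h => h
  -- Substituting `T > x` for `x` amounts to changing the value of `x`. `T` itself is evaluated at
  -- the original assignment, even if it contains `x`.
  have key : ∀ v : ℕ → B, (Str.leaf z ⊩ U.subst (Function.update Str.leaf x
      (Str.gt T (Str.leaf x)))).SatIn 𝔹 v ↔ (Str.leaf z ⊩ U).SatIn 𝔹
        (Function.update v x (𝔹.gt t (T.ev 𝔹 v t.opp) (v x))) := by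
    intro v
    unfold StrSeq.SatIn
    rw [Str.ev_subst 𝔹 (w := Function.update v x (𝔹.gt t (T.ev 𝔹 v t.opp) (v x)))]
    · simp [Str.ev, Function.update_of_ne hxz.symm]
    · refine hself.2.imp fun r y hy => ?_
      by_cases hyx : y = x
      · subst hyx
        obtain rfl := Sgn.eq_of_occ (hd y) hy ht
        simp [Str.ev]
      · simp [Function.update_of_ne hyx, Str.ev]
  have hsat : ∀ v : ℕ → B, c.SatIn 𝔹 v ↔ sle t (v x) (T.ev 𝔹 v t.opp) := by
    intro v
    rw [h.satIn_iff, satIn_sseq]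
    rfl
  constructor
  · intro H v hv hv'
    obtain ⟨V, hV⟩ := StrSeq.exists_bound_value 𝔹 (d := (Str.leaf z ⊩ U)) ⟨trivial, hU⟩ (hd x) ht v
    rw [key, hV, 𝔹.gt_res] at hv'
    have ha := 𝔹.meet_left t (v x) (T.ev 𝔹 v t.opp)
    have hw := H _ (hΓ v x t _ ht ha hv) <| by
      rw [hsat, Function.update_self]
      refine (𝔹.meet_right _ _ _).trans ?_
      have hT : (sseq t (Str.leaf x) T).All fun t x => 0 < (Str.leaf z ⊩ U).occ t x := by
        rw [StrSeq.all_iff_occ] at hc ⊢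
        intro r y hy
        exact hc r y (by rwa [h.occ_eq])
      rw [← sle_opp]
      -- `T` may contain `x`, but only in the position in which `x` is displayed; so lowering `x`
      -- weakens the bound imposed by `T`.
      refine Str.ev_mono 𝔹 ((all_sseq.1 hT).2.imp fun r y hy => ?_)
      by_cases hyx : y = x
      · subst hyx
        obtain rfl := Sgn.eq_of_occ (hd y) hy ht
        simpa using ha
      · simp only [Function.update_of_ne hyx]
        exact sle_refl _ _
    rw [hV] at hw
    have := (hV _).2 (𝔹.sle_of_meet_sle hv' hw)
    rwa [Function.update_eq_self] at this
  · intro H v hv hv'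
    refine H v hv ?_
    obtain ⟨V, hV⟩ := StrSeq.exists_bound_value 𝔹 (d := (Str.leaf z ⊩ U)) ⟨trivial, hU⟩ (hd x) ht v
    rw [key, hV, 𝔹.gt_res]
    exact ((hsat v).1 hv').trans (𝔹.left_sle _ _ _)

/-- The premises are exchanged one at a time. While one is treated, the others, whether original or
already localized, sit in `Γ`; both kinds are down-closed. -/
theorem valid_list_iff {B : Type w} [Preorder B] (𝔹 : TenseAlg L B)
    (hU : U.Sided .neg)
    (hd : ∀ x, (Str.leaf z ⊩ U).occ .pos x + (Str.leaf z ⊩ U).occ .neg x ≤ 1)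
    {l l' : List (StrSeq L ℕ)} (h : List.Forall₂ (LocalizedPrem z U) l l')
    (hcz : ∀ c ∈ l, c.All fun _ y => y ≠ z)
    (hc : ∀ c ∈ l, c.All fun t x => 0 < (Str.leaf z ⊩ U).occ t x)
    {Γ : (ℕ → B) → Prop} (hΓ : DownClosed (Str.leaf z ⊩ U) Γ) :
    (∀ v, Γ v → (∀ c ∈ l, c.SatIn 𝔹 v) → (Str.leaf z ⊩ U).SatIn 𝔹 v) ↔
      ∀ v, Γ v → (∀ c ∈ l', c.SatIn 𝔹 v) → (Str.leaf z ⊩ U).SatIn 𝔹 v := by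
  induction h generalizing Γ with
  | nil => exact Iff.rfl
  | @cons c c' l l' hcc' hl ih =>
    simp only [List.forall_mem_cons] at hcz hc ⊢
    have h1 := hcc'.valid_iff 𝔹 hU hcz.1 hd hc.1 (Γ := fun v => Γ v ∧ ∀ c ∈ l, c.SatIn 𝔹 v)
      (fun v x t a ht ha hv => ⟨hΓ v x t a ht ha hv.1, fun e he =>
        downClosed_satIn 𝔹 hd (hc.2 e he) v x t a ht ha (hv.2 e he)⟩)
    have h2 := ih hcz.2 hc.2 (Γ := fun v => Γ v ∧ c'.SatIn 𝔹 v)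
      (fun v x t a ht ha hv => ⟨hΓ v x t a ht ha hv.1,
        downClosed_satIn 𝔹 hd (hcc'.all_occ hd hc.1) v x t a ht ha hv.2⟩)
    constructor
    · intro H v hv hv'
      exact h2.1 (fun v hv hl => h1.1 (fun v hv hcv => H v hv.1 ⟨hcv, hv.2⟩) v ⟨hv.1, hl⟩ hv.2)
        v ⟨hv, hv'.1⟩ hv'.2
    · intro H v hv hv'
      exact h1.2 (fun v hv hcv => h2.2 (fun v hv hl => H v hv.1 ⟨hv.2, hl⟩) v ⟨hv.1, hcv⟩ hv.2)
        v ⟨hv, hv'.2⟩ hv'.1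

end LocalizedPrem

/-- `ρ'` is the special rule, with displayed variable `z`, that localizes the premises of `ρ`. -/
structure SRule.Localizes {L : DLELang.{u}} (z : ℕ) (ρ ρ' : SRule L) : Prop where
  fresh : ∀ c ∈ ρ.concl :: ρ.prems, c.All fun _ y => y ≠ z
  concl : ρ'.concl = (Str.leaf z ⊩ Str.gt ρ.concl.ant ρ.concl.suc)
  prems : List.Forall₂ (LocalizedPrem z (Str.gt ρ.concl.ant ρ.concl.suc)) ρ.prems ρ'.prems

namespace SRule

variable {L : DLELang.{u}}

/-- Any `z` beyond the finitely many variables of the rule is fresh. Sidedness and the presence of a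
variable in each premise are what makes a variable displayable there. -/
theorem exists_localizes {ρ : SRule L} (hs : ρ.Sided) (hm : ∀ c ∈ ρ.prems, ∃ x, c.Mem x) :
    ∃ z ρ', ρ.Localizes z ρ' := by
  have hb : ∀ l : List (StrSeq L ℕ), ∃ n, ∀ c ∈ l, c.All fun _ x => x < n := by
    intro l
    induction l with
    | nil => exact ⟨0, by simp⟩
    | cons c l ih =>
      obtain ⟨n, hn⟩ := ih
      obtain ⟨m, hm⟩ := c.ant.exists_bound
      obtain ⟨k, hk⟩ := c.suc.exists_bound
      refine ⟨n + m + k, List.forall_mem_cons.2 ⟨⟨(hm _).imp fun _ x hx => ?_,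
        (hk _).imp fun _ x hx => ?_⟩, fun e he => (hn e he).imp fun _ x hx => ?_⟩⟩ <;> omega
  obtain ⟨z, hz⟩ := hb (ρ.concl :: ρ.prems)
  have hl : ∀ l : List (StrSeq L ℕ), (∀ c ∈ l, c.Sided ∧ ∃ x, c.Mem x) →
      ∃ l', List.Forall₂ (LocalizedPrem z (Str.gt ρ.concl.ant ρ.concl.suc)) l l' := by
    intro l
    induction l with
    | nil => exact fun _ => ⟨[], .nil⟩
    | cons c l ih =>
      intro h
      rw [List.forall_mem_cons] at h
      obtain ⟨l', hl'⟩ := ih h.2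
      obtain ⟨hc, x, hx⟩ := h.1
      obtain ⟨t, T, hT⟩ := c.exists_display hx hc
      exact ⟨_ :: l', .cons ⟨x, t, T, hT, rfl⟩ hl'⟩
  obtain ⟨l', hl'⟩ := hl ρ.prems fun c hc => ⟨hs.2 c hc, hm c hc⟩
  exact ⟨z, ⟨l', _⟩, fun c hc => (hz c hc).imp fun _ x hx => hx.ne, rfl, hl'⟩

/-! ### The localized rule is special, sided and equivalent -/

namespace Localizes

variable {z : ℕ} {ρ ρ' : SRule L}

theorem gt_all_ne (h : ρ.Localizes z ρ') (s : Sgn) :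
    (Str.gt ρ.concl.ant ρ.concl.suc).All (fun _ y => y ≠ z) s := by
  have h1 := h.fresh _ List.mem_cons_self
  have h2 := h1.1
  have h3 := h1.2
  rw [Str.all_iff_occ] at h2 h3
  refine ⟨?_, ?_⟩ <;> rw [Str.all_iff_occ]
  · exact fun t x => h2 t x
  · exact fun t x => h3 t x

theorem occ_concl (h : ρ.Localizes z ρ') {t : Sgn} {x : ℕ} (hx : x ≠ z) :
    ρ'.concl.occ t x = ρ.concl.occ t x := by
  rw [h.concl]
  simp [StrSeq.occ, Str.occ, hx.symm]

theorem occ_le (h : ρ.Localizes z ρ') (ha : ρ.IsAnalytic) (x : ℕ) :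
    ρ'.concl.occ .pos x + ρ'.concl.occ .neg x ≤ 1 := by
  by_cases hx : x = z
  · subst hx
    have h1 := h.gt_all_ne .neg
    rw [Str.all_iff_occ] at h1
    have h2 : ∀ t, (Str.gt ρ.concl.ant ρ.concl.suc).occ t x = 0 := fun t =>
      Nat.eq_zero_of_not_pos fun h' => h1 t x h' rfl
    rw [h.concl]
    simp only [StrSeq.occ, h2]
    simp [Str.occ]
  · rw [h.occ_concl hx, h.occ_concl hx]
    exact ha.c3 x

theorem prems_all (h : ρ.Localizes z ρ') (ha : ρ.IsAnalytic) :
    ∀ c ∈ ρ.prems, c.All fun t x => 0 < ρ'.concl.occ t x := by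
  intro c hc
  have h1 := (isAnalytic_iff.1 ha).2 c hc
  have h2 := h.fresh c (List.mem_cons_of_mem _ hc)
  rw [StrSeq.all_iff_occ] at h1 h2 ⊢
  intro t x hx
  rw [h.occ_concl (h2 t x hx)]
  exact h1 t x hx

theorem isSpecial_left (h : ρ.Localizes z ρ') (ha : ρ.IsAnalytic) : ρ'.IsAnalytic ∧
    ∀ c ∈ ρ'.concl :: ρ'.prems, c.ant = Str.leaf z ∧ ¬ c.suc.Mem z := by
  have h1 := h.occ_le ha
  have h2 := h.prems_all ha
  have key : ∀ c' ∈ ρ'.prems, ∃ c ∈ ρ.prems,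
      LocalizedPrem z (Str.gt ρ.concl.ant ρ.concl.suc) c c' := fun c' hc' => by
    obtain ⟨i, hi, rfl⟩ := List.getElem_of_mem hc'
    have hlen := h.prems.length_eq
    exact ⟨ρ.prems[i], List.getElem_mem _, h.prems.get (by omega) hi⟩
  have ne_mem : ∀ S : Str L ℕ, S.All (fun _ y => y ≠ z) .neg → ¬ S.Mem z := by
    rintro S hS ⟨t, ht⟩
    exact Str.all_iff_occ _ _ |>.1 hS t z ht rfl
  refine ⟨isAnalytic_iff.2 ⟨h1, fun c' hc' => ?_⟩, fun c' hc' => ?_⟩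
  · obtain ⟨c, hc, hcc'⟩ := key c' hc'
    have h2 := h2 c hc
    rw [h.concl] at h1 h2 ⊢
    exact hcc'.all_occ h1 h2
  · rcases List.mem_cons.1 hc' with rfl | hc'
    · rw [h.concl]
      exact ⟨rfl, ne_mem _ (h.gt_all_ne _)⟩
    · obtain ⟨c, hc, hcc'⟩ := key c' hc'
      have := hcc'.suc_all_ne h.gt_all_ne (h.fresh c (List.mem_cons_of_mem _ hc))
      exact ⟨this.1, ne_mem _ this.2⟩

theorem isSpecial (h : ρ.Localizes z ρ') (ha : ρ.IsAnalytic) : ρ'.IsSpecial :=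
  ⟨(h.isSpecial_left ha).1, z, Or.inl (h.isSpecial_left ha).2⟩

theorem sided (h : ρ.Localizes z ρ') (ha : ρ.IsAnalytic) (hs : ρ.Sided) : ρ'.Sided := by
  have h1 := h.occ_le ha
  have h2 := h.prems_all ha
  have hU : (Str.gt ρ.concl.ant ρ.concl.suc).Sided .neg := hs.1
  refine ⟨?_, fun c' hc' => ?_⟩
  · rw [h.concl]
    exact ⟨trivial, hU⟩
  · obtain ⟨i, hi, rfl⟩ := List.getElem_of_mem hc'
    have hlen := h.prems.length_eq
    have hm : ρ.prems[i] ∈ ρ.prems := List.getElem_mem _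
    have hcc' := h.prems.get (by omega) hi
    have h2 := h2 _ hm
    rw [h.concl] at h1 h2
    exact hcc'.sided (hs.2 _ hm) hU h1 h2

/-- Once the premises are exchanged by `valid_list_iff`, only the conclusions differ: `S ≤ T`
against `S ∧ z ≤ T` for a variable `z` absent from the original rule. -/
theorem validIn_iff (h : ρ.Localizes z ρ') (ha : ρ.IsAnalytic) (hs : ρ.Sided) {B : Type w}
    [Preorder B] (𝔹 : TenseAlg L B) : ρ.ValidIn 𝔹 ↔ ρ'.ValidIn 𝔹 := by
  have h1 := h.occ_le ha
  have h2 := h.prems_all ha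
  rw [h.concl] at h1 h2
  have h3 := LocalizedPrem.valid_list_iff 𝔹 (U := Str.gt ρ.concl.ant ρ.concl.suc) hs.1 h1 h.prems
    (fun c hc => h.fresh c (List.mem_cons_of_mem _ hc)) h2 (Γ := fun _ => True)
    (fun _ _ _ _ _ _ _ => trivial)
  simp only [true_implies] at h3
  unfold ValidIn
  rw [h.concl, ← h3]
  have key : ∀ v : ℕ → B, (Str.leaf z ⊩ Str.gt ρ.concl.ant ρ.concl.suc).SatIn 𝔹 v ↔
      𝔹.meet .pos (ρ.concl.ant.ev 𝔹 v .pos) (v z) ≤ ρ.concl.suc.ev 𝔹 v .neg := fun v =>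
    (𝔹.meet_sle_iff_gt .pos _ _ _).symm
  constructor
  · intro H v hv
    rw [key]
    exact le_trans (𝔹.meet_left .pos _ _) (H v hv)
  · intro H v hv
    have hcongr : ∀ c ∈ ρ.concl :: ρ.prems,
        (c.SatIn 𝔹 (Function.update v z (𝔹.unit .pos)) ↔ c.SatIn 𝔹 v) := fun c hc =>
      StrSeq.satIn_congr 𝔹 ((h.fresh c hc).imp fun _ y hy => Function.update_of_ne hy _ _)
    -- Taking `z = ⊤` recovers the original conclusion; by freshness it does not affect the
    -- premises.
    have h4 := H (Function.update v z (𝔹.unit .pos))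
      fun c hc => (hcongr c (List.mem_cons_of_mem _ hc)).2 (hv c hc)
    rw [key, Function.update_self] at h4
    rw [← hcongr _ List.mem_cons_self]
    exact le_trans ((𝔹.sle_meet .pos _ _ _).2 ⟨le_rfl, 𝔹.sle_unit .pos _⟩) h4

end Localizes

end SRule

/-! ### Perfect algebras -/

namespace DLEOps

variable {L : DLELang.{u}} {A : Type v} [CompletelyDistribLattice A] {𝔸 : DLEOps L A}

/-- The adjoint functor theorem in one coordinate: by complete preservation, the supremum (or
infimum) that defines `resF` is itself a solution of the defining inequality. -/
theorem IsPerfect.f_res (h : 𝔸.IsPerfect) (f : L.F) (i : Fin (L.arF f)) (a : Fin (L.arF f) → A)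
    (b : A) : 𝔸.opF f a ≤ b ↔ sle (L.epsF f i) (a i) (𝔸.resF f i (Function.update a i b)) := by
  cases e : L.epsF f i with
  | pos =>
    -- Monotonicity is preservation of the join of the pair `{x, y}`, whose join is `y`.
    have hmono : ∀ x y, x ≤ y →
        𝔸.opF f (Function.update a i x) ≤ 𝔸.opF f (Function.update a i y) := fun x y hxy => by
      have h1 := h.f_pos f i e a {x, y}
      rw [sSup_pair, sup_eq_right.2 hxy] at h1
      rw [h1]
      exact le_sSup ⟨x, by simp, rfl⟩
    simp only [resF, e, sle_pos, Function.update_idem, Function.update_self]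
    constructor
    · intro hab
      exact le_sSup (by simpa using hab)
    · intro hab
      have h1 := hmono _ _ hab
      rw [Function.update_eq_self, h.f_pos f i e] at h1
      refine h1.trans (sSup_le ?_)
      rintro _ ⟨x, hx, rfl⟩
      exact hx
  | neg =>
    have hmono : ∀ x y, x ≤ y →
        𝔸.opF f (Function.update a i y) ≤ 𝔸.opF f (Function.update a i x) := fun x y hxy => by
      have h1 := h.f_neg f i e a {x, y}
      rw [sInf_pair, inf_eq_left.2 hxy] at h1
      rw [h1]
      exact le_sSup ⟨y, by simp, rfl⟩
    simp only [resF, e, sle_neg, Function.update_idem, Function.update_self]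
    constructor
    · intro hab
      exact sInf_le (by simpa using hab)
    · intro hab
      have h1 := hmono _ _ hab
      rw [Function.update_eq_self, h.f_neg f i e] at h1
      refine h1.trans (sSup_le ?_)
      rintro _ ⟨x, hx, rfl⟩
      exact hx

theorem IsPerfect.g_res (h : 𝔸.IsPerfect) (g : L.G) (i : Fin (L.arG g)) (a : Fin (L.arG g) → A)
    (b : A) : b ≤ 𝔸.opG g a ↔ sle (L.epsG g i) (𝔸.resG g i (Function.update a i b)) (a i) := by
  cases e : L.epsG g i with
  | pos =>
    have hmono : ∀ x y, x ≤ y →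
        𝔸.opG g (Function.update a i x) ≤ 𝔸.opG g (Function.update a i y) := fun x y hxy => by
      have h1 := h.g_pos g i e a {x, y}
      rw [sInf_pair, inf_eq_left.2 hxy] at h1
      rw [h1]
      exact sInf_le ⟨y, by simp, rfl⟩
    simp only [resG, e, sle_pos, Function.update_idem, Function.update_self]
    constructor
    · intro hab
      exact sInf_le (by simpa using hab)
    · intro hab
      have h1 := hmono _ _ hab
      rw [Function.update_eq_self, h.g_pos g i e] at h1
      refine (le_sInf ?_).trans h1
      rintro _ ⟨x, hx, rfl⟩
      exact hx
  | neg =>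
    have hmono : ∀ x y, x ≤ y →
        𝔸.opG g (Function.update a i y) ≤ 𝔸.opG g (Function.update a i x) := fun x y hxy => by
      have h1 := h.g_neg g i e a {x, y}
      rw [sSup_pair, sup_eq_right.2 hxy] at h1
      rw [h1]
      exact sInf_le ⟨x, by simp, rfl⟩
    simp only [resG, e, sle_neg, Function.update_idem, Function.update_self]
    constructor
    · intro hab
      exact le_sSup (by simpa using hab)
    · intro hab
      have h1 := hmono _ _ hab
      rw [Function.update_eq_self, h.g_neg g i e] at h1
      refine (le_sInf ?_).trans h1
      rintro _ ⟨x, hx, rfl⟩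
      exact hx

/-- A perfect algebra as a tense algebra. -/
def IsPerfect.tenseAlg (h : 𝔸.IsPerfect) : TenseAlg L A where
  unit s := match s with | .pos => ⊤ | .neg => ⊥
  meet s a b := match s with | .pos => a ⊓ b | .neg => a ⊔ b
  gt s a b := match s with | .pos => b \ a | .neg => a ⇨ b
  lt s a b := match s with | .pos => a \ b | .neg => b ⇨ a
  opF := 𝔸.opF
  opG := 𝔸.opG
  resF := 𝔸.resF
  resG := 𝔸.resG
  sle_unit s a := by
    cases s
    · exact le_top
    · exact bot_le
  sle_meet s a b c := by
    cases s
    · exact le_inf_iff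
    · exact sup_le_iff
  gt_res s a b c := by
    cases s
    · exact sdiff_le_iff
    · exact le_himp_iff'
  lt_res s a b c := by
    cases s
    · exact sdiff_le_iff'
    · exact le_himp_iff
  f_res := h.f_res
  g_res := h.g_res

theorem IsPerfect.eval_eq (h : 𝔸.IsPerfect) (v : ℕ → A) (s : Sgn) (S : Str L ℕ) :
    S.eval 𝔸 v s = S.ev h.tenseAlg v s := by
  induction S generalizing s with
  | leaf a => cases s <;> rfl
  | I => cases s <;> rfl
  | comma S T ihS ihT => cases s <;> simp only [Str.eval, Str.ev, ihS, ihT] <;> rfl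
  | gt S T ihS ihT => cases s <;> simp only [Str.eval, Str.ev, ihS, ihT] <;> rfl
  | lt S T ihS ihT => cases s <;> simp only [Str.eval, Str.ev, ihS, ihT] <;> rfl
  | H f X ih => cases s <;> simp only [Str.eval, Str.ev, ih] <;> rfl
  | K g X ih => cases s <;> simp only [Str.eval, Str.ev, ih] <;> rfl
  | Hres f i X ih => cases s <;> simp only [Str.eval, Str.ev, ih] <;> rfl
  | Kres g i X ih => cases s <;> simp only [Str.eval, Str.ev, ih] <;> rfl

theorem IsPerfect.valid_iff (h : 𝔸.IsPerfect) (ρ : SRule L) :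
    ρ.Valid 𝔸 ↔ ρ.ValidIn h.tenseAlg := by
  have : ∀ (v : ℕ → A) (c : StrSeq L ℕ), c.Sat 𝔸 v ↔ c.SatIn h.tenseAlg v := fun v c => by
    unfold StrSeq.Sat StrSeq.SatIn
    rw [h.eval_eq, h.eval_eq]
  simp only [SRule.Valid, SRule.ValidIn, this]

end DLEOps

/-- Every interpretable analytic rule whose premises contain variables is equivalent to an
interpretable special rule. -/
theorem SRule.exists_special_equiv {L : DLELang.{u}} {ρ : SRule L} (ha : ρ.IsAnalytic)
    (hs : ρ.Sided) (hm : ∀ c ∈ ρ.prems, ∃ x, c.Mem x) :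
    ∃ ρ' : SRule L, ρ'.IsSpecial ∧ ρ'.Sided ∧
      ∀ (A : Type v) [CompletelyDistribLattice A] (𝔸 : DLEOps L A), 𝔸.IsPerfect →
        (ρ.Valid 𝔸 ↔ ρ'.Valid 𝔸) := by
  obtain ⟨z, ρ', h⟩ := SRule.exists_localizes hs hm
  refine ⟨ρ', h.isSpecial ha, h.sided ha hs, fun A _ 𝔸 hA => ?_⟩
  rw [hA.valid_iff, hA.valid_iff]
  exact h.validIn_iff ha hs hA.tenseAlg

/-! ### The algebra of closed sets of structures -/

/-- A set of sided sequents closed under the display postulates and the structural rules needed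
for its Galois-closed sets to form a tense algebra. -/
structure IsDisplayFrame {L : DLELang.{u}} {α : Type v} (D : StrSeq L α → Prop) : Prop where
  sided : ∀ {c}, D c → c.Sided
  disp : ∀ {c d}, Display L α c d → (D c ↔ D d)
  struct : ∀ {ps c}, StructRule L α ps c → c.Sided → (∀ p ∈ ps, D p) → D c

/-- Galois-closed sets of structures for the relation `D`, presented by their two polars. -/
structure ClosedPair {L : DLELang.{u}} {α : Type v} (D : StrSeq L α → Prop) : Type (max u v) where
  side : Sgn → Set (Str L α)
  mem_side : ∀ s x, x ∈ side s ↔ x.Sided s ∧ ∀ y ∈ side s.opp, D (sseq s x y)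

namespace ClosedPair

variable {L : DLELang.{u}} {α : Type v} {D : StrSeq L α → Prop}

instance : Preorder (ClosedPair D) where
  le a b := a.side .pos ⊆ b.side .pos
  le_refl _ := subset_rfl
  le_trans _ _ _ := Set.Subset.trans

theorem sided {a : ClosedPair D} {s : Sgn} {x : Str L α} (h : x ∈ a.side s) : x.Sided s :=
  ((a.mem_side s x).1 h).1

theorem derivable {a : ClosedPair D} {s : Sgn} {x y : Str L α} (hx : x ∈ a.side s)
    (hy : y ∈ a.side s.opp) : D (sseq s x y) :=
  ((a.mem_side s x).1 hx).2 y hy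

/-- The two polars determine each other with inclusion reversed, so the order can be tested on
either side. -/
theorem sle_iff {s : Sgn} {a b : ClosedPair D} : sle s a b ↔ a.side s ⊆ b.side s := by
  cases s with
  | pos => exact Iff.rfl
  | neg =>
    constructor
    · intro h x hx
      rw [b.mem_side]
      exact ⟨sided hx, fun y hy => derivable hx (h hy)⟩
    · intro h x hx
      rw [a.mem_side]
      exact ⟨sided hx, fun y hy => derivable hx (h hy)⟩

/-- The closed pair generated by the set `C` of structures in position `s`. -/
def gen (D : StrSeq L α → Prop) (s : Sgn) (C : Set (Str L α)) : ClosedPair D where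
  side t := if t = s
    then {x | x.Sided s ∧ ∀ y, y.Sided s.opp → (∀ u ∈ C, u.Sided s → D (sseq s u y)) →
      D (sseq s x y)}
    else {y | y.Sided s.opp ∧ ∀ u ∈ C, u.Sided s → D (sseq s u y)}
  mem_side t x := by
    rcases Sgn.eq_or_eq_opp t s with rfl | rfl
    · simp
    · simp only [Sgn.opp_ne, if_false, Sgn.opp_opp, if_true, Set.mem_ofPred_eq, sseq_opp]
      exact and_congr_right fun hx => ⟨fun h y hy => hy.2 x hx h,
        fun h u hu hus => h u ⟨hus, fun y _ hy => hy u hu hus⟩⟩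

section gen

variable {s : Sgn} {C : Set (Str L α)}

theorem mem_gen (hC : ∀ u ∈ C, u.Sided s) {u : Str L α} (hu : u ∈ C) : u ∈ (gen D s C).side s := by
  simp only [gen, if_true, Set.mem_ofPred_eq]
  exact ⟨hC u hu, fun y _ hy => hy u hu (hC u hu)⟩

theorem mem_gen_opp (hC : ∀ u ∈ C, u.Sided s) {y : Str L α} :
    y ∈ (gen D s C).side s.opp ↔ y.Sided s.opp ∧ ∀ u ∈ C, D (sseq s u y) := by
  simp only [gen, Sgn.opp_ne, if_false, Set.mem_ofPred_eq]
  exact and_congr_right fun _ => forall₂_congr fun u hu => by simp [hC u hu]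

/-- Universal property of the generated pair: it is least, in the order of sign `s`, among those
containing `C`. The laws of `closedAlg` are verified on generators through it. -/
theorem gen_sle (hC : ∀ u ∈ C, u.Sided s)
    {b : ClosedPair D} : sle s (gen D s C) b ↔ ∀ u ∈ C, u ∈ b.side s := by
  constructor
  · intro h u hu
    exact sle_iff.1 h (mem_gen hC hu)
  · intro h
    rw [← sle_opp, sle_iff]
    intro y hy
    rw [mem_gen_opp hC]
    exact ⟨sided hy, fun u hu => derivable (h u hu) hy⟩

end gen

/-- The closed pair generated by a single structure. -/
def prin (D : StrSeq L α → Prop) (s : Sgn) (u : Str L α) : ClosedPair D := gen D s {u}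

theorem prin_sle {s : Sgn} {u : Str L α} (hu : u.Sided s) {b : ClosedPair D} :
    sle s (prin D s u) b ↔ u ∈ b.side s := by
  unfold prin
  rw [gen_sle (by simpa using hu)]
  simp

theorem mem_prin {s : Sgn} {u : Str L α} (hu : u.Sided s) : u ∈ (prin D s u).side s :=
  mem_gen (by simpa using hu) rfl

theorem mem_prin_opp {s : Sgn} {u : Str L α} (hu : u.Sided s) {y : Str L α} :
    y ∈ (prin D s u).side s.opp ↔ y.Sided s.opp ∧ D (sseq s u y) := by
  unfold prin
  rw [mem_gen_opp (by simpa using hu)]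
  simp

end ClosedPair

/-! ### The tense algebra of closed pairs and the rules valid in it -/

namespace IsDisplayFrame

open ClosedPair

variable {L : DLELang.{u}} {α : Type v} {D : StrSeq L α → Prop}

theorem dispEquiv (hD : IsDisplayFrame D) {c d : StrSeq L α} (h : DispEquiv L α c d) : D c ↔ D d :=
  h.induct (P := fun c d => D c ↔ D d) ⟨fun _ => Iff.rfl, Iff.symm, Iff.trans⟩
    fun _ _ h => hD.disp h

theorem exch (hD : IsDisplayFrame D)
    {s : Sgn} {x y z : Str L α} (h : D (sseq s (Str.comma x y) z)) :
    D (sseq s (Str.comma y x) z) := by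
  have hs := sided_sseq.1 (hD.sided h)
  cases s with
  | pos =>
    exact hD.struct (StructRule.exch_left y x z) ⟨⟨hs.1.2, hs.1.1⟩, hs.2⟩ (by simpa [sseq] using h)
  | neg =>
    exact hD.struct (StructRule.exch_right x y z) ⟨hs.2, ⟨hs.1.2, hs.1.1⟩⟩ (by simpa [sseq] using h)

theorem weak (hD : IsDisplayFrame D)
    {s : Sgn} {x y z : Str L α} (hx : x.Sided s) (h : D (sseq s y z)) :
    D (sseq s (Str.comma x y) z) := by
  have hs := sided_sseq.1 (hD.sided h)
  cases s with
  | pos =>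
    exact hD.struct (StructRule.weak_left x y z) ⟨⟨hx, hs.1⟩, hs.2⟩ (by simpa [sseq] using h)
  | neg =>
    refine hD.exch (s := .neg) ?_
    exact hD.struct (StructRule.weak_right x y z) ⟨hs.2, ⟨hs.1, hx⟩⟩ (by simpa [sseq] using h)

theorem contr (hD : IsDisplayFrame D)
    {s : Sgn} {x z : Str L α} (h : D (sseq s (Str.comma x x) z)) : D (sseq s x z) := by
  have hs := sided_sseq.1 (hD.sided h)
  cases s with
  | pos => exact hD.struct (StructRule.contr_left x z) ⟨hs.1.1, hs.2⟩ (by simpa [sseq] using h)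
  | neg => exact hD.struct (StructRule.contr_right x z) ⟨hs.2, hs.1.1⟩ (by simpa [sseq] using h)

theorem unit_elim (hD : IsDisplayFrame D)
    {s : Sgn} {x z : Str L α} (h : D (sseq s (Str.comma Str.I x) z)) :
    D (sseq s x z) := by
  have hs := sided_sseq.1 (hD.sided h)
  cases s with
  | pos => exact hD.struct (StructRule.I_left_inv x z) ⟨hs.1.2, hs.2⟩ (by simpa [sseq] using h)
  | neg =>
    exact hD.struct (StructRule.I_right_inv x z) ⟨hs.2, hs.1.2⟩ (by simpa [sseq] using hD.exch h)

/-- The tense algebra of closed pairs. -/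
def closedAlg (hD : IsDisplayFrame D) : TenseAlg L (ClosedPair D) where
  unit s := gen D s {Str.I}
  meet s a b := gen D s {z | ∃ x ∈ a.side s, ∃ y ∈ b.side s, z = Str.comma x y}
  gt s a b := gen D s {z | ∃ x ∈ a.side s.opp, ∃ y ∈ b.side s, z = Str.gt x y}
  lt s a b := gen D s {z | ∃ x ∈ a.side s, ∃ y ∈ b.side s.opp, z = Str.lt x y}
  opF f a := gen D .pos {z | ∃ X, (∀ j, X j ∈ (a j).side (Sgn.pos.act (L.epsF f j))) ∧
    z = Str.H f X}
  opG g a := gen D .neg {z | ∃ X, (∀ j, X j ∈ (a j).side (Sgn.neg.act (L.epsG g j))) ∧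
    z = Str.K g X}
  resF f i a := gen D (L.epsF f i).opp {z | ∃ X, (∀ j, X j ∈ (a j).side
    ((L.epsF f i).opp.act (adjEps (L.epsF f) i j))) ∧ z = Str.Hres f i X}
  resG g i a := gen D (L.epsG g i) {z | ∃ X, (∀ j, X j ∈ (a j).side
    ((L.epsG g i).act (adjEps (L.epsG g) i j))) ∧ z = Str.Kres g i X}
  sle_unit s a := by
    rw [← sle_opp, sle_iff]
    intro y hy
    rw [mem_gen_opp (by simp [Str.Sided])] at hy
    rw [a.mem_side]
    refine ⟨hy.1, fun x hx => ?_⟩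
    rw [sseq_opp]
    rw [Sgn.opp_opp] at hx
    -- For `s = pos`: `I ⊢ y` is weakened by `x`, and then `I` is deleted, leaving `x ⊢ y`.
    exact hD.unit_elim (hD.exch (hD.weak (ClosedPair.sided hx) (hy.2 _ rfl)))
  sle_meet s a b c := by
    have hC : ∀ z ∈ {z | ∃ x ∈ a.side s, ∃ y ∈ b.side s, z = Str.comma x y}, z.Sided s := by
      rintro _ ⟨x, hx, y, hy, rfl⟩
      exact ⟨ClosedPair.sided hx, ClosedPair.sided hy⟩
    constructor
    · intro h
      refine ⟨h.trans ((gen_sle hC).2 ?_), h.trans ((gen_sle hC).2 ?_)⟩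
      · rintro _ ⟨x, hx, y, hy, rfl⟩
        rw [a.mem_side]
        exact ⟨⟨ClosedPair.sided hx, ClosedPair.sided hy⟩, fun z hz =>
          hD.exch (hD.weak (ClosedPair.sided hy) (ClosedPair.derivable hx hz))⟩
      · rintro _ ⟨x, hx, y, hy, rfl⟩
        rw [b.mem_side]
        exact ⟨⟨ClosedPair.sided hx, ClosedPair.sided hy⟩, fun z hz =>
          hD.weak (ClosedPair.sided hx) (ClosedPair.derivable hy hz)⟩
    · rintro ⟨h1, h2⟩
      rw [sle_iff] at h1 h2 ⊢
      intro x hx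
      rw [ClosedPair.mem_side]
      -- A common member `x` is paired with itself; contraction brings `x ; x` back to `x`.
      exact ⟨ClosedPair.sided hx, fun z hz => hD.contr
        (ClosedPair.derivable (mem_gen hC ⟨x, h1 hx, x, h2 hx, rfl⟩) hz)⟩
  gt_res s a b c := by
    rw [gen_sle, ← sle_opp, gen_sle]
    · constructor
      · rintro h _ ⟨x, hx, z, hz, rfl⟩
        rw [b.mem_side]
        refine ⟨⟨ClosedPair.sided hx, ClosedPair.sided hz⟩, fun y hy => ?_⟩
        rw [Sgn.opp_opp] at hy
        rw [sseq_opp, ← hD.dispEquiv (DispEquiv.gt_left _ _ _ _)]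
        exact ClosedPair.derivable (h _ ⟨x, hx, y, hy, rfl⟩) hz
      · rintro h _ ⟨x, hx, y, hy, rfl⟩
        rw [c.mem_side]
        refine ⟨⟨ClosedPair.sided hx, ClosedPair.sided hy⟩, fun z hz => ?_⟩
        rw [hD.dispEquiv (DispEquiv.gt_left _ _ _ _), ← sseq_opp]
        exact ClosedPair.derivable (h _ ⟨x, hx, z, hz, rfl⟩) (by rwa [Sgn.opp_opp])
    · rintro _ ⟨x, hx, y, hy, rfl⟩
      exact ⟨ClosedPair.sided hx, ClosedPair.sided hy⟩
    · rintro _ ⟨x, hx, y, hy, rfl⟩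
      exact ⟨ClosedPair.sided hx, ClosedPair.sided hy⟩
  lt_res s a b c := by
    rw [gen_sle, ← sle_opp, gen_sle]
    · constructor
      · rintro h _ ⟨z, hz, x, hx, rfl⟩
        rw [a.mem_side]
        refine ⟨⟨ClosedPair.sided hz, ClosedPair.sided hx⟩, fun y hy => ?_⟩
        rw [Sgn.opp_opp] at hy
        rw [sseq_opp, ← hD.dispEquiv (DispEquiv.lt_left _ _ _ _)]
        exact ClosedPair.derivable (h _ ⟨y, hy, x, hx, rfl⟩) hz
      · rintro h _ ⟨y, hy, x, hx, rfl⟩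
        rw [c.mem_side]
        refine ⟨⟨ClosedPair.sided hy, ClosedPair.sided hx⟩, fun z hz => ?_⟩
        rw [hD.dispEquiv (DispEquiv.lt_left _ _ _ _), ← sseq_opp]
        exact ClosedPair.derivable (h _ ⟨z, hz, x, hx, rfl⟩) (by rwa [Sgn.opp_opp])
    · rintro _ ⟨x, hx, y, hy, rfl⟩
      exact ⟨ClosedPair.sided hx, ClosedPair.sided hy⟩
    · rintro _ ⟨x, hx, y, hy, rfl⟩
      exact ⟨ClosedPair.sided hx, ClosedPair.sided hy⟩
  f_res f i a b := by
    have hsgn : ∀ j, j ≠ i → (L.epsF f i).opp.act (adjEps (L.epsF f) i j) = L.epsF f j :=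
      fun j hj => by rw [adjEps_of_ne _ hj]; simp
    rw [← sle_pos, gen_sle, ← sle_opp, gen_sle]
    · constructor
      · rintro h _ ⟨X, hX, rfl⟩
        rw [ClosedPair.mem_side]
        refine ⟨⟨rfl, fun j => ClosedPair.sided (hX j)⟩, fun x hx => ?_⟩
        rw [Sgn.opp_opp] at hx
        -- Back at the base connective, the arguments of `H` are those of the residual with `x` in
        -- the coordinate `i`, so the hypothesis on generators of `opF` applies.
        rw [hD.dispEquiv (DispEquiv.hres_self _ _ _ _)]
        refine ClosedPair.derivable (a := b) (h _ ⟨_, fun j => ?_, rfl⟩) ?_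
        · by_cases hj : j = i
          · subst hj; simpa using hx
          · have := hX j
            rw [hsgn j hj] at this
            simpa [hj] using this
        · simpa using hX i
      · rintro h _ ⟨X, hX, rfl⟩
        rw [ClosedPair.mem_side]
        refine ⟨⟨rfl, fun j => ClosedPair.sided (hX j)⟩, fun y hy => ?_⟩
        rw [hD.disp (Display.f_sseq f i X y), ← sseq_opp]
        refine ClosedPair.derivable (a := a i) (h _ ⟨_, fun j => ?_, rfl⟩) (by simpa using hX i)
        by_cases hj : j = i
        · subst hj; simpa using hy
        · rw [hsgn j hj]
          simpa [hj] using hX j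
    · rintro _ ⟨X, hX, rfl⟩
      exact ⟨rfl, fun j => ClosedPair.sided (hX j)⟩
    · rintro _ ⟨X, hX, rfl⟩
      exact ⟨rfl, fun j => ClosedPair.sided (hX j)⟩
  g_res g i a b := by
    have hsgn : ∀ j, j ≠ i → (L.epsG g i).act (adjEps (L.epsG g) i j) = (L.epsG g j).opp :=
      fun j hj => by rw [adjEps_of_ne _ hj]; simp
    rw [← sle_neg, gen_sle, gen_sle]
    · constructor
      · rintro h _ ⟨X, hX, rfl⟩
        rw [ClosedPair.mem_side]
        refine ⟨⟨rfl, fun j => ClosedPair.sided (hX j)⟩, fun x hx => ?_⟩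
        rw [hD.dispEquiv (DispEquiv.kres_self _ _ _ _)]
        refine ClosedPair.derivable (a := b) (h _ ⟨_, fun j => ?_, rfl⟩) ?_
        · by_cases hj : j = i
          · subst hj; simpa using hx
          · have := hX j
            rw [hsgn j hj] at this
            simpa [hj] using this
        · simpa using hX i
      · rintro h _ ⟨X, hX, rfl⟩
        rw [ClosedPair.mem_side]
        refine ⟨⟨rfl, fun j => ClosedPair.sided (hX j)⟩, fun y hy => ?_⟩
        rw [hD.disp (Display.g_sseq g i X y), sseq_opp]
        refine ClosedPair.derivable (a := a i) (h _ ⟨_, fun j => ?_, rfl⟩) (by simpa using hX i)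
        by_cases hj : j = i
        · subst hj; simpa using hy
        · rw [hsgn j hj]
          simpa [hj] using hX j
    · rintro _ ⟨X, hX, rfl⟩
      exact ⟨rfl, fun j => ClosedPair.sided (hX j)⟩
    · rintro _ ⟨X, hX, rfl⟩
      exact ⟨rfl, fun j => ClosedPair.sided (hX j)⟩

/-- The operations of `closedAlg` are generated by applying the structural connectives to members of
the arguments, so the substituted structure is, inductively, one of the generators. -/
theorem subst_mem_ev (hD : IsDisplayFrame D)
    {β : Type w} {σ : β → Str L α} {v : β → ClosedPair D} {s : Sgn} {S : Str L β}
    (hS : S.Sided s) (h : S.All (fun t a => σ a ∈ (v a).side t) s) :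
    S.subst σ ∈ (S.ev hD.closedAlg v s).side s := by
  induction S generalizing s with
  | leaf a => exact h
  | I => exact mem_gen (by simp [Str.Sided]) rfl
  | comma S T ihS ihT =>
    refine mem_gen ?_ ⟨_, ihS hS.1 h.1, _, ihT hS.2 h.2, rfl⟩
    rintro _ ⟨x, hx, y, hy, rfl⟩
    exact ⟨ClosedPair.sided hx, ClosedPair.sided hy⟩
  | gt S T ihS ihT =>
    refine mem_gen ?_ ⟨_, ihS hS.1 h.1, _, ihT hS.2 h.2, rfl⟩
    rintro _ ⟨x, hx, y, hy, rfl⟩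
    exact ⟨ClosedPair.sided hx, ClosedPair.sided hy⟩
  | lt S T ihS ihT =>
    refine mem_gen ?_ ⟨_, ihS hS.1 h.1, _, ihT hS.2 h.2, rfl⟩
    rintro _ ⟨x, hx, y, hy, rfl⟩
    exact ⟨ClosedPair.sided hx, ClosedPair.sided hy⟩
  | H f X ih =>
    obtain ⟨rfl, hS⟩ := hS
    refine mem_gen ?_ ⟨_, fun j => ih j (hS j) (h j), rfl⟩
    rintro _ ⟨X, hX, rfl⟩
    exact ⟨rfl, fun j => ClosedPair.sided (hX j)⟩
  | K g X ih =>
    obtain ⟨rfl, hS⟩ := hS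
    refine mem_gen ?_ ⟨_, fun j => ih j (hS j) (h j), rfl⟩
    rintro _ ⟨X, hX, rfl⟩
    exact ⟨rfl, fun j => ClosedPair.sided (hX j)⟩
  | Hres f i X ih =>
    obtain ⟨rfl, hS⟩ := hS
    refine mem_gen ?_ ⟨_, fun j => ih j (hS j) (h j), rfl⟩
    rintro _ ⟨X, hX, rfl⟩
    exact ⟨rfl, fun j => ClosedPair.sided (hX j)⟩
  | Kres g i X ih =>
    obtain ⟨rfl, hS⟩ := hS
    refine mem_gen ?_ ⟨_, fun j => ih j (hS j) (h j), rfl⟩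
    rintro _ ⟨X, hX, rfl⟩
    exact ⟨rfl, fun j => ClosedPair.sided (hX j)⟩

/-- A structure in a closed pair can replace the generator of the pair. -/
theorem replace (hD : IsDisplayFrame D)
    {s : Sgn} {u x w : Str L α} (hu : u.Sided s) (hx : x ∈ (prin D s u).side s)
    (h : D (sseq s u w)) : D (sseq s x w) :=
  ClosedPair.derivable hx ((mem_prin_opp hu).2 ⟨(sided_sseq.1 (hD.sided h)).2, h⟩)

/-- Replacement in all the coordinates of a connective that can be displayed. -/
theorem replace_coords (hD : IsDisplayFrame D)
    {n : ℕ} {con : (Fin n → Str L α) → Str L α} {s : Sgn} {ε : Fin n → Sgn}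
    {z : Str L α}
    (hcon : ∀ X j, ∃ W, ∀ y, DispEquiv L α (sseq s (con (Function.update X j y)) z)
      (sseq (s.act (ε j)) y W))
    {Y Z : Fin n → Str L α} (hY : ∀ j, (Y j).Sided (s.act (ε j)))
    (hZ : ∀ j, Z j ∈ (prin D (s.act (ε j)) (Y j)).side (s.act (ε j)))
    (h : D (sseq s (con Y) z)) : D (sseq s (con Z) z) := by
  -- The coordinates in `J` are already replaced; the next one is displayed, replaced and put back.
  have key : ∀ J : Finset (Fin n), D (sseq s (con fun j => if j ∈ J then Z j else Y j) z) := by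
    intro J
    induction J using Finset.induction_on with
    | empty => simpa using h
    | insert i J hi ih =>
      have h1 : (fun j => if j ∈ J then Z j else Y j) =
          Function.update (fun j => if j ∈ J then Z j else Y j) i (Y i) := by
        funext j
        by_cases hj : j = i
        · subst hj; simp [hi]
        · simp [hj]
      have h2 : (fun j => if j ∈ insert i J then Z j else Y j) =
          Function.update (fun j => if j ∈ J then Z j else Y j) i (Z i) := by
        funext j
        by_cases hj : j = i
        · subst hj; simp
        · simp [hj]
      obtain ⟨W, hW⟩ := hcon (fun j => if j ∈ J then Z j else Y j) i
      rw [h1, hD.dispEquiv (hW _)] at ih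
      rw [h2, hD.dispEquiv (hW _)]
      exact hD.replace (hY i) (hZ i) ih
  simpa using key Finset.univ

theorem display_H (f : L.F) (z : Str L α) (X : Fin (L.arF f) → Str L α) (j : Fin (L.arF f)) :
    ∃ W, ∀ y, DispEquiv L α (sseq .pos (Str.H f (Function.update X j y)) z)
      (sseq (Sgn.pos.act (L.epsF f j)) y W) := by
  refine ⟨Str.Hres f j (Function.update X j z), fun y => ?_⟩
  have := DispEquiv.of (Display.f_sseq f j (Function.update X j y) z)
  simpa using this

theorem display_K (g : L.G) (z : Str L α) (X : Fin (L.arG g) → Str L α) (j : Fin (L.arG g)) :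
    ∃ W, ∀ y, DispEquiv L α (sseq .neg (Str.K g (Function.update X j y)) z)
      (sseq (Sgn.neg.act (L.epsG g j)) y W) := by
  refine ⟨Str.Kres g j (Function.update X j z), fun y => ?_⟩
  have := DispEquiv.of (Display.g_sseq g j (Function.update X j y) z)
  simpa using this

/-- The context `W` does not depend on the entry `y`, which is what allows `y` to be exchanged. A
coordinate other than `i` is reached through `H`. -/
theorem display_Hres (f : L.F) (i : Fin (L.arF f)) (z : Str L α) (X : Fin (L.arF f) → Str L α)
    (j : Fin (L.arF f)) :
    ∃ W, ∀ y, DispEquiv L α (sseq (L.epsF f i).opp (Str.Hres f i (Function.update X j y)) z)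
      (sseq ((L.epsF f i).opp.act (adjEps (L.epsF f) i j)) y W) := by
  by_cases hj : j = i
  · subst hj
    refine ⟨Str.H f (Function.update X j z), fun y => ?_⟩
    have := DispEquiv.hres_self f j (Function.update X j y) z
    simpa [sseq] using this
  · refine ⟨Str.Hres f j (Function.update (Function.update X i z) j (X i)), fun y => ?_⟩
    have h1 := DispEquiv.hres_self f i (Function.update X j y) z
    have h2 := DispEquiv.of (Display.f_sseq f j
      (Function.update (Function.update X j y) i z) (X i))
    rw [Function.update_of_ne (Ne.symm hj)] at h1
    rw [Function.update_of_ne hj, Function.update_self] at h2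
    have h3 := h1.trans h2
    rw [Function.update_comm hj, Function.update_idem] at h3
    rw [adjEps_of_ne _ hj]
    simpa using h3

theorem display_Kres (g : L.G) (i : Fin (L.arG g)) (z : Str L α) (X : Fin (L.arG g) → Str L α)
    (j : Fin (L.arG g)) :
    ∃ W, ∀ y, DispEquiv L α (sseq (L.epsG g i) (Str.Kres g i (Function.update X j y)) z)
      (sseq ((L.epsG g i).act (adjEps (L.epsG g) i j)) y W) := by
  by_cases hj : j = i
  · subst hj
    refine ⟨Str.K g (Function.update X j z), fun y => ?_⟩
    have := DispEquiv.kres_self g j (Function.update X j y) z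
    simpa [sseq] using this
  · refine ⟨Str.Kres g j (Function.update (Function.update X i z) j (X i)), fun y => ?_⟩
    have h1 := DispEquiv.kres_self g i (Function.update X j y) z
    have h2 := DispEquiv.of (Display.g_sseq g j
      (Function.update (Function.update X j y) i z) (X i))
    rw [Function.update_of_ne (Ne.symm hj)] at h1
    rw [Function.update_of_ne hj, Function.update_self] at h2
    have h3 := h1.trans h2
    rw [Function.update_comm hj, Function.update_idem] at h3
    rw [adjEps_of_ne _ hj]
    simpa using h3

/-- Whatever is derivable with `con Y` stays derivable when each `Y j` is replaced by a member of
the pair it generates; so all generators lie in the pair of `con Y`. -/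
theorem gen_sle_prin (hD : IsDisplayFrame D)
    {n : ℕ} {con : (Fin n → Str L α) → Str L α} {s : Sgn} {ε : Fin n → Sgn}
    (hcon : ∀ z X j, ∃ W, ∀ y, DispEquiv L α (sseq s (con (Function.update X j y)) z)
      (sseq (s.act (ε j)) y W))
    (hsided : ∀ X, (con X).Sided s ↔ ∀ j, (X j).Sided (s.act (ε j)))
    {Y : Fin n → Str L α} (hY : ∀ j, (Y j).Sided (s.act (ε j))) :
    sle s (gen D s {z | ∃ X, (∀ j, X j ∈ (prin D (s.act (ε j)) (Y j)).side (s.act (ε j))) ∧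
      z = con X}) (prin D s (con Y)) := by
  rw [gen_sle]
  · rintro _ ⟨Z, hZ, rfl⟩
    rw [ClosedPair.mem_side]
    refine ⟨(hsided Z).2 fun j => ClosedPair.sided (hZ j), fun z hz => ?_⟩
    rw [mem_prin_opp ((hsided Y).2 hY)] at hz
    exact hD.replace_coords (hcon z) hY hZ hz.2
  · rintro _ ⟨Z, hZ, rfl⟩
    exact (hsided Z).2 fun j => ClosedPair.sided (hZ j)

/-- The counterpart of `subst_mem_ev`: the value is also bounded by the principal pair of the
substituted structure. Display gives this congruence property without any cut. -/
theorem ev_sle_prin (hD : IsDisplayFrame D)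
    {β : Type w} {σ : β → Str L α} {v : β → ClosedPair D} {s : Sgn} {S : Str L β}
    (hS : S.Sided s)
    (h : S.All (fun t a => (σ a).Sided t ∧ sle t (v a) (prin D t (σ a))) s) :
    sle s (S.ev hD.closedAlg v s) (prin D s (S.subst σ)) := by
  have sub : ∀ {s : Sgn} {S : Str L β}, S.Sided s →
      S.All (fun t a => (σ a).Sided t ∧ sle t (v a) (prin D t (σ a))) s →
      (S.subst σ).Sided s := fun hS h =>
    (Str.sided_subst _ _ _).2 ⟨hS, h.imp fun _ _ h => h.1⟩
  induction S generalizing s with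
  | leaf a => exact h.2
  | I => exact sle_refl _ _
  | comma S T ihS ihT =>
    have hS' := sub hS.1 h.1
    have hT' := sub hS.2 h.2
    refine (hD.closedAlg.meet_mono (ihS hS.1 h.1) (ihT hS.2 h.2)).trans ?_
    refine (gen_sle ?_).2 ?_
    · rintro _ ⟨x, hx, y, hy, rfl⟩
      exact ⟨ClosedPair.sided hx, ClosedPair.sided hy⟩
    · rintro _ ⟨x, hx, y, hy, rfl⟩
      rw [ClosedPair.mem_side]
      refine ⟨⟨ClosedPair.sided hx, ClosedPair.sided hy⟩, fun z hz => ?_⟩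
      rw [mem_prin_opp (sub (S := Str.comma S T) hS h)] at hz
      have h1 := hD.replace hS' hx ((hD.disp (Display.lt_sseq _ _ _ _)).1 hz.2)
      rw [← hD.disp (Display.lt_sseq _ _ _ _)] at h1
      have h2 := hD.replace hT' hy ((hD.disp (Display.gt_sseq _ _ _ _)).1 h1)
      rwa [← hD.disp (Display.gt_sseq _ _ _ _)] at h2
  | gt S T ihS ihT =>
    have hS' := sub hS.1 h.1
    have hT' := sub hS.2 h.2
    refine (hD.closedAlg.gt_mono (ihS hS.1 h.1) (ihT hS.2 h.2)).trans ?_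
    refine (gen_sle ?_).2 ?_
    · rintro _ ⟨x, hx, y, hy, rfl⟩
      exact ⟨ClosedPair.sided hx, ClosedPair.sided hy⟩
    · rintro _ ⟨x, hx, y, hy, rfl⟩
      rw [ClosedPair.mem_side]
      refine ⟨⟨ClosedPair.sided hx, ClosedPair.sided hy⟩, fun z hz => ?_⟩
      rw [mem_prin_opp (sub (S := Str.gt S T) hS h)] at hz
      have h1 := hD.replace hS' hx ((hD.dispEquiv (DispEquiv.gt_right _ _ _ _)).1 hz.2)
      rw [← hD.dispEquiv (DispEquiv.gt_right _ _ _ _)] at h1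
      have h2 := hD.replace hT' hy ((hD.dispEquiv (DispEquiv.gt_left _ _ _ _)).1 h1)
      rwa [← hD.dispEquiv (DispEquiv.gt_left _ _ _ _)] at h2
  | lt S T ihS ihT =>
    have hS' := sub hS.1 h.1
    have hT' := sub hS.2 h.2
    refine (hD.closedAlg.lt_mono (ihS hS.1 h.1) (ihT hS.2 h.2)).trans ?_
    refine (gen_sle ?_).2 ?_
    · rintro _ ⟨x, hx, y, hy, rfl⟩
      exact ⟨ClosedPair.sided hx, ClosedPair.sided hy⟩
    · rintro _ ⟨x, hx, y, hy, rfl⟩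
      rw [ClosedPair.mem_side]
      refine ⟨⟨ClosedPair.sided hx, ClosedPair.sided hy⟩, fun z hz => ?_⟩
      rw [mem_prin_opp (sub (S := Str.lt S T) hS h)] at hz
      have h1 := hD.replace hS' hx ((hD.dispEquiv (DispEquiv.lt_left _ _ _ _)).1 hz.2)
      rw [← hD.dispEquiv (DispEquiv.lt_left _ _ _ _)] at h1
      have h2 := hD.replace hT' hy ((hD.dispEquiv (DispEquiv.lt_right _ _ _ _)).1 h1)
      rwa [← hD.dispEquiv (DispEquiv.lt_right _ _ _ _)] at h2
  | H f X ih =>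
    obtain ⟨rfl, hS⟩ := hS
    refine (sle_of_mono (hD.closedAlg.opF_mono f) .pos fun j => ih j (hS j) (h j)).trans ?_
    exact hD.gen_sle_prin (display_H f) (fun X => by simp [Str.Sided]) fun j => sub (hS j) (h j)
  | K g X ih =>
    obtain ⟨rfl, hS⟩ := hS
    refine (sle_of_mono (hD.closedAlg.opG_mono g) .neg fun j => ih j (hS j) (h j)).trans ?_
    exact hD.gen_sle_prin (display_K g) (fun X => by simp [Str.Sided]) fun j => sub (hS j) (h j)
  | Hres f i X ih =>
    obtain ⟨rfl, hS⟩ := hS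
    refine (sle_of_mono (hD.closedAlg.resF_mono f i) _ fun j => ih j (hS j) (h j)).trans ?_
    exact hD.gen_sle_prin (display_Hres f i) (fun X => by simp [Str.Sided])
      fun j => sub (hS j) (h j)
  | Kres g i X ih =>
    obtain ⟨rfl, hS⟩ := hS
    refine (sle_of_mono (hD.closedAlg.resG_mono g i) _ fun j => ih j (hS j) (h j)).trans ?_
    exact hD.gen_sle_prin (display_Kres g i) (fun X => by simp [Str.Sided])
      fun j => sub (hS j) (h j)

/-- An instance of a sequent that holds in the algebra of closed pairs is derivable. -/
theorem derivable_subst (hD : IsDisplayFrame D)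
    {β : Type w} {σ : β → Str L α} {v : β → ClosedPair D} {c : StrSeq L β}
    (hc : c.Sided) (h : c.All (fun t a => σ a ∈ (v a).side t)) (hv : c.SatIn hD.closedAlg v) :
    D (c.subst σ) :=
  ClosedPair.derivable (s := .pos) (a := c.suc.ev hD.closedAlg v .neg)
    ((sle_iff (s := .pos)).1 hv (hD.subst_mem_ev hc.1 h.1)) (hD.subst_mem_ev hc.2 h.2)

/-- The antecedent lies below its principal pair, the succedent above its own, and derivability of
the instance compares the two principal pairs. -/
theorem satIn_of_derivable (hD : IsDisplayFrame D)
    {β : Type w} {σ : β → Str L α} {v : β → ClosedPair D} {c : StrSeq L β}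
    (hc : c.Sided) (h : c.All (fun t a => (σ a).Sided t ∧ sle t (v a) (prin D t (σ a))))
    (hd : D (c.subst σ)) : c.SatIn hD.closedAlg v := by
  have hs1 : (c.ant.subst σ).Sided .pos := (hD.sided hd).1
  have hs2 : (c.suc.subst σ).Sided .neg := (hD.sided hd).2
  have h1 : sle .pos (prin D .pos (c.ant.subst σ)) (prin D .neg (c.suc.subst σ)) := by
    rw [prin_sle hs1]
    exact (mem_prin_opp (s := .neg) hs2).2 ⟨hs1, hd⟩
  exact ((hD.ev_sle_prin hc.1 h.1).trans h1).trans (hD.ev_sle_prin hc.2 h.2)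

/-- A sided analytic rule that preserves `D` is valid in the algebra of closed pairs. -/
theorem validIn_closedAlg (hD : IsDisplayFrame D) {ρ : SRule L} (ha : ρ.IsAnalytic) (hs : ρ.Sided)
    (hρ : ∀ σ : ℕ → Str L α, (ρ.concl.subst σ).Sided → (∀ c ∈ ρ.prems, D (c.subst σ)) →
      D (ρ.concl.subst σ)) : ρ.ValidIn hD.closedAlg := by
  intro v hv
  have hself : ρ.concl.All fun t x => 0 < ρ.concl.occ t x := by
    rw [StrSeq.all_iff_occ]; exact fun _ _ h => h
  -- `J` holds the variables that still have their arbitrary value; the other variables of the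
  -- conclusion have been made principal, generated by a member of `v x`. The premises are only ever
  -- used at `v`.
  have key : ∀ J : Finset ℕ, ∀ w : ℕ → ClosedPair D, (∀ x ∈ J, w x = v x) →
      (∀ x ∉ J, ∀ t, 0 < ρ.concl.occ t x → ∃ u ∈ (v x).side t, w x = prin D t u) →
      ρ.concl.SatIn hD.closedAlg w := by
    intro J
    induction J using Finset.induction_on with
    | empty =>
      intro w _ hw
      simp only [Finset.notMem_empty, not_false_eq_true, true_implies] at hw
      have : ∀ x, ∃ u, ∀ t, 0 < ρ.concl.occ t x → u ∈ (v x).side t ∧ w x = prin D t u := by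
        intro x
        by_cases hx : ∃ t, 0 < ρ.concl.occ t x
        · obtain ⟨t, ht⟩ := hx
          obtain ⟨u, hu, hwu⟩ := hw x t ht
          refine ⟨u, fun r hr => ?_⟩
          obtain rfl := Sgn.eq_of_occ (ha.c3 x) hr ht
          exact ⟨hu, hwu⟩
        -- `I` is a dummy: by C1 a variable absent from the conclusion occurs nowhere in the rule.
        · exact ⟨Str.I, fun t ht => absurd ⟨t, ht⟩ hx⟩
      choose σ hσ using this
      refine hD.satIn_of_derivable (σ := σ) hs.1 (hself.imp fun t x hx => ?_) (hρ σ ?_ ?_)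
      · obtain ⟨h1, h2⟩ := hσ x t hx
        exact ⟨ClosedPair.sided h1, by rw [h2]⟩
      · rw [StrSeq.sided_subst]
        exact ⟨hs.1, hself.imp fun t x hx => ClosedPair.sided (hσ x t hx).1⟩
      · intro c hc
        exact hD.derivable_subst (hs.2 c hc)
          (((SRule.isAnalytic_iff.1 ha).2 c hc).imp fun t x hx => (hσ x t hx).1) (hv c hc)
    | insert y J hy ih =>
      intro w hwJ hw
      by_cases hyo : ∃ t, 0 < ρ.concl.occ t y
      · obtain ⟨t, ht⟩ := hyo
        -- The conclusion says that the value of `y` is bounded by `V`, and a closed pair is bounded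
        -- by `V` as soon as the principal pairs of its members are.
        obtain ⟨V, hV⟩ := StrSeq.exists_bound_value hD.closedAlg hs.1 (ha.c3 y) ht w
        have h1 := hV (w y)
        rw [Function.update_eq_self] at h1
        rw [h1, hwJ y (Finset.mem_insert_self _ _), sle_iff]
        intro u hu
        rw [← prin_sle (ClosedPair.sided hu), ← hV]
        refine ih _ (fun x hx => ?_) (fun x hx r hr => ?_)
        · rw [Function.update_of_ne (by rintro rfl; exact hy hx)]
          exact hwJ x (Finset.mem_insert_of_mem hx)
        · by_cases hxy : x = y
          · subst hxy
            obtain rfl := Sgn.eq_of_occ (ha.c3 x) hr ht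
            exact ⟨u, hu, Function.update_self _ _ _⟩
          · rw [Function.update_of_ne hxy]
            exact hw x (by simp [hx, hxy]) r hr
      · refine ih w (fun x hx => hwJ x (Finset.mem_insert_of_mem hx)) (fun x hx t ht => ?_)
        have hxy : x ≠ y := by rintro rfl; exact hyo ⟨t, ht⟩
        exact hw x (by simp [hx, hxy]) t ht
  obtain ⟨m, hm⟩ := ρ.concl.ant.exists_bound
  obtain ⟨n, hn⟩ := ρ.concl.suc.exists_bound
  have hb : ρ.concl.All fun _ x => x < m + n :=
    ⟨(hm _).imp fun _ x hx => by omega, (hn _).imp fun _ x hx => by omega⟩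
  rw [StrSeq.all_iff_occ] at hb
  -- All variables of the conclusion lie in this range, so at the start nothing has to be principal.
  exact key (Finset.range (m + n)) v (fun _ _ => rfl)
    fun x hx t ht => absurd (Finset.mem_range.2 (hb t x ht)) hx

end IsDisplayFrame

/-! ### Formulas in tense algebras; soundness and completeness of the calculi -/

/-- The value of a formula, the connectives other than those of lattices being interpreted by
`O`. -/
def Form.ev {L M : DLELang.{u}} {B : Type w} [Preorder B] (𝔹 : TenseAlg L B) (O : DLEOps M B)
    (v : ℕ → B) : Form M → B
  | var p => v p
  | top => 𝔹.unit .pos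
  | bot => 𝔹.unit .neg
  | and φ ψ => 𝔹.meet .pos (ev 𝔹 O v φ) (ev 𝔹 O v ψ)
  | or φ ψ => 𝔹.meet .neg (ev 𝔹 O v φ) (ev 𝔹 O v ψ)
  | opF f a => O.opF f fun i => ev 𝔹 O v (a i)
  | opG g a => O.opG g fun i => ev 𝔹 O v (a i)

theorem Str.sided_leaf {L : DLELang.{u}} {α : Type v} (s : Sgn) (a : α) :
    (leaf a : Str L α).Sided s := trivial

section Calculus

variable {L M : DLELang.{u}} {sF : (f : M.F) → (Fin (M.arF f) → Str L (Form M)) → Str L (Form M)}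
  {sG : (g : M.G) → (Fin (M.arG g) → Str L (Form M)) → Str L (Form M)}

/-- The structural counterparts of the connectives are suitably sided. -/
structure IsCounterpart (sF : (f : M.F) → (Fin (M.arF f) → Str L (Form M)) → Str L (Form M))
    (sG : (g : M.G) → (Fin (M.arG g) → Str L (Form M)) → Str L (Form M)) : Prop where
  sidedF : ∀ f X, (∀ i, (X i).Sided (M.epsF f i)) → (sF f X).Sided .pos
  sidedG : ∀ g X, (∀ i, (X i).Sided (M.epsG g i).opp) → (sG g X).Sided .neg

/-- The operations `O` are the interpretations of the structural counterparts. -/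
structure Interprets {B : Type w} [Preorder B] (𝔹 : TenseAlg L B) (O : DLEOps M B)
    (sF : (f : M.F) → (Fin (M.arF f) → Str L (Form M)) → Str L (Form M))
    (sG : (g : M.G) → (Fin (M.arG g) → Str L (Form M)) → Str L (Form M)) : Prop where
  evF : ∀ v f X, (sF f X).ev 𝔹 v .pos = O.opF f fun i => (X i).ev 𝔹 v (M.epsF f i)
  evG : ∀ v g X, (sG g X).ev 𝔹 v .neg = O.opG g fun i => (X i).ev 𝔹 v (M.epsG g i).opp
  monoF : ∀ f {a b}, (∀ i, sle (M.epsF f i) (a i) (b i)) → O.opF f a ≤ O.opF f b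
  monoG : ∀ g {a b}, (∀ i, sle (M.epsG g i) (a i) (b i)) → O.opG g a ≤ O.opG g b

theorem Derivable.sided {α : Type u} {base : List (StrSeq L α) → StrSeq L α → Prop}
    {R : Set (SRule L)} {c : StrSeq L α} (h : Derivable base R c) : c.Sided := by
  cases h with
  | step ps c hr hp => exact hr.1

theorem Derivable.of_base {α : Type u} {base : List (StrSeq L α) → StrSeq L α → Prop}
    {R : Set (SRule L)} {ps : List (StrSeq L α)} {c : StrSeq L α} (h : base ps c)
    (hc : c.Sided) (hp : ∀ p ∈ ps, Derivable base R p) : Derivable base R c :=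
  Gen.step ps c ⟨hc, Or.inl h⟩ hp

theorem Derivable.of_rule {α : Type u} {base : List (StrSeq L α) → StrSeq L α → Prop}
    {R : Set (SRule L)} {ρ : SRule L} (hρ : ρ ∈ R) (σ : ℕ → Str L α)
    (hc : (ρ.concl.subst σ).Sided) (hp : ∀ c ∈ ρ.prems, Derivable base R (c.subst σ)) :
    Derivable base R (ρ.concl.subst σ) :=
  Gen.step _ _ ⟨hc, Or.inr ⟨ρ, hρ, σ, rfl, rfl⟩⟩ fun p h => by
    obtain ⟨c, hc, rfl⟩ := List.mem_map.1 h
    exact hp c hc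

theorem StructRule.satIn {α : Type v} {B : Type w} [Preorder B] (𝔹 : TenseAlg L B) (v : α → B)
    {ps : List (StrSeq L α)} {c : StrSeq L α} (h : StructRule L α ps c)
    (hp : ∀ p ∈ ps, p.SatIn 𝔹 v) : c.SatIn 𝔹 v := by
  have unit_le : ∀ a, 𝔹.unit .neg ≤ a := 𝔹.unit_sle .pos
  have le_unit : ∀ a, a ≤ 𝔹.unit .pos := 𝔹.sle_unit .pos
  have one : ∀ {p : StrSeq L α}, (∀ q ∈ [p], q.SatIn 𝔹 v) →
      p.ant.ev 𝔹 v .pos ≤ p.suc.ev 𝔹 v .neg := fun h => h _ List.mem_cons_self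
  cases h with
  | nec_f_pos f k X h =>
    have h1 := one hp
    exact le_trans h1 (unit_le _)
  | nec_f_neg f k X h =>
    have h1 := one hp
    exact le_trans (le_unit _) h1
  | nec_g_pos g k X h =>
    have h1 := one hp
    exact le_trans (le_unit _) h1
  | nec_g_neg g k X h =>
    have h1 := one hp
    exact le_trans h1 (unit_le _)
  | I_left X Y =>
    have h1 := one hp
    exact le_trans (𝔹.meet_right .pos _ _) h1
  | I_left_inv X Y =>
    have h1 := one hp
    exact le_trans ((𝔹.sle_meet .pos _ _ _).2 ⟨le_unit _, le_rfl⟩) h1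
  | I_right X Y =>
    have h1 := one hp
    exact le_trans h1 (𝔹.meet_left .neg _ _)
  | I_right_inv X Y =>
    have h1 := one hp
    exact le_trans h1
      ((𝔹.sle_meet .neg _ _ _).2 ⟨sle_refl .neg _, unit_le _⟩)
  | exch_left X Y Z =>
    have h1 := one hp
    exact le_trans (𝔹.meet_comm .pos _ _) h1
  | exch_right X Y Z =>
    have h1 := one hp
    exact le_trans h1 (𝔹.meet_comm .neg _ _)
  | weak_left X Y Z =>
    have h1 := one hp
    exact le_trans (𝔹.meet_right .pos _ _) h1
  | weak_right X Y Z =>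
    have h1 := one hp
    exact le_trans h1 (𝔹.meet_left .neg _ _)
  | contr_left X Y =>
    have h1 := one hp
    exact le_trans ((𝔹.sle_meet .pos _ _ _).2 ⟨le_rfl, le_rfl⟩) h1
  | contr_right X Y =>
    have h1 := one hp
    exact le_trans h1
      ((𝔹.sle_meet .neg _ _ _).2 ⟨sle_refl .neg _, sle_refl .neg _⟩)
  | assoc_left X Y Z W =>
    have h1 := one hp
    exact le_trans (𝔹.meet_assoc .pos _ _ _) h1
  | assoc_left_inv X Y Z W =>
    have h1 := one hp
    exact le_trans (𝔹.meet_assoc_symm .pos _ _ _) h1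
  | assoc_right X Y Z W =>
    have h1 := one hp
    exact le_trans h1 (𝔹.meet_assoc_symm .neg _ _ _)
  | assoc_right_inv X Y Z W =>
    have h1 := one hp
    exact le_trans h1 (𝔹.meet_assoc .neg _ _ _)

/-- Soundness of the extended calculi. -/
theorem Derivable.satIn {B : Type w} [Preorder B] {𝔹 : TenseAlg L B} {O : DLEOps M B}
    (hO : Interprets 𝔹 O sF sG) {R : Set (SRule L)} (ha : ∀ ρ ∈ R, ρ.IsAnalytic)
    (hR : ∀ ρ ∈ R, ρ.Sided → ρ.ValidIn 𝔹) (v : ℕ → B) {c : StrSeq L (Form M)}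
    (h : Derivable (CalcRule L M sF sG) R c) : c.SatIn 𝔹 (Form.ev 𝔹 O v) := by
  induction h with
  | step ps c hr hp ih =>
    obtain ⟨hcs, hr | ⟨ρ, hρ, σ, rfl, rfl⟩⟩ := hr
    · cases hr with
      | id p => exact le_rfl
      | cut X A Y =>
        have h1 := ih (X ⊩ Str.leaf A) (by simp)
        have h2 := ih (Str.leaf A ⊩ Y) (by simp)
        exact le_trans h1 h2
      | disp c d h => exact (h.satIn_iff 𝔹 _).1 (ih c (by simp))
      | disp_inv c d h => exact (h.satIn_iff 𝔹 _).2 (ih d (by simp))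
      | struct ps c h => exact h.satIn 𝔹 _ ih
      | bot_left => exact le_rfl
      | bot_right X =>
        have h := ih _ (List.mem_cons_self)
        exact h
      | top_left X =>
        have h := ih _ (List.mem_cons_self)
        exact h
      | top_right => exact le_rfl
      | and_left A B X =>
        have h := ih _ (List.mem_cons_self)
        exact h
      | and_right A B X Y =>
        exact 𝔹.meet_mono (s := .pos) (ih (X ⊩ Str.leaf A) (by simp))
          (ih (Y ⊩ Str.leaf B) (by simp))
      | or_left A B X Y =>
        exact 𝔹.meet_mono (s := .neg) (ih (Str.leaf A ⊩ X) (by simp))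
          (ih (Str.leaf B ⊩ Y) (by simp))
      | or_right A B X =>
        have h := ih _ (List.mem_cons_self)
        exact h
      | f_left f A X =>
        have h := ih _ (List.mem_cons_self)
        unfold StrSeq.SatIn at h
        rw [hO.evF] at h
        exact h
      | f_right f A X =>
        unfold StrSeq.SatIn
        rw [hO.evF]
        refine hO.monoF f fun i => ?_
        have h := ih _ ((List.mem_ofFn' _ _).2 ⟨i, rfl⟩)
        cases e : M.epsF f i <;> simp only [e] at h <;> exact h
      | g_right g A X =>
        have h := ih _ (List.mem_cons_self)
        unfold StrSeq.SatIn at h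
        rw [hO.evG] at h
        exact h
      | g_left g A X =>
        unfold StrSeq.SatIn
        rw [hO.evG]
        refine hO.monoG g fun i => ?_
        have h := ih _ ((List.mem_ofFn' _ _).2 ⟨i, rfl⟩)
        cases e : M.epsG g i <;> simp only [e] at h <;> exact h
    · have hself : ρ.concl.All fun t x => 0 < ρ.concl.occ t x := by
        rw [StrSeq.all_iff_occ]; exact fun _ _ h => h
      -- By C3 a variable occurs in one position only, so the position-dependent value of `σ x`
      -- yields a single value `b` for the assignment.
      have hσ : ∀ x, ∃ b, ∀ t, 0 < ρ.concl.occ t x →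
          (σ x).ev 𝔹 (Form.ev 𝔹 O v) t = b := fun x => by
        by_cases hx : ∃ t, 0 < ρ.concl.occ t x
        · obtain ⟨t, ht⟩ := hx
          exact ⟨_, fun r hr => by rw [Sgn.eq_of_occ ((ha ρ hρ).c3 x) hr ht]⟩
        · exact ⟨(σ x).ev 𝔹 (Form.ev 𝔹 O v) .pos, fun t ht => absurd ⟨t, ht⟩ hx⟩
      choose b hb using hσ
      simp only [List.mem_map, forall_exists_index, and_imp, forall_apply_eq_imp_iff₂] at hp ih
      -- Derivations consist of sided sequents, and a sided instance forces the rule itself to be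
      -- sided; unsided rules are never applied.
      have hs : ρ.Sided := ⟨((StrSeq.sided_subst _ _).1 hcs).1,
        fun c hc => ((StrSeq.sided_subst _ _).1 (Derivable.sided (hp c hc))).1⟩
      rw [StrSeq.satIn_subst 𝔹 (hself.imp fun t x hx => hb x t hx)]
      refine hR ρ hρ hs b fun c hc => ?_
      rw [← StrSeq.satIn_subst 𝔹 (((SRule.isAnalytic_iff.1 (ha ρ hρ)).2 c hc).imp
        fun t x hx => hb x t hx)]
      exact ih c hc

theorem isDisplayFrame_derivable (R : Set (SRule L)) :
    IsDisplayFrame (Derivable (CalcRule L M sF sG) R) where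
  sided h := h.sided
  disp {c d} h := ⟨fun hc => .of_base (.disp c d h) (h.sided_iff.1 hc.sided) (by simpa using hc),
    fun hd => .of_base (.disp_inv c d h) (h.sided_iff.2 hd.sided) (by simpa using hd)⟩
  struct h hc hp := .of_base (.struct _ _ h) hc hp

/-! ### Completeness: formulas as closed pairs -/

section Completeness

variable (R : Set (SRule L))

theorem derivable_id (hs : IsCounterpart sF sG) (A : Form M) :
    Derivable (CalcRule L M sF sG) R (Str.leaf A ⊩ Str.leaf A) := by
  have ss : ∀ A B : Form M, (Str.leaf A ⊩ Str.leaf B : StrSeq L (Form M)).Sided :=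
    fun _ _ => ⟨trivial, trivial⟩
  induction A with
  | var p => exact .of_base (.id p) (ss _ _) (by simp)
  | top =>
    refine .of_base (.top_left _) (ss _ _) ?_
    simp only [List.mem_singleton, forall_eq]
    exact .of_base .top_right ⟨trivial, trivial⟩ (by simp)
  | bot =>
    refine .of_base (.bot_right _) (ss _ _) ?_
    simp only [List.mem_singleton, forall_eq]
    exact .of_base .bot_left ⟨trivial, trivial⟩ (by simp)
  | and A B ihA ihB =>
    refine .of_base (.and_left _ _ _) (ss _ _) ?_
    simp only [List.mem_singleton, forall_eq]
    exact .of_base (.and_right A B _ _) ⟨⟨trivial, trivial⟩, trivial⟩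
      (by simpa using ⟨ihA, ihB⟩)
  | or A B ihA ihB =>
    refine .of_base (.or_right _ _ _) (ss _ _) ?_
    simp only [List.mem_singleton, forall_eq]
    exact .of_base (.or_left A B _ _) ⟨trivial, ⟨trivial, trivial⟩⟩
      (by simpa using ⟨ihA, ihB⟩)
  | opF f A ih =>
    refine .of_base (.f_left _ _ _) (ss _ _) ?_
    simp only [List.mem_singleton, forall_eq]
    refine .of_base (.f_right f A _) ⟨hs.sidedF _ _ fun _ => trivial, trivial⟩ fun p hp => ?_
    obtain ⟨i, rfl⟩ := (List.mem_ofFn' _ _).1 hp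
    cases e : M.epsF f i <;> simp only [e] <;> exact ih i
  | opG g A ih =>
    refine .of_base (.g_right _ _ _) (ss _ _) ?_
    simp only [List.mem_singleton, forall_eq]
    refine .of_base (.g_left g A _) ⟨trivial, hs.sidedG _ _ fun _ => trivial⟩ fun p hp => ?_
    obtain ⟨i, rfl⟩ := (List.mem_ofFn' _ _).1 hp
    cases e : M.epsG g i <;> simp only [e] <;> exact ih i

theorem derivable_cut {s : Sgn} {A : Form M} {x y : Str L (Form M)}
    (hx : Derivable (CalcRule L M sF sG) R (sseq s x (Str.leaf A)))
    (hy : Derivable (CalcRule L M sF sG) R (sseq s (Str.leaf A) y)) :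
    Derivable (CalcRule L M sF sG) R (sseq s x y) := by
  have h1 := sided_sseq.1 hx.sided
  have h2 := sided_sseq.1 hy.sided
  cases s with
  | pos => exact .of_base (.cut x A y) ⟨h1.1, h2.2⟩ (by simpa using ⟨hx, hy⟩)
  | neg => exact .of_base (.cut y A x) ⟨h2.2, h1.1⟩ (by simpa using ⟨hy, hx⟩)

open ClosedPair

/-- The closed pair of a formula. -/
def formPair (A : Form M) : ClosedPair (Derivable (CalcRule L M sF sG) R) :=
  prin _ .pos (Str.leaf A)

/-- For `neg` this is cut on `A`: a structure that proves `A` proves everything that `A` proves. -/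
theorem formPair_sle_prin (s : Sgn) (A : Form M) :
    sle s (formPair R A) (prin (Derivable (CalcRule L M sF sG) R) s (Str.leaf A)) := by
  cases s with
  | pos => exact sle_refl _ _
  | neg =>
    rw [← Sgn.opp_pos, sle_opp, sle_iff]
    intro x hx
    have hx' := (mem_prin_opp (s := .neg) (Str.sided_leaf _ A)).1 hx
    refine (ClosedPair.mem_side _ _ _).2 ⟨hx'.1, fun y hy => ?_⟩
    exact derivable_cut R (s := .pos) hx'.2 ((mem_prin_opp (s := .pos) (Str.sided_leaf _ A)).1 hy).2

theorem mem_formPair (hs : IsCounterpart sF sG) (s : Sgn) (A : Form M) :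
    Str.leaf A ∈ (formPair (sF := sF) (sG := sG) R A).side s := by
  cases s with
  | pos => exact mem_prin (Str.sided_leaf _ _)
  | neg => exact (mem_prin_opp (s := .pos) (Str.sided_leaf _ A)).2 ⟨trivial, derivable_id R hs A⟩

/-- If `S` and the formula `C` are interderivable, they have the same value. -/
theorem ev_eq_formPair (hs : IsCounterpart sF sG)
    {s : Sgn} {S : Str L (Form M)} {C : Form M} (hS : S.Sided s)
    (h1 : ∀ y, Derivable (CalcRule L M sF sG) R (sseq s S y) → y.Sided s.opp →
      Derivable (CalcRule L M sF sG) R (sseq s (Str.leaf C) y))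
    (h2 : Derivable (CalcRule L M sF sG) R (sseq s S (Str.leaf C))) :
    sle s (S.ev (isDisplayFrame_derivable R).closedAlg (formPair (sF := sF) (sG := sG) R) s)
        (formPair R C) ∧
      sle s (formPair (sF := sF) (sG := sG) R C)
        (S.ev (isDisplayFrame_derivable R).closedAlg (formPair (sF := sF) (sG := sG) R) s) := by
  have hsub : S.subst Str.leaf = S := S.subst_leaf
  have hle := (isDisplayFrame_derivable R).ev_sle_prin (σ := Str.leaf)
    (v := formPair (sF := sF) (sG := sG) R) hS
    (Str.All.of_forall (fun t A => ⟨trivial, formPair_sle_prin (sF := sF) (sG := sG) R t A⟩) _ _)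
  have hmem := (isDisplayFrame_derivable R).subst_mem_ev (σ := Str.leaf)
    (v := formPair (sF := sF) (sG := sG) R) hS
    (Str.All.of_forall (fun t A => mem_formPair R hs t A) _ _)
  rw [hsub] at hle hmem
  constructor
  · refine hle.trans ((prin_sle hS).2 ((ClosedPair.mem_side _ _ _).2 ⟨hS, fun y hy => ?_⟩))
    exact derivable_cut R h2 (ClosedPair.derivable (mem_formPair R hs s C) hy)
  · refine (formPair_sle_prin R s C).trans ((prin_sle (Str.sided_leaf _ C)).2 ?_)
    refine (ClosedPair.mem_side _ _ _).2 ⟨trivial, fun y hy => ?_⟩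
    exact h1 y (ClosedPair.derivable hmem hy) (ClosedPair.sided hy)

variable {O : DLEOps M (ClosedPair (Derivable (CalcRule L M sF sG) R))}

/-- The truth lemma; the two signs together give equality up to the preorder. For each compound
formula one logical rule replaces its structural counterpart by the formula, the other together with
identities makes the two interderivable, and `ev_eq_formPair` applies. -/
theorem form_ev_eq_formPair (hs : IsCounterpart sF sG) (hO : Interprets (isDisplayFrame_derivable R).closedAlg O sF sG)
    (s : Sgn) (A : Form M) :
    sle s (A.ev (isDisplayFrame_derivable R).closedAlg O fun p => formPair R (Form.var p))
      (formPair R A) := by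
  have id := derivable_id R hs
  induction A generalizing s with
  | var p => exact sle_refl _ _
  | top =>
    have h := ev_eq_formPair R hs (s := .pos) (S := Str.I) (C := Form.top) trivial
      (fun y hy hys => .of_base (.top_left y) ⟨trivial, hys⟩ (by simpa [sseq] using hy))
      (.of_base .top_right ⟨trivial, trivial⟩ (by simp))
    cases s
    · exact h.1
    · exact h.2
  | bot =>
    have h := ev_eq_formPair R hs (s := .neg) (S := Str.I) (C := Form.bot) trivial
      (fun y hy hys => .of_base (.bot_right y) ⟨hys, trivial⟩ (by simpa [sseq] using hy))
      (.of_base .bot_left ⟨trivial, trivial⟩ (by simp))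
    cases s
    · exact h.2
    · exact h.1
  | and A B ihA ihB =>
    have h := ev_eq_formPair R hs (s := .pos) (S := Str.comma (Str.leaf A) (Str.leaf B))
      (C := Form.and A B) ⟨trivial, trivial⟩
      (fun y hy hys => .of_base (.and_left A B y) ⟨trivial, hys⟩ (by simpa [sseq] using hy))
      (.of_base (.and_right A B _ _) ⟨⟨trivial, trivial⟩, trivial⟩
        (by simpa using ⟨id A, id B⟩))
    cases s
    · exact ((isDisplayFrame_derivable R).closedAlg.meet_mono (s := .pos)
        (ihA .pos) (ihB .pos)).trans h.1
    · exact le_trans h.2 ((isDisplayFrame_derivable R).closedAlg.meet_mono (s := .pos)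
        (ihA .neg) (ihB .neg))
  | or A B ihA ihB =>
    have h := ev_eq_formPair R hs (s := .neg) (S := Str.comma (Str.leaf A) (Str.leaf B))
      (C := Form.or A B) ⟨trivial, trivial⟩
      (fun y hy hys => .of_base (.or_right A B y) ⟨hys, trivial⟩ (by simpa [sseq] using hy))
      (.of_base (.or_left A B _ _) ⟨trivial, ⟨trivial, trivial⟩⟩
        (by simpa using ⟨id A, id B⟩))
    cases s
    · exact le_trans ((isDisplayFrame_derivable R).closedAlg.meet_mono (s := .neg)
        (a := formPair R A) (b := formPair R B) (ihA .pos) (ihB .pos)) h.2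
    · exact ((isDisplayFrame_derivable R).closedAlg.meet_mono (s := .neg)
        (ihA .neg) (ihB .neg)).trans h.1
  | opF f A ih =>
    have h := ev_eq_formPair R hs (s := .pos) (S := sF f fun i => Str.leaf (A i))
      (C := Form.opF f A) (hs.sidedF _ _ fun _ => trivial)
      (fun y hy hys => .of_base (.f_left f A y) ⟨trivial, hys⟩ (by simpa [sseq] using hy))
      (.of_base (.f_right f A _) ⟨hs.sidedF _ _ fun _ => trivial, trivial⟩ fun p hp => by
        obtain ⟨i, rfl⟩ := (List.mem_ofFn' _ _).1 hp
        cases e : M.epsF f i <;> simp only [e] <;> exact id _)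
    rw [hO.evF] at h
    cases s
    · exact le_trans (hO.monoF f fun i => ih i _) h.1
    · exact le_trans h.2 (hO.monoF f fun i => by rw [← sle_opp]; exact ih i _)
  | opG g A ih =>
    have h := ev_eq_formPair R hs (s := .neg) (S := sG g fun i => Str.leaf (A i))
      (C := Form.opG g A) (hs.sidedG _ _ fun _ => trivial)
      (fun y hy hys => .of_base (.g_right g A y) ⟨hys, trivial⟩ (by simpa [sseq] using hy))
      (.of_base (.g_left g A _) ⟨trivial, hs.sidedG _ _ fun _ => trivial⟩ fun p hp => by
        obtain ⟨i, rfl⟩ := (List.mem_ofFn' _ _).1 hp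
        cases e : M.epsG g i <;> simp only [e] <;> exact id _)
    rw [hO.evG] at h
    cases s
    · exact le_trans (hO.monoG g fun i => ih i _) h.2
    · exact le_trans h.1 (hO.monoG g fun i => by rw [← sle_opp]; exact ih i _)

/-- A formula-sequent is derivable if it holds in the algebra of closed pairs. -/
theorem derivable_of_ev_le (hs : IsCounterpart sF sG) (hO : Interprets (isDisplayFrame_derivable R).closedAlg O sF sG)
    {A B : Form M}
    (h : (A.ev (isDisplayFrame_derivable R).closedAlg O fun p => formPair R (Form.var p)) ≤
      B.ev (isDisplayFrame_derivable R).closedAlg O fun p => formPair R (Form.var p)) :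
    Derivable (CalcRule L M sF sG) R (Str.leaf A ⊩ Str.leaf B) := by
  have h1 : sle .pos (formPair R A) (formPair R B) :=
    le_trans (form_ev_eq_formPair R hs hO .neg A) (le_trans h (form_ev_eq_formPair R hs hO .pos B))
  exact ClosedPair.derivable (s := .pos) (sle_iff.1 h1 (mem_formPair R hs .pos A))
    (mem_formPair R hs .neg B)

end Completeness

/-- Sided analytic rules of the calculus are valid in the algebra of closed pairs. -/
theorem validIn_of_mem {R : Set (SRule L)} {ρ : SRule L} (hρ : ρ ∈ R) (ha : ρ.IsAnalytic)
    (hs : ρ.Sided) :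
    ρ.ValidIn (isDisplayFrame_derivable (M := M) (sF := sF) (sG := sG) R).closedAlg :=
  (isDisplayFrame_derivable R).validIn_closedAlg ha hs fun σ hσ hp => .of_rule hρ σ hσ hp

end Calculus

/-! ### Premises without variables -/

namespace SRule

variable {L : DLELang.{u}}

open Classical in
/-- The rule without its variable-free premises. -/
noncomputable def dropConst (ρ : SRule L) : SRule L :=
  ⟨ρ.prems.filter fun c => ∃ x, c.Mem x, ρ.concl⟩

theorem mem_dropConst {ρ : SRule L} {c : StrSeq L ℕ} :
    c ∈ ρ.dropConst.prems ↔ c ∈ ρ.prems ∧ ∃ x, c.Mem x := by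
  simp [dropConst]

theorem IsAnalytic.dropConst {ρ : SRule L} (h : ρ.IsAnalytic) : ρ.dropConst.IsAnalytic where
  c1 c hc := h.c1 c (mem_dropConst.1 hc).1
  c3 := h.c3
  c4 c hc := h.c4 c (mem_dropConst.1 hc).1

theorem Sided.dropConst {ρ : SRule L} (h : ρ.Sided) : ρ.dropConst.Sided :=
  ⟨h.1, fun c hc => h.2 c (mem_dropConst.1 hc).1⟩

theorem _root_.StrSeq.all_of_not_mem {c : StrSeq L ℕ} (h : ¬ ∃ x, c.Mem x)
    (P : Sgn → ℕ → Prop) : c.All P :=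
  StrSeq.all_iff_occ.2 fun t x hx => absurd ⟨x, t, hx⟩ h

variable {B : Type w} [Preorder B]

/-- The variable-free premises of the rule hold. -/
def ConstSat (𝔹 : TenseAlg L B) (ρ : SRule L) : Prop :=
  ∀ c ∈ ρ.prems, (¬ ∃ x, c.Mem x) → ∀ v : ℕ → B, c.SatIn 𝔹 v

theorem ValidIn.dropConst {𝔹 : TenseAlg L B} {ρ : SRule L} (h : ρ.ValidIn 𝔹)
    (hc : ρ.ConstSat 𝔹) : ρ.dropConst.ValidIn 𝔹 := by
  intro v hv
  refine h v fun c hcρ => ?_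
  by_cases hm : ∃ x, c.Mem x
  · exact hv c (mem_dropConst.2 ⟨hcρ, hm⟩)
  · exact hc c hcρ hm v

/-- The truth of a variable-free premise does not depend on the assignment. If one fails, the rule
holds vacuously; otherwise all of them are redundant. -/
theorem validIn_of_dropConst {𝔹 : TenseAlg L B} {ρ : SRule L}
    (h : ρ.ConstSat 𝔹 → ρ.dropConst.ValidIn 𝔹) : ρ.ValidIn 𝔹 := by
  intro v hv
  refine h (fun c hc hm w => ?_) v fun c hc => hv c (mem_dropConst.1 hc).1
  rw [StrSeq.satIn_congr 𝔹 (w := v) (StrSeq.all_of_not_mem hm _)]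
  exact hv c hc

/-- The special rules that localize the rules of `R` whose variable-free premises hold in `𝔹`. -/
def specialRules (𝔹 : TenseAlg L B) (R : Set (SRule L)) : Set (SRule L) :=
  {ρ' | ∃ ρ ∈ R, ρ.Sided ∧ ρ.ConstSat 𝔹 ∧ ∃ z, ρ.dropConst.Localizes z ρ'}

theorem isSpecial_of_mem {𝔹 : TenseAlg L B} {R : Set (SRule L)} (hR : ∀ ρ ∈ R, ρ.IsAnalytic)
    {ρ' : SRule L} (h : ρ' ∈ specialRules 𝔹 R) : ρ'.IsSpecial := by
  obtain ⟨ρ, hρ, -, -, z, hz⟩ := h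
  exact hz.isSpecial (hR ρ hρ).dropConst

theorem validIn_specialRules {𝔹 : TenseAlg L B} {R : Set (SRule L)}
    (hR : ∀ ρ ∈ R, ρ.IsAnalytic) (hv : ∀ ρ ∈ R, ρ.Sided → ρ.ValidIn 𝔹) {ρ' : SRule L}
    (h : ρ' ∈ specialRules 𝔹 R) : ρ'.ValidIn 𝔹 := by
  obtain ⟨ρ, hρ, hs, hc, z, hz⟩ := h
  exact (hz.validIn_iff (hR ρ hρ).dropConst hs.dropConst 𝔹).1 ((hv ρ hρ hs).dropConst hc)

/-- The rules of `R` are valid where their localizations are, provided that the variable-free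
sequents that hold there also hold in `𝔹`. -/
theorem validIn_of_specialRules {𝔹 : TenseAlg L B} {R : Set (SRule L)}
    (hR : ∀ ρ ∈ R, ρ.IsAnalytic) {B' : Type*} [Preorder B'] {𝔹' : TenseAlg L B'}
    (hconst : ∀ c : StrSeq L ℕ, c.Sided → (¬ ∃ x, c.Mem x) → (∀ v, c.SatIn 𝔹' v) →
      ∀ v, c.SatIn 𝔹 v)
    (hv : ∀ ρ' ∈ specialRules 𝔹 R, ρ'.ValidIn 𝔹') {ρ : SRule L} (hρ : ρ ∈ R) (hs : ρ.Sided) :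
    ρ.ValidIn 𝔹' := by
  refine validIn_of_dropConst fun hc => ?_
  obtain ⟨z, ρ', hz⟩ := exists_localizes hs.dropConst fun c hc => (mem_dropConst.1 hc).2
  rw [hz.validIn_iff (hR ρ hρ).dropConst hs.dropConst 𝔹']
  -- Membership in `specialRules` demands the constant premises in `𝔹`, while they are known in
  -- `𝔹'`; `hconst` bridges the two.
  exact hv ρ' ⟨ρ, hρ, hs, fun c hcρ hm => hconst c (hs.2 c hcρ) hm (hc c hcρ hm), z, hz⟩

theorem sided_of_mem {𝔹 : TenseAlg L B} {R : Set (SRule L)} (hR : ∀ ρ ∈ R, ρ.IsAnalytic)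
    {ρ' : SRule L} (h : ρ' ∈ specialRules 𝔹 R) : ρ'.Sided := by
  obtain ⟨ρ, hρ, hs, -, z, hz⟩ := h
  exact hz.sided (hR ρ hρ).dropConst hs.dropConst

end SRule

/-! ### Special displayability -/

theorem isCounterpart_base (L : DLELang.{u}) :
    IsCounterpart (L := L) (M := L) Str.H Str.K where
  sidedF f X h := ⟨rfl, fun j => by rw [Sgn.pos_act]; exact h j⟩
  sidedG g X h := ⟨rfl, fun j => by rw [Sgn.neg_act]; exact h j⟩

theorem interprets_base {L : DLELang.{u}} {B : Type w} [Preorder B] (𝔹 : TenseAlg L B) :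
    Interprets 𝔹 (⟨𝔹.opF, 𝔹.opG⟩ : DLEOps L B) Str.H Str.K where
  evF v f X := by simp only [Str.ev, Sgn.pos_act]
  evG v g X := by simp only [Str.ev, Sgn.neg_act]
  monoF f _ _ h := 𝔹.opF_mono f h
  monoG g _ _ h := 𝔹.opG_mono g h

/-- A derivation in either calculus is interpreted in the algebra of closed pairs of the other,
where its rules are valid, and is read back by completeness. The axioms of the logic play no role.
-/
theorem SpeciallyDisplayable.of_properly {L : DLELang.{u}} {Λ : Set (FSeq L)}
    (h : ProperlyDisplayable L Λ) : SpeciallyDisplayable L Λ := by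
  obtain ⟨hAx, R, hR, hΛ⟩ := h
  set 𝔹 := (isDisplayFrame_derivable (M := L) (sF := Str.H) (sG := Str.K) R).closedAlg with h𝔹
  have hv : ∀ ρ ∈ R, ρ.Sided → ρ.ValidIn 𝔹 := fun ρ hρ hs => validIn_of_mem hρ (hR ρ hρ) hs
  set R' := SRule.specialRules 𝔹 R with hR'
  have ha' : ∀ ρ' ∈ R', ρ'.IsAnalytic := fun ρ' h => (SRule.isSpecial_of_mem hR h).1
  have hv' : ∀ ρ' ∈ R', ρ'.Sided → ρ'.ValidIn 𝔹 := fun ρ' h _ =>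
    SRule.validIn_specialRules hR hv h
  refine ⟨hAx, R', fun ρ' h => SRule.isSpecial_of_mem hR h, fun A B => ?_⟩
  rw [hΛ]
  constructor
  · intro h
    refine derivable_of_ev_le R' (isCounterpart_base L) (interprets_base _) ?_
    refine Derivable.satIn (interprets_base _) hR (fun ρ hρ hs => ?_) _ h
    refine SRule.validIn_of_specialRules hR (𝔹 := 𝔹) (fun c hc hm hsat v => ?_)
      (fun ρ' h => validIn_of_mem h (ha' ρ' h) (SRule.sided_of_mem hR h)) hρ hs
    -- A constant true in the algebra of `R'` is derivable with `R'`, hence true in `𝔹`. As there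
    -- are no variables, the substitution and the assignments are arbitrary fillers.
    have h1 := (isDisplayFrame_derivable R').derivable_subst (σ := fun _ => Str.I)
      (v := fun _ => formPair R' Form.top) hc (StrSeq.all_of_not_mem hm _) (hsat _)
    have h2 := Derivable.satIn (interprets_base 𝔹) ha' hv' (fun _ => formPair R Form.top) h1
    rwa [StrSeq.satIn_subst 𝔹 (w := v) (StrSeq.all_of_not_mem hm _)] at h2
  · intro h
    refine derivable_of_ev_le R (isCounterpart_base L) (interprets_base _) ?_
    exact Derivable.satIn (interprets_base 𝔹) ha' hv' _ h

/-! ### Interpretation of the expanded language -/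

section Star

variable {L : DLELang.{u}}

/-- The operations of a tense algebra that interpret the expanded language. -/
def TenseAlg.star {B : Type w} [Preorder B] (𝔹 : TenseAlg L B) : DLEOps L.star B where
  opF c := match c with
    | .base f => fun a => 𝔹.opF f a
    | .coimp => fun a => 𝔹.gt .pos (a (0 : Fin 2)) (a (1 : Fin 2))
    | .coimp' => fun a => 𝔹.lt .pos (a (0 : Fin 2)) (a (1 : Fin 2))
    | .adjF f i _ => fun a => 𝔹.resF f i a
    | .adjG g i _ => fun a => 𝔹.resG g i a
  opG c := match c with
    | .base g => fun a => 𝔹.opG g a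
    | .imp => fun a => 𝔹.gt .neg (a (0 : Fin 2)) (a (1 : Fin 2))
    | .imp' => fun a => 𝔹.lt .neg (a (0 : Fin 2)) (a (1 : Fin 2))
    | .adjF f i _ => fun a => 𝔹.resF f i a
    | .adjG g i _ => fun a => 𝔹.resG g i a

theorem isCounterpart_star (L : DLELang.{u}) :
    IsCounterpart (L := L) (M := L.star) (strF L) (strG L) where
  sidedF c X h := by
    cases c with
    | base f => exact ⟨rfl, fun j => by rw [Sgn.pos_act]; exact h j⟩
    | coimp => exact ⟨h (0 : Fin 2), h (1 : Fin 2)⟩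
    | coimp' => exact ⟨h (0 : Fin 2), h (1 : Fin 2)⟩
    | adjF f i e => exact ⟨by rw [e]; rfl, fun j => by rw [Sgn.pos_act]; exact h j⟩
    | adjG g i e => exact ⟨e.symm, fun j => by rw [Sgn.pos_act]; exact h j⟩
  sidedG c X h := by
    cases c with
    | base g => exact ⟨rfl, fun j => by rw [Sgn.neg_act]; exact h j⟩
    | imp => exact ⟨h (0 : Fin 2), h (1 : Fin 2)⟩
    | imp' => exact ⟨h (0 : Fin 2), h (1 : Fin 2)⟩
    | adjF f i e => exact ⟨by rw [e]; rfl, fun j => by rw [Sgn.neg_act]; exact h j⟩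
    | adjG g i e => exact ⟨e.symm, fun j => by rw [Sgn.neg_act]; exact h j⟩

theorem interprets_star {B : Type w} [Preorder B] (𝔹 : TenseAlg L B) :
    Interprets 𝔹 𝔹.star (strF L) (strG L) where
  evF v c X := by
    cases c <;> simp only [strF, Str.ev, Sgn.pos_act] <;> rfl
  evG v c X := by
    cases c <;> simp only [strG, Str.ev, Sgn.neg_act] <;> rfl
  monoF c a b h := by
    cases c with
    | base f => exact 𝔹.opF_mono f h
    | coimp => exact 𝔹.gt_mono (s := .pos) (h (0 : Fin 2)) (h (1 : Fin 2))
    | coimp' => exact 𝔹.lt_mono (s := .pos) (h (0 : Fin 2)) (h (1 : Fin 2))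
    | adjF f i e => exact 𝔹.resF_mono f i h
    | adjG g i e => exact 𝔹.resG_mono g i h
  monoG c a b h := by
    cases c with
    | base g => exact 𝔹.opG_mono g h
    | imp =>
      exact 𝔹.gt_mono (s := .neg) (a := b (0 : Fin 2)) (a' := a (0 : Fin 2))
        (h (0 : Fin 2)) (h (1 : Fin 2))
    | imp' =>
      exact 𝔹.lt_mono (s := .neg) (b := b (1 : Fin 2)) (b' := a (1 : Fin 2))
        (h (0 : Fin 2)) (h (1 : Fin 2))
    | adjF f i e => exact 𝔹.resF_mono f i h
    | adjG g i e => exact 𝔹.resG_mono g i h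

/-! ### Translating structural terms into formulas of the expanded language -/

namespace Form

/-- The connective `f♯ᵢ`, which belongs to `F*` or to `G*` according to `ε_f(i)`. -/
def resF (f : L.F) (i : Fin (L.arF f)) (a : Fin (L.arF f) → Form L.star) : Form L.star :=
  match h : L.epsF f i with
  | .pos => opG (L := L.star) (StarG.adjF f i h) a
  | .neg => opF (L := L.star) (StarF.adjF f i h) a

/-- The connective `g♭ᵢ`, which belongs to `F*` or to `G*` according to `ε_g(i)`. -/
def resG (g : L.G) (i : Fin (L.arG g)) (a : Fin (L.arG g) → Form L.star) : Form L.star :=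
  match h : L.epsG g i with
  | .pos => opF (L := L.star) (StarF.adjG g i h) a
  | .neg => opG (L := L.star) (StarG.adjG g i h) a

theorem resF_pos {f : L.F} {i : Fin (L.arF f)} (h : L.epsF f i = .pos)
    (a : Fin (L.arF f) → Form L.star) :
    resF f i a = opG (L := L.star) (StarG.adjF f i h) a := by
  unfold resF; split <;> rename_i e <;> first | rfl | exact absurd (h.symm.trans e) (by simp)

theorem resF_neg {f : L.F} {i : Fin (L.arF f)} (h : L.epsF f i = .neg)
    (a : Fin (L.arF f) → Form L.star) :
    resF f i a = opF (L := L.star) (StarF.adjF f i h) a := by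
  unfold resF; split <;> rename_i e <;> first | rfl | exact absurd (h.symm.trans e) (by simp)

theorem resG_pos {g : L.G} {i : Fin (L.arG g)} (h : L.epsG g i = .pos)
    (a : Fin (L.arG g) → Form L.star) :
    resG g i a = opF (L := L.star) (StarF.adjG g i h) a := by
  unfold resG; split <;> rename_i e <;> first | rfl | exact absurd (h.symm.trans e) (by simp)

theorem resG_neg {g : L.G} {i : Fin (L.arG g)} (h : L.epsG g i = .neg)
    (a : Fin (L.arG g) → Form L.star) :
    resG g i a = opG (L := L.star) (StarG.adjG g i h) a := by
  unfold resG; split <;> rename_i e <;> first | rfl | exact absurd (h.symm.trans e) (by simp)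

end Form

namespace Str

/-- The formula of the expanded language that interprets a structural term in position `s`. -/
def form : Sgn → Str L ℕ → Form L.star
  | _, leaf x => .var x
  | .pos, I => .top
  | .neg, I => .bot
  | .pos, comma S T => .and (form .pos S) (form .pos T)
  | .neg, comma S T => .or (form .neg S) (form .neg T)
  | .pos, gt S T => .opF (L := L.star) StarF.coimp ![form .neg S, form .pos T]
  | .neg, gt S T => .opG (L := L.star) StarG.imp ![form .pos S, form .neg T]
  | .pos, lt S T => .opF (L := L.star) StarF.coimp' ![form .pos S, form .neg T]
  | .neg, lt S T => .opG (L := L.star) StarG.imp' ![form .neg S, form .pos T]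
  | s, H f X => .opF (L := L.star) (StarF.base f) fun j => form (s.act (L.epsF f j)) (X j)
  | s, K g X => .opG (L := L.star) (StarG.base g) fun j => form (s.act (L.epsG g j)) (X j)
  | s, Hres f i X => Form.resF f i fun j => form (s.act (adjEps (L.epsF f) i j)) (X j)
  | s, Kres g i X => Form.resG g i fun j => form (s.act (adjEps (L.epsG g) i j)) (X j)

/-- Structural connectives are read in precedent position as `⊤`, `∧` or members of `F*`, in
succedent position as `⊥`, `∨` or members of `G*`: sidedness matches the grammar of primitive
formulas. -/
theorem prim_form {s : Sgn} {S : Str L ℕ} (h : S.Sided s) : (S.form s).Prim s := by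
  induction S generalizing s with
  | leaf a => simp [form, Form.Prim]
  | I => cases s <;> simp [form, Form.Prim]
  | comma S T ihS ihT =>
    cases s
    · exact ⟨ihS h.1, ihT h.2⟩
    · exact ⟨ihS h.1, ihT h.2⟩
  | gt S T ihS ihT =>
    cases s
    · exact ⟨rfl, Fin.forall_fin_two.2 ⟨ihS h.1, ihT h.2⟩⟩
    · exact ⟨rfl, Fin.forall_fin_two.2 ⟨ihS h.1, ihT h.2⟩⟩
  | lt S T ihS ihT =>
    cases s
    · exact ⟨rfl, Fin.forall_fin_two.2 ⟨ihS h.1, ihT h.2⟩⟩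
    · exact ⟨rfl, Fin.forall_fin_two.2 ⟨ihS h.1, ihT h.2⟩⟩
  | H f X ih => simp only [form]; exact ⟨h.1, fun j => ih j (h.2 j)⟩
  | K g X ih => simp only [form]; exact ⟨h.1, fun j => ih j (h.2 j)⟩
  | Hres f i X ih =>
    simp only [form]
    have h1 := h.1
    cases e : L.epsF f i with
    | pos => rw [Form.resF_pos e]; exact ⟨by rw [h1, e]; rfl, fun j => ih j (h.2 j)⟩
    | neg => rw [Form.resF_neg e]; exact ⟨by rw [h1, e]; rfl, fun j => ih j (h.2 j)⟩
  | Kres g i X ih =>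
    simp only [form]
    have h1 := h.1
    cases e : L.epsG g i with
    | pos => rw [Form.resG_pos e]; exact ⟨by rw [h1, e], fun j => ih j (h.2 j)⟩
    | neg => rw [Form.resG_neg e]; exact ⟨by rw [h1, e], fun j => ih j (h.2 j)⟩

theorem occ_form (s : Sgn) (S : Str L ℕ) (t : Sgn) (p : ℕ) :
    (S.form s).occ t p = S.occ t p := by
  induction S generalizing s t with
  | leaf a => simp [form, Form.occ, occ]
  | I => cases s <;> simp [form, Form.occ, occ]
  | comma S T ihS ihT => cases s <;> simp [form, Form.occ, occ, ihS, ihT]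
  | gt S T ihS ihT => cases s <;> simp [form, Form.occ, occ, ihS, ihT]
  | lt S T ihS ihT => cases s <;> simp [form, Form.occ, occ, ihS, ihT]
  | H f X ih => simp [form, Form.occ, occ, ih]
  | K g X ih => simp [form, Form.occ, occ, ih]
  | Hres f i X ih =>
    simp only [form, occ]
    cases e : L.epsF f i with
    | pos => simp [Form.resF_pos e, Form.occ, ih]
    | neg => simp [Form.resF_neg e, Form.occ, ih]
  | Kres g i X ih =>
    simp only [form, occ]
    cases e : L.epsG g i with
    | pos => simp [Form.resG_pos e, Form.occ, ih]
    | neg => simp [Form.resG_neg e, Form.occ, ih]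

theorem ev_form {B : Type w} [Preorder B] (𝔹 : TenseAlg L B) (v : ℕ → B) (s : Sgn)
    (S : Str L ℕ) : (S.form s).ev 𝔹 𝔹.star v = S.ev 𝔹 v s := by
  induction S generalizing s with
  | leaf a => simp [form, Form.ev, ev]
  | I => cases s <;> simp [form, Form.ev, ev]
  | comma S T ihS ihT => cases s <;> simp [form, Form.ev, ev, ihS, ihT]
  | gt S T ihS ihT => cases s <;> exact congrArg₂ (𝔹.gt _) (ihS _) (ihT _)
  | lt S T ihS ihT => cases s <;> exact congrArg₂ (𝔹.lt _) (ihS _) (ihT _)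
  | H f X ih => simp only [form, ev]; exact congrArg _ (funext fun j => ih j _)
  | K g X ih => simp only [form, ev]; exact congrArg _ (funext fun j => ih j _)
  | Hres f i X ih =>
    simp only [form, ev]
    cases e : L.epsF f i with
    | pos => rw [Form.resF_pos e]; exact congrArg _ (funext fun j => ih j _)
    | neg => rw [Form.resF_neg e]; exact congrArg _ (funext fun j => ih j _)
  | Kres g i X ih =>
    simp only [form, ev]
    cases e : L.epsG g i with
    | pos => rw [Form.resG_pos e]; exact congrArg _ (funext fun j => ih j _)
    | neg => rw [Form.resG_neg e]; exact congrArg _ (funext fun j => ih j _)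

end Str

end Star

/-! ### Tense logics -/

section Tense

variable {L : DLELang.{u}} {Ax : Set (FSeq L.star)}

theorem LogicRule.mem_tenseLogic {ps : List (FSeq L.star)} {c : FSeq L.star}
    (h : LogicRule L.star ps c) (hp : ∀ p ∈ ps, p ∈ tenseLogic L Ax) : c ∈ tenseLogic L Ax :=
  Gen.step ps c (Or.inl h) hp

theorem Residuation.mem_tenseLogic_iff {c d : FSeq L.star} (h : Residuation L c d) :
    c ∈ tenseLogic L Ax ↔ d ∈ tenseLogic L Ax := by
  constructor
  · exact fun hc => Gen.step [c] d (Or.inr (Or.inl ⟨c, rfl, Or.inl h⟩))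
      (List.forall_mem_singleton.2 hc)
  · exact fun hd => Gen.step [d] c (Or.inr (Or.inl ⟨d, rfl, Or.inr h⟩))
      (List.forall_mem_singleton.2 hd)

theorem subset_tenseLogic : Ax ⊆ tenseLogic L Ax :=
  fun c hc => Gen.step [] c (Or.inr (Or.inr ⟨rfl, hc⟩)) (by simp)

theorem tenseLogic_subset {Ax' : Set (FSeq L.star)} (h : Ax ⊆ tenseLogic L Ax') :
    tenseLogic L Ax ⊆ tenseLogic L Ax' := by
  intro c hc
  induction hc with
  | step ps c hr hp ih =>
    rcases hr with hr | ⟨d, rfl, hr⟩ | ⟨rfl, hr⟩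
    · exact hr.mem_tenseLogic ih
    · have hd := ih d (by simp)
      rcases hr with hr | hr
      · exact hr.mem_tenseLogic_iff.1 hd
      · exact hr.mem_tenseLogic_iff.2 hd
    · exact h hr

/-- The formulas of the expanded language, preordered by the tense logic with axioms `Ax`. -/
def Lind (L : DLELang.{u}) (_Ax : Set (FSeq L.star)) : Type u := Form L.star

instance : Preorder (Lind L Ax) where
  le φ ψ := ((φ, ψ) : FSeq L.star) ∈ tenseLogic L Ax
  le_refl φ := (LogicRule.refl φ).mem_tenseLogic (by simp)
  le_trans φ χ ψ h hψ := (LogicRule.cut φ χ ψ).mem_tenseLogic (by simp [h, hψ])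

/-- The tense algebra of formulas. -/
def lindAlg (L : DLELang.{u}) (Ax : Set (FSeq L.star)) : TenseAlg L (Lind L Ax) where
  unit s := match s with
    | .pos => Form.top (L := L.star)
    | .neg => Form.bot (L := L.star)
  meet s := match s with
    | .pos => Form.and (L := L.star)
    | .neg => Form.or (L := L.star)
  gt s a b := match s with
    | .pos => Form.opF (L := L.star) StarF.coimp ![a, b]
    | .neg => Form.opG (L := L.star) StarG.imp ![a, b]
  lt s a b := match s with
    | .pos => Form.opF (L := L.star) StarF.coimp' ![a, b]
    | .neg => Form.opG (L := L.star) StarG.imp' ![a, b]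
  opF f a := Form.opF (L := L.star) (StarF.base f) a
  opG g a := Form.opG (L := L.star) (StarG.base g) a
  resF f i a := Form.resF f i a
  resG g i a := Form.resG g i a
  sle_unit s a := by
    cases s
    · exact (LogicRule.le_top (L := L.star) a).mem_tenseLogic (by simp)
    · exact (LogicRule.bot_le (L := L.star) a).mem_tenseLogic (by simp)
  sle_meet s a b c := by
    cases s
    · refine ⟨fun h => ⟨le_trans h ?_, le_trans h ?_⟩, fun h => ?_⟩
      · exact (LogicRule.and_le_left (L := L.star) a b).mem_tenseLogic (by simp)
      · exact (LogicRule.and_le_right (L := L.star) a b).mem_tenseLogic (by simp)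
      · exact (LogicRule.and_intro (L := L.star) c a b).mem_tenseLogic
          (List.forall_mem_cons.2 ⟨h.1, List.forall_mem_singleton.2 h.2⟩)
    · refine ⟨fun h => ⟨le_trans (α := Lind L Ax) ?_ h, le_trans (α := Lind L Ax) ?_ h⟩,
        fun h => ?_⟩
      · exact (LogicRule.le_or_left (L := L.star) a b).mem_tenseLogic (by simp)
      · exact (LogicRule.le_or_right (L := L.star) a b).mem_tenseLogic (by simp)
      · exact (LogicRule.or_elim (L := L.star) a b c).mem_tenseLogic
          (List.forall_mem_cons.2 ⟨h.1, List.forall_mem_singleton.2 h.2⟩)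
  gt_res s a b c := by
    cases s
    · exact (Residuation.coimp b a c).mem_tenseLogic_iff.symm
    · exact (Residuation.imp a c b).mem_tenseLogic_iff.symm
  lt_res s a b c := by
    cases s
    · exact (Residuation.coimp' a c b).mem_tenseLogic_iff.symm
    · exact (Residuation.imp' c b a).mem_tenseLogic_iff.symm
  f_res f i a b := by
    cases h : L.epsF f i with
    | pos =>
      have h1 := (Residuation.f_pos f i a b h).mem_tenseLogic_iff (Ax := Ax)
      rw [← Form.resF_pos h] at h1
      exact h1
    | neg =>
      have h1 := (Residuation.f_neg f i a b h).mem_tenseLogic_iff (Ax := Ax)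
      rw [← Form.resF_neg h] at h1
      exact h1
  g_res g i a b := by
    cases h : L.epsG g i with
    | pos =>
      have h1 := (Residuation.g_pos g i a b h).mem_tenseLogic_iff (Ax := Ax)
      rw [← Form.resG_pos h] at h1
      exact h1
    | neg =>
      have h1 := (Residuation.g_neg g i a b h).mem_tenseLogic_iff (Ax := Ax)
      rw [← Form.resG_neg h] at h1
      exact h1

/-- The value of a formula in the algebra of formulas is a substitution instance of it. -/
theorem ev_lindAlg (σ : ℕ → Form L.star) (A : Form L.star) :
    A.ev (lindAlg L Ax) (lindAlg L Ax).star (B := Lind L Ax) σ = A.subst σ := by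
  have two : ∀ a : Fin 2 → Form L.star, ![a 0, a 1] = a := fun a => by
    funext i; fin_cases i <;> rfl
  induction A with
  | var p => rfl
  | top => rfl
  | bot => rfl
  | and φ ψ ih ih' => exact congrArg₂ Form.and ih ih'
  | or φ ψ ih ih' => exact congrArg₂ Form.or ih ih'
  | opF c a ih =>
    have ih := funext ih
    simp only [Form.subst, ← ih]
    cases c with
    | base f => rfl
    | coimp =>
      exact congrArg (Form.opF (L := L.star) StarF.coimp)
        (two fun x => (a x).ev (lindAlg L Ax) (lindAlg L Ax).star (B := Lind L Ax) σ)
    | coimp' =>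
      exact congrArg (Form.opF (L := L.star) StarF.coimp')
        (two fun x => (a x).ev (lindAlg L Ax) (lindAlg L Ax).star (B := Lind L Ax) σ)
    | adjF f i h => exact Form.resF_neg h _
    | adjG g i h => exact Form.resG_pos h _
  | opG c a ih =>
    have ih := funext ih
    simp only [Form.subst, ← ih]
    cases c with
    | base f => rfl
    | imp =>
      exact congrArg (Form.opG (L := L.star) StarG.imp)
        (two fun x => (a x).ev (lindAlg L Ax) (lindAlg L Ax).star (B := Lind L Ax) σ)
    | imp' =>
      exact congrArg (Form.opG (L := L.star) StarG.imp')
        (two fun x => (a x).ev (lindAlg L Ax) (lindAlg L Ax).star (B := Lind L Ax) σ)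
    | adjF f i h => exact Form.resF_pos h _
    | adjG g i h => exact Form.resG_neg h _

theorem Form.subst_var {M : DLELang.{u}} (A : Form M) : A.subst Form.var = A := by
  induction A with
  | var p => rfl
  | top => rfl
  | bot => rfl
  | and φ ψ ih ih' => exact congrArg₂ Form.and ih ih'
  | or φ ψ ih ih' => exact congrArg₂ Form.or ih ih'
  | opF c a ih => exact congrArg _ (funext ih)
  | opG c a ih => exact congrArg _ (funext ih)

theorem mem_tenseLogic_subst {φ ψ : Form L.star} (h : (φ, ψ) ∈ tenseLogic L Ax)
    (σ : ℕ → Form L.star) : (φ.subst σ, ψ.subst σ) ∈ tenseLogic L Ax :=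
  (LogicRule.subst σ φ ψ).mem_tenseLogic (List.forall_mem_singleton.2 h)

/-- Assignments into the algebra of formulas are substitutions: the identity substitution gives one
direction, closure of the logic under substitution the other. -/
theorem ev_le_lindAlg_iff {φ ψ : Form L.star} :
    (∀ σ : ℕ → Lind L Ax, φ.ev (lindAlg L Ax) (lindAlg L Ax).star σ ≤
      ψ.ev (lindAlg L Ax) (lindAlg L Ax).star σ) ↔ (φ, ψ) ∈ tenseLogic L Ax := by
  constructor
  · intro h
    have := h (Form.var (L := L.star))
    rw [ev_lindAlg, ev_lindAlg, Form.subst_var, Form.subst_var] at this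
    exact this
  · intro h σ
    have h1 := mem_tenseLogic_subst h σ
    rw [← ev_lindAlg (Ax := Ax) σ φ, ← ev_lindAlg (Ax := Ax) σ ψ] at h1
    exact h1

end Tense

/-! ### The primitive inequality of a special rule -/

namespace SRule

variable {L : DLELang.{u}}

/-- The antecedent of the inequality of a rule `(z ⊢ Tᵢ)ᵢ / z ⊢ T`. -/
def tail (z : ℕ) : List (StrSeq L ℕ) → Form L.star
  | [] => .var z
  | c :: l => .and (c.suc.form .neg) (tail z l)

theorem prim_tail (z : ℕ) {l : List (StrSeq L ℕ)} (h : ∀ c ∈ l, c.Sided) :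
    (tail z l).Prim .neg := by
  induction l with
  | nil => simp [tail, Form.Prim]
  | cons c l ih =>
    exact ⟨Str.prim_form (h c (by simp)).2, ih fun d hd => h d (by simp [hd])⟩

theorem occ_tail {z : ℕ} {l : List (StrSeq L ℕ)} {t : Sgn} {p : ℕ}
    (h : 0 < (tail z l).occ t p) : (p = z ∧ t = .pos) ∨ ∃ c ∈ l, 0 < c.suc.occ t p := by
  induction l with
  | nil =>
    simp only [tail, Form.occ] at h
    split_ifs at h with h'
    · exact Or.inl ⟨h'.1.symm, h'.2⟩
    · simp at h
  | cons c l ih =>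
    simp only [tail, Form.occ, Str.occ_form, add_pos_iff] at h
    rcases h with h | h
    · exact Or.inr ⟨c, by simp, h⟩
    · exact (ih h).imp_right fun ⟨d, hd, h⟩ => ⟨d, by simp [hd], h⟩

theorem le_tail_ev_iff {B : Type w} [Preorder B] (𝔹 : TenseAlg L B) (v : ℕ → B) (z : ℕ)
    (l : List (StrSeq L ℕ)) (b : B) :
    b ≤ (tail z l).ev 𝔹 𝔹.star v ↔ b ≤ v z ∧ ∀ c ∈ l, b ≤ c.suc.ev 𝔹 v .neg := by
  induction l with
  | nil => simp [tail, Form.ev]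
  | cons c l ih =>
    have := 𝔹.sle_meet .pos ((c.suc.form .neg).ev 𝔹 𝔹.star v) ((tail z l).ev 𝔹 𝔹.star v) b
    simp only [sle_pos, ih, Str.ev_form] at this
    simp only [tail, Form.ev, Str.ev_form, this, List.forall_mem_cons]
    tauto

variable {ρ : SRule L} {z : ℕ}

/-- The head is the succedent of the conclusion, scattered by C3. In the tail every letter other
than `z` has the sign that it has in the head, by C1 and C4; `z` occurs only positively there and is
absent from the head. -/
theorem primitiveIneq_tail (ha : ρ.IsAnalytic) (hs : ρ.Sided)
    (hz : ∀ c ∈ ρ.concl :: ρ.prems, c.ant = Str.leaf z ∧ ¬ c.suc.Mem z) :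
    (tail z ρ.prems).PrimitiveIneq (ρ.concl.suc.form .neg) := by
  have hc := hz _ List.mem_cons_self
  have hocc : ∀ t x, x ≠ z → ρ.concl.occ t x = ρ.concl.suc.occ t.opp x := fun t x hx => by
    simp [StrSeq.occ, hc.1, Str.occ, hx.symm]
  have h0 : ∀ t, ρ.concl.suc.occ t z = 0 := fun t => by
    by_contra h
    exact hc.2 ⟨t, Nat.pos_of_ne_zero h⟩
  have hscat : ∀ x, ρ.concl.suc.occ .pos x + ρ.concl.suc.occ .neg x ≤ 1 := fun x => by
    by_cases hx : x = z
    · subst hx; simp [h0]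
    · have := ha.c3 x
      rw [hocc _ _ hx, hocc _ _ hx] at this
      simpa [add_comm] using this
  have hprem : ∀ t x, x ≠ z → 0 < (tail z ρ.prems).occ t x → 0 < ρ.concl.suc.occ t x := by
    intro t x hx h
    rcases occ_tail h with h | ⟨c, hcρ, h⟩
    · exact absurd h.1 hx
    · have h1 := (isAnalytic_iff.1 ha).2 c hcρ
      rw [StrSeq.all_iff_occ] at h1
      have h2 := h1 t.opp x (by simp only [StrSeq.occ, Sgn.opp_opp]; omega)
      rwa [hocc _ _ hx, Sgn.opp_opp] at h2
  have hsc : ∀ t x, 0 < ρ.concl.suc.occ t x → ρ.concl.suc.occ t.opp x = 0 := fun t x h => by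
    have := hscat x
    cases t <;> simp only [Sgn.opp_pos, Sgn.opp_neg] <;> omega
  have hzneg : (tail z ρ.prems).occ .neg z = 0 := by
    by_contra h
    rcases occ_tail (Nat.pos_of_ne_zero h) with h | ⟨c, hcρ, h⟩
    · exact absurd h.2 (by simp)
    · exact (hz c (List.mem_cons_of_mem _ hcρ)).2 ⟨_, h⟩
  refine Or.inr ⟨prim_tail z hs.2, Str.prim_form hs.1.2, fun p => ?_, fun p t => ?_, fun p => ?_⟩
  · simpa only [Str.occ_form] using hscat p
  · rw [Str.occ_form]
    by_cases hp : p = z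
    · subst hp; exact Or.inr (h0 _)
    · rcases Nat.eq_zero_or_pos ((tail z ρ.prems).occ t p) with h | h
      · exact Or.inl h
      · exact Or.inr (hsc t p (hprem t p hp h))
  · by_cases hp : p = z
    · subst hp; exact Or.inr hzneg
    · rcases Nat.eq_zero_or_pos ((tail z ρ.prems).occ .pos p) with h | h
      · exact Or.inl h
      · rcases Nat.eq_zero_or_pos ((tail z ρ.prems).occ .neg p) with h' | h'
        · exact Or.inr h'
        · have h1 := hsc _ _ (hprem _ p hp h)
          have h2 := hprem _ p hp h'
          simp only [Sgn.opp_pos] at h1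
          omega

/-- A special rule is valid where its inequality is. -/
theorem validIn_iff_tail_le
    (hz : ∀ c ∈ ρ.concl :: ρ.prems, c.ant = Str.leaf z ∧ ¬ c.suc.Mem z)
    {B : Type w} [Preorder B] (𝔹 : TenseAlg L B) :
    ρ.ValidIn 𝔹 ↔ ∀ v : ℕ → B, (tail z ρ.prems).ev 𝔹 𝔹.star v ≤
      (ρ.concl.suc.form .neg).ev 𝔹 𝔹.star v := by
  have hsat : ∀ c ∈ ρ.concl :: ρ.prems, ∀ v : ℕ → B,
      c.SatIn 𝔹 v ↔ v z ≤ c.suc.ev 𝔹 v .neg := fun c hc v => by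
    unfold StrSeq.SatIn
    rw [(hz c hc).1]
    rfl
  have hupd : ∀ c ∈ ρ.concl :: ρ.prems, ∀ (v : ℕ → B) (b : B),
      c.suc.ev 𝔹 (Function.update v z b) .neg = c.suc.ev 𝔹 v .neg := fun c hc v b => by
    refine Str.ev_congr 𝔹 ((Str.all_iff_occ _ _).2 fun t x hx => ?_)
    rw [Function.update_of_ne]
    rintro rfl
    exact (hz c hc).2 ⟨t, hx⟩
  simp only [Str.ev_form]
  constructor
  · intro h v
    have h1 := (le_tail_ev_iff 𝔹 v z ρ.prems _).1 le_rfl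
    -- With `z` set to the value of the tail, the premises hold automatically; as `z` is absent from
    -- all succedents, their values do not change.
    have h2 := h (Function.update v z ((tail z ρ.prems).ev 𝔹 𝔹.star v)) fun c hc => by
      rw [hsat c (List.mem_cons_of_mem _ hc), hupd c (List.mem_cons_of_mem _ hc),
        Function.update_self]
      exact h1.2 c hc
    rwa [hsat _ List.mem_cons_self, hupd _ List.mem_cons_self, Function.update_self] at h2
  · intro h v hv
    rw [hsat _ List.mem_cons_self]
    refine le_trans ((le_tail_ev_iff 𝔹 v z ρ.prems _).2 ⟨le_rfl, fun c hc => ?_⟩) (h v)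
    exact (hsat c (List.mem_cons_of_mem _ hc) v).1 (hv c hc)

end SRule

/-! ### Properly displayable tense logics -/

/-- The inequalities of the special rules hold in `𝔹`, so they belong to `Λ` by completeness.
Conversely, the original rules are valid in the algebra of formulas of the logic they axiomatize, so
soundness puts all of `Λ` into that logic. -/
theorem ProperlyDisplayableStar.exists_primitive {L : DLELang.{u}} {Λ : Set (FSeq L.star)}
    (h : ProperlyDisplayableStar L Λ) :
    ∃ P : Set (FSeq L.star), (∀ s ∈ P, s.1.PrimitiveIneq s.2) ∧ Λ = tenseLogic L P := by
  obtain ⟨⟨Ax, hAx⟩, R, hR, hΛ⟩ := h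
  set 𝔹 := (isDisplayFrame_derivable (M := L.star) (sF := strF L) (sG := strG L) R).closedAlg
  have hv : ∀ ρ ∈ R, ρ.Sided → ρ.ValidIn 𝔹 := fun ρ hρ hs => validIn_of_mem hρ (hR ρ hρ) hs
  have hint := interprets_star 𝔹
  have of_ev : ∀ {A B : Form L.star}, (∀ v, A.ev 𝔹 𝔹.star v ≤ B.ev 𝔹 𝔹.star v) →
      (A, B) ∈ Λ := fun h => (hΛ _ _).2 <|
    derivable_of_ev_le R (isCounterpart_star L) hint (h _)
  have to_ev : ∀ {A B : Form L.star}, (A, B) ∈ Λ → ∀ v, A.ev 𝔹 𝔹.star v ≤ B.ev 𝔹 𝔹.star v :=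
    fun h v => Derivable.satIn hint hR hv v ((hΛ _ _).1 h)
  set P : Set (FSeq L.star) := {s | ∃ ρ ∈ SRule.specialRules 𝔹 R, ∃ z,
    (∀ c ∈ ρ.concl :: ρ.prems, c.ant = Str.leaf z ∧ ¬ c.suc.Mem z) ∧
    s = (SRule.tail z ρ.prems, ρ.concl.suc.form .neg)} with hP
  have hPΛ : tenseLogic L P ⊆ Λ := by
    rw [hAx]
    refine tenseLogic_subset ?_
    rw [← hAx]
    rintro s ⟨ρ, hρ, z, hz, rfl⟩
    exact of_ev ((SRule.validIn_iff_tail_le hz 𝔹).1 (SRule.validIn_specialRules hR hv hρ))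
  refine ⟨P, ?_, Set.Subset.antisymm ?_ hPΛ⟩
  · rintro s ⟨ρ, hρ, z, hz, rfl⟩
    exact SRule.primitiveIneq_tail (SRule.isSpecial_of_mem hR hρ).1 (SRule.sided_of_mem hR hρ) hz
  · rintro ⟨A, B⟩ hAB
    rw [← ev_le_lindAlg_iff]
    intro σ
    refine Derivable.satIn (interprets_star (lindAlg L P)) hR (fun ρ hρ hs => ?_) σ
      ((hΛ _ _).1 hAB)
    refine SRule.validIn_of_specialRules hR (𝔹 := 𝔹) (fun c hc hm hsat v => ?_)
      (fun ρ' h => ?_) hρ hs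
    -- A constant true in the algebra of formulas is a theorem of the logic of `P`, which is
    -- contained in `Λ`; hence it is true in `𝔹`.
    · have h1 : (c.ant.form .pos, c.suc.form .neg) ∈ tenseLogic L P := by
        rw [← ev_le_lindAlg_iff]
        intro σ
        rw [Str.ev_form, Str.ev_form]
        exact hsat σ
      have h2 := to_ev (hPΛ h1) v
      rwa [Str.ev_form, Str.ev_form] at h2
    · obtain ⟨ρ, hρ, -, -, z, hz⟩ := id h
      have hz' := (hz.isSpecial_left (hR ρ hρ).dropConst).2
      rw [SRule.validIn_iff_tail_le hz', ev_le_lindAlg_iff]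
      exact subset_tenseLogic ⟨ρ', h, z, hz', rfl⟩

theorem mainTheorem3 (L : DLELang.{u}) :
    (∀ ρ : SRule L, ρ.IsAnalytic → ρ.Sided → (∀ c ∈ ρ.prems, ∃ x, c.Mem x) →
      ∃ ρ' : SRule L, ρ'.IsSpecial ∧ ρ'.Sided ∧
        ∀ (A : Type v) [CompletelyDistribLattice A] (𝔸 : DLEOps L A), 𝔸.IsPerfect →
          (ρ.Valid 𝔸 ↔ ρ'.Valid 𝔸)) ∧
    (∀ Λ : Set (FSeq L), ProperlyDisplayable L Λ → SpeciallyDisplayable L Λ) ∧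
    (∀ Λ : Set (FSeq L.star), ProperlyDisplayableStar L Λ →
      ∃ P : Set (FSeq L.star), (∀ s ∈ P, s.1.PrimitiveIneq s.2) ∧ Λ = tenseLogic L P) :=
  ⟨fun _ ha hs hm => SRule.exists_special_equiv ha hs hm,
    fun _ h => SpeciallyDisplayable.of_properly h,
    fun _ h => ProperlyDisplayableStar.exists_primitive h⟩
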